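/- Let $D$ be an unoriented link diagram on the sphere (or the plane) with $N$ crossings, numbered in some order. A Kauffman state $s$ of $D$ assigns a marker $+1$ or $-1$ to each crossing; $D_s$ is the system of circles obtained by smoothing all crossings according to $s$, where the marker $+1$ joins the two regions swept by the over-strand when it is turned counterclockwise and the marker $-1$ joins the other two; $|s|$ is the number of circles of $D_s$. Let $s_+$ and $s_-$ be the states with only positive and only negative markers. An enhanced state $S$ is a state $s$ together with a sign $\pm$ for each circle of $D_s$; let $\sigma(S)$ be the number of positive minus the number of negative markers, and $\tau(S)$ the number of positive minus the number of negative circles. Let $\mathcal C_{i,j}(D)$ be the free abelian group on the enhanced states with $\sigma(S)=i$ and $\sigma(S)+2\tau(S)=j$, and let $d:\mathcal C_{i,j}(D)\to\mathcal C_{i-2,j}(D)$, $d(S)=\sum_{S'}(-1)^{t(S:S')}[S:S']\,S'$, where $[S:S']=1$ if the markers of $S$ and $S'\in\mathcal C_{i-2,j}(D)$ differ at exactly one crossing $v$ and all circles not touching $v$ have the same sign in $S$ and $S'$, $[S:S']=0$ otherwise, and $t(S:S')$ is the number of negative markers of $S$ at crossings bigger than $v$. The Khovanov homology of $D$ is $H_{i,j}(D)=\ker(d|_{\mathcal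 C_{i,j}(D)})/d(\mathcal C_{i+2,j}(D))$. For integers $k_1,k_2$, call $D$ $H$-$(k_1,k_2)$-thick if $H_{i,j}(D)=0$ for all $i,j$, with the possible exception of those with $$N-2|s_-|-4k_2\le j-2i\le 2|s_+|-N+4k_1 .$$ Call $D$ $H$-$k$-thick if it is $H$-$(k_1,k_2)$-thick for some integers $k_1,k_2$ with $k\ge k_1+k_2+\tfrac12(|s_+|+|s_-|-N)$. **Corollary.** Let $D$ be a non-split (that is, connected and non-empty) alternating link diagram without nugatory crossings, where a crossing is nugatory if some simple closed curve meets $D$ only in this crossing and passes there from one corner to the opposite one. Then $D$ is $H$-$(0,0)$-thick and $H$-$1$-thick. Thus its Khovanov homology lies on two adjacent diagonals of slope $2$: one has $2|s_+|-N=(N-2|s_-|)+4$, and $H_{i,j}(D)\neq 0$ only if $j-2i=N-2|s_-|$ or $j-2i=2|s_+|-N$. -/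

import Mathlib

/-- An unoriented link diagram on the two-sphere, with `X` as its ordered set of crossings.
The four arms at a crossing `c` are `(c, 0), (c, 1), (c, 2), (c, 3)`, listed counterclockwise;
`(c, 0)` and `(c, 2)` lie on the under-strand, `(c, 1)` and `(c, 3)` on the over-strand.
`glue` says which two arms are the two ends of the same edge of the diagram.
Components of the diagram without crossings are not seen by the arms: there are `circles` of them.
For a connected diagram these data determine the diagram up to isotopy of the sphere; for a
disconnected one the relative position of its connected pieces, on which neither the
circles of the smoothed diagrams nor the Khovanov homology depend, is not recorded. -/
structure LinkDiagram (X : Type*) [Fintype X] where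
  /-- the other end of the edge that starts at a given arm -/
  glue : X × Fin 4 → X × Fin 4
  /-- the number of crossingless components -/
  circles : ℕ
  glue_glue : ∀ a, glue (glue a) = a
  glue_ne : ∀ a, glue a ≠ a
  /-- Planarity, through Euler's formula. The arm `(c, i)` also names the corner at `c` between the
  arms `i` and `i + 1`. Walking along the arm `(c, i)` with this corner on the left one arrives
  at the arm `(c', j) = glue (c, i)`, and the next corner of the same face is `(c', j - 1)`.
  The underlying 4-valent graph has `V = N` vertices and `E = 2 N` edges, and it is drawn on spheres
  (one for each component of the graph) iff `V - E + F = 2 * #components`. -/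
  euler :
    Nat.card (Quot fun a b : X × Fin 4 => b = ((glue a).1, (glue a).2 - 1)) =
      Fintype.card X + 2 * Nat.card (Quot fun x y : X => ∃ i, (glue (x, i)).1 = y)

namespace LinkDiagram

variable {X : Type*} [Fintype X] (D : LinkDiagram X)

/-- The next corner of the same face; corners are named by arms as explained at `euler`. -/
def nextCorner (a : X × Fin 4) : X × Fin 4 := ((D.glue a).1, (D.glue a).2 - 1)

/-- The faces of the diagram, as classes of corners. -/
def Face : Type _ := Quot fun a b : X × Fin 4 => b = D.nextCorner a

/-- The face in which a corner lies. -/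
def face (a : X × Fin 4) : D.Face := Quot.mk _ a

/-- The connected components of the diagram, seen as a subset of the sphere. -/
def Piece : Type _ := (Quot fun x y : X => ∃ i, (D.glue (x, i)).1 = y) ⊕ Fin D.circles

/-- A diagram is non-split if, as a subset of the sphere, it is connected (and not empty). -/
def NonSplit : Prop := Nat.card D.Piece = 1

/-- An arm on the over-strand of its crossing. -/
def IsOver (a : X × Fin 4) : Prop := a.2 = 1 ∨ a.2 = 3

/-- Alternating: along each component over- and under-passes alternate, that is, each edge
has one end on an over-strand and one end on an under-strand. -/
def Alternating : Prop := ∀ a, IsOver (D.glue a) ↔ ¬ IsOver a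

/-- A crossing is nugatory if there is a simple closed curve on the sphere which meets the diagram
in this crossing only and crosses it there from a corner to the opposite corner, that is, if
two opposite corners at the crossing belong to the same face. -/
def Nugatory (c : X) : Prop := ∃ i : Fin 4, D.face (c, i) = D.face (c, i + 2)

/-! ### Kauffman states -/

/-- The arm at the same crossing to which an arm is joined by the smoothing. The positive marker
(`true`) opens a channel between the two regions which the over-strand sweeps when it is
turned counterclockwise, hence joins `0` with `1` and `2` with `3`; the negative marker
(`false`) joins `0` with `3` and `1` with `2`. -/
def smoothArm : Bool → Fin 4 → Fin 4
  | true => ![1, 0, 3, 2]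
  | false => ![3, 2, 1, 0]

/-- The circles of the smoothed diagram `D_s`, for a state `s : X → Bool` (`true` is the
marker `+1`, `false` is the marker `-1`). -/
def Circle (s : X → Bool) : Type _ :=
  (Quot fun a b : X × Fin 4 => b = D.glue a ∨ b = (a.1, smoothArm (s a.1) a.2)) ⊕ Fin D.circles

/-- The circle of `D_s` through a given arm. -/
def circleOf (s : X → Bool) (a : X × Fin 4) : D.Circle s := Sum.inl (Quot.mk _ a)

/-- A crossingless component, as a circle of `D_s`. -/
def freeCircle (s : X → Bool) (f : Fin D.circles) : D.Circle s := Sum.inr f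

instance (s : X → Bool) : Finite (D.Circle s) := by unfold Circle; infer_instance

/-- The number of circles of `D_s`. -/
noncomputable def numCircles (s : X → Bool) : ℕ := Nat.card (D.Circle s)

/-- The number of circles of the state all of whose markers are positive. -/
noncomputable def sPlus : ℕ := D.numCircles fun _ => true

/-- The number of circles of the state all of whose markers are negative. -/
noncomputable def sMinus : ℕ := D.numCircles fun _ => false

/-- Enhanced Kauffman states: a state with a sign (`true` is `+`) for each circle of `D_s`. -/
structure EnhancedState where
  /-- the markers of the crossings -/
  marker : X → Bool
  /-- the signs of the circles -/
  sign : D.Circle marker → Bool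

instance : Finite D.EnhancedState :=
  Finite.of_injective (β := (s : X → Bool) × (D.Circle s → Bool))
    (fun S => ⟨S.marker, S.sign⟩) (by rintro ⟨s, e⟩ ⟨s', e'⟩ h; cases h; rfl)

noncomputable instance : Fintype D.EnhancedState := Fintype.ofFinite _

variable {D}

/-- The number of positive markers minus the number of negative markers. -/
def EnhancedState.sigma (S : D.EnhancedState) : ℤ :=
  ((Finset.univ.filter fun x => S.marker x = true).card : ℤ) -
    ((Finset.univ.filter fun x => S.marker x = false).card : ℤ)

/-- The number of positive circles minus the number of negative circles. -/
noncomputable def EnhancedState.tau (S : D.EnhancedState) : ℤ :=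
  (Nat.card {c // S.sign c = true} : ℤ) - (Nat.card {c // S.sign c = false} : ℤ)

/-- `S ∈ 𝒮_{i,j}(D)`. -/
def EnhancedState.HasDegree (S : D.EnhancedState) (i j : ℤ) : Prop :=
  S.sigma = i ∧ S.sigma + 2 * S.tau = j

/-- The incidence condition `[S : S'] = 1` at the crossing `v`: the bidegree drops by `(2, 0)`,
the markers of `S` and `S'` differ exactly at `v`, and every circle that does not touch `v` (a
circle of `D_S` through an arm `a`, which is then also the circle of `D_{S'}` through `a`,
or a crossingless component) has the same sign in `S` and in `S'`. -/
def Incident (v : X) (S S' : D.EnhancedState) : Prop :=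
  S'.HasDegree (S.sigma - 2) (S.sigma + 2 * S.tau) ∧
  (∀ x, S.marker x ≠ S'.marker x ↔ x = v) ∧
  (∀ a, (∀ k, D.circleOf S.marker (v, k) ≠ D.circleOf S.marker a) →
    S.sign (D.circleOf S.marker a) = S'.sign (D.circleOf S'.marker a)) ∧
  (∀ f, S.sign (D.freeCircle S.marker f) = S'.sign (D.freeCircle S'.marker f))

/-! ### Khovanov homology -/

open Classical in
/-- The coefficient `(-1)^{t(S : S')} [S : S']` of `S'` in `d S`, where `t(S : S')` is the number of
crossings bigger than `v` with negative marker in `S`. At most one term of the sum is not zero. -/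
noncomputable def coeff [LinearOrder X] (S S' : D.EnhancedState) : ℤ :=
  ∑ v : X, if Incident v S S' then
    (-1) ^ (Finset.univ.filter fun x => v < x ∧ S.marker x = false).card else 0

variable (D)

/-- The subgroup `𝒞_{i,j}(D)` of the free abelian group `𝒞(D)` on the enhanced states. -/
noncomputable def chains (i j : ℤ) : Submodule ℤ (D.EnhancedState →₀ ℤ) :=
  Finsupp.supported ℤ ℤ {S | S.HasDegree i j}

/-- The differential of the Khovanov chain complex `𝒞(D)`. -/
noncomputable def d [LinearOrder X] : (D.EnhancedState →₀ ℤ) →ₗ[ℤ] (D.EnhancedState →₀ ℤ) :=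
  Finsupp.linearCombination ℤ fun S => ∑ S', Finsupp.single S' (coeff S S')

/-- The kernel of `d` on `𝒞_{i,j}(D)`. -/
noncomputable def cycles [LinearOrder X] (i j : ℤ) : Submodule ℤ (D.EnhancedState →₀ ℤ) :=
  D.chains i j ⊓ LinearMap.ker D.d

/-- The image under `d` of `𝒞_{i+2,j}(D)`. -/
noncomputable def boundaries [LinearOrder X] (i j : ℤ) : Submodule ℤ (D.EnhancedState →₀ ℤ) :=
  (D.chains (i + 2) j).map D.d

/-- The Khovanov homology group `H_{i,j}(D)`, with integer coefficients. -/
abbrev Homology [LinearOrder X] (i j : ℤ) : Type _ :=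
  D.cycles i j ⧸ (D.boundaries i j).submoduleOf (D.cycles i j)

/-- `D` is `H`-`(k₁, k₂)`-thick: `H_{i,j}(D) = 0` with a possible exception of `i, j` with
`N - 2 |s₋| - 4 k₂ ≤ j - 2 i ≤ 2 |s₊| - N + 4 k₁`. -/
def HThickPair [LinearOrder X] (k₁ k₂ : ℤ) : Prop :=
  ∀ i j : ℤ,
    ¬ ((Fintype.card X : ℤ) - 2 * D.sMinus - 4 * k₂ ≤ j - 2 * i ∧
        j - 2 * i ≤ 2 * (D.sPlus : ℤ) - Fintype.card X + 4 * k₁) →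
      Subsingleton (D.Homology i j)

/-- `D` is `H`-`k`-thick: it is `H`-`(k₁, k₂)`-thick for some `k₁, k₂` with
`k ≥ k₁ + k₂ + (|s₊| + |s₋| - N) / 2`. -/
def HThick [LinearOrder X] (k : ℤ) : Prop :=
  ∃ k₁ k₂ : ℤ, D.HThickPair k₁ k₂ ∧
    (k : ℚ) ≥ k₁ + k₂ + 1 / 2 * ((D.sPlus : ℚ) + D.sMinus - Fintype.card X)

end LinkDiagram

/-! A connected alternating diagram has as many circles in its two extreme states as connectedness
permits. Its faces correspond to the circles of `s₊` and `s₋` together, so Euler's formula gives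
|s₊| + |s₋| = N + 2 (`sPlus_add_sMinus`). For any connected cube of smoothings, the two extreme
states have together at most two circles more than there are free crossings
(`ConnectedOn.classCount_add_classCount_le`). A cube attaining this bound is called thin, and the
heart of the proof is `Thin.onTwoDiagonals`: the homology of a thin cube lives on two adjacent
values of j - 2i.

That is shown by induction on the number of free crossings. Suppose first that changing the marker
at some crossing merges circles at both extreme states. Then both faces of the cube at this crossing
are thin with the same two diagonals, and the exact sequence of a subcomplex and its quotient
applies (`ExactOn.extension`). Otherwise every crossing splits a circle at one of the extreme
states. If the face reached there were connected, its circles would exceed the bound; so every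
crossing has a marker that disconnects the cube. A crossing cutting off a minimal side `Z` cuts off
a single circle without further crossings (`exists_separates_forall_notMem`). As for a first
Reidemeister move, all states but those with marker `m` at the crossing and sign `m` on `Z` form an
acyclic part (`ConnectedOn.exactOn_complement`), and what remains is a smaller thin cube with the
same diagonals. Without free crossings there is one free circle, whose two signs give the two
diagonals.

The induction is carried out for `MarkerSystem`, cubes of equivalence relations in which every
change of a marker is a merge or a split. An alternating diagram gives one, because its circles are
the cycles of a permutation of the under-arms and a change of marker multiplies this permutation by
a transposition (`circlePerm_flipAt`). That the differential squares to zero comes from the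
commutation of merge and split maps (`edgeMap_edgeMap_comm`): these maps commute with multiplication
by signs, so it suffices to compare them on the unit. -/

set_option linter.unusedSectionVars false

/-! ### Subquotients of a based complex -/

section BasedComplex

variable {B ι : Type*} [Fintype B]

/-- The subquotient spanned by `G` of the based complex with matrix `M` is exact in degree `n`. -/
def ExactOn (M : B → B → ℤ) (deg : B → ι) (up : ι → ι) (G : Set B) (n : ι) : Prop :=
  ∀ z : B → ℤ, (∀ b, z b ≠ 0 → b ∈ G ∧ deg b = n) → (∀ c ∈ G, ∑ b, z b * M b c = 0) →
    ∃ y : B → ℤ, (∀ b, y b ≠ 0 → b ∈ G ∧ deg b = up n) ∧ ∀ c ∈ G, ∑ b, y b * M b c = z c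

/-- A set of basis elements which spans a subquotient. -/
def IsSubquotient (M : B → B → ℤ) (G : Set B) : Prop :=
  ∀ b c e, b ∈ G → e ∈ G → M b c ≠ 0 → M c e ≠ 0 → c ∈ G

variable {M : B → B → ℤ} {deg : B → ι} {up : ι → ι} {G U : Set B} {n : ι}

open Classical in
-- Every two-step path between elements of `G` has its middle in `G`, so truncating the boundary to
-- `G` loses no term and the square of the differential still vanishes.
theorem sum_boundary_boundary (hM : ∀ b e, ∑ c, M b c * M c e = 0) (hG : IsSubquotient M G)
    {y : B → ℤ} (hy : ∀ b, y b ≠ 0 → b ∈ G) {e : B} (he : e ∈ G) :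
    ∑ c, (if c ∈ G then ∑ b, y b * M b c else 0) * M c e = 0 := by
  have h1 : ∀ c, (if c ∈ G then ∑ b, y b * M b c else 0) * M c e
      = ∑ b, y b * (M b c * M c e) := by
    intro c
    split_ifs with hc
    · rw [Finset.sum_mul]
      exact Finset.sum_congr rfl fun b _ => by ring
    · rw [zero_mul]
      symm
      refine Finset.sum_eq_zero fun b _ => ?_
      by_contra h
      have hyb : y b ≠ 0 := fun h0 => h (by simp [h0])
      have h2 : M b c ≠ 0 := fun h0 => h (by simp [h0])
      have h3 : M c e ≠ 0 := fun h0 => h (by simp [h0])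
      exact hc (hG b c e (hy b hyb) he h2 h3)
  rw [Finset.sum_congr rfl fun c _ => h1 c, Finset.sum_comm]
  refine Finset.sum_eq_zero fun b _ => ?_
  rw [← Finset.mul_sum, hM, mul_zero]

open Classical in
-- This is exactness in the middle of the long homology sequence: bound the cycle in the quotient `G
-- \ U` first, subtract that boundary, and bound what is left in the subcomplex `G ∩ U`.
theorem ExactOn.extension (hM : ∀ b e, ∑ c, M b c * M c e = 0)
    (hdeg : ∀ b c, M b c ≠ 0 → deg b = up (deg c)) (hup : Function.Injective up)
    (hG : IsSubquotient M G) (hUW : ∀ b ∈ G ∩ U, ∀ c ∈ G \ U, M b c = 0)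
    (hU : ExactOn M deg up (G ∩ U) n) (hW : ExactOn M deg up (G \ U) n) :
    ExactOn M deg up G n := by
  intro z hz hz0
  obtain ⟨y, hy, hyz⟩ := hW (fun b => if b ∈ U then 0 else z b)
    (by
      intro b hb
      have hbU : b ∉ U := fun h => hb (if_pos h)
      simp only [hbU, if_false] at hb
      exact ⟨⟨(hz b hb).1, hbU⟩, (hz b hb).2⟩)
    (by
      intro c hc
      refine Eq.trans (Finset.sum_congr rfl fun b _ => ?_) (hz0 c hc.1)
      split_ifs with hb
      · by_cases h0 : z b = 0
        · simp [h0]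
        · rw [hUW b ⟨(hz b h0).1, hb⟩ c hc]; simp
      · rfl)
  have hyG : ∀ b, y b ≠ 0 → b ∈ G := fun b hb => (hy b hb).1.1
  obtain ⟨x, hx, hxz⟩ := hU (fun c => z c - if c ∈ G then ∑ b, y b * M b c else 0)
    (by
      intro c hc
      by_cases hcG : c ∈ G
      · refine ⟨⟨hcG, ?_⟩, ?_⟩
        · by_contra hcU
          apply hc
          have := hyz c ⟨hcG, hcU⟩
          simp only [hcU, if_false] at this
          simp [hcG, this]
        · by_cases h0 : z c = 0
          · have : ∑ b, y b * M b c ≠ 0 := by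
              intro h; apply hc; simp [h0, h]
            obtain ⟨b, -, hb⟩ := Finset.exists_ne_zero_of_sum_ne_zero this
            have h1 := hdeg b c (right_ne_zero_of_mul hb)
            rw [(hy b (left_ne_zero_of_mul hb)).2] at h1
            exact (hup h1).symm
          · exact (hz c h0).2
      · exfalso
        apply hc
        have : z c = 0 := by
          by_contra h; exact hcG (hz c h).1
        simp [hcG, this])
    (by
      intro e he
      simp only [sub_mul, Finset.sum_sub_distrib]
      rw [hz0 e he.1, sum_boundary_boundary hM hG hyG he.1, sub_zero])
  refine ⟨fun b => x b + y b, ?_, ?_⟩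
  · intro b hb
    by_cases h : x b = 0
    · have : y b ≠ 0 := by intro h'; exact hb (by simp [h, h'])
      exact ⟨(hy b this).1.1, (hy b this).2⟩
    · exact ⟨(hx b h).1.1, (hx b h).2⟩
  · intro c hc
    simp only [add_mul, Finset.sum_add_distrib]
    by_cases hcU : c ∈ U
    · rw [hxz c ⟨hc, hcU⟩]; simp [hc]
    · have h0 : ∑ b, x b * M b c = 0 := by
        refine Finset.sum_eq_zero fun b _ => ?_
        by_cases h : x b = 0
        · simp [h]
        · rw [hUW b (hx b h).1 c ⟨hc, hcU⟩, mul_zero]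
      rw [h0, zero_add, hyz c ⟨hc, hcU⟩]
      simp [hcU]

open Classical in
/-- A subquotient is exact if its matrix from the quotient `G \ U` to the subcomplex `G ∩ U` is
a signed permutation matrix. -/
theorem exactOn_of_matching (hM : ∀ b e, ∑ c, M b c * M c e = 0)
    (hdeg : ∀ b c, M b c ≠ 0 → deg b = up (deg c)) (hG : IsSubquotient M G)
    (f : B → B) (f' : B → B) (hf : ∀ b ∈ G \ U, f b ∈ G ∩ U ∧ f' (f b) = b)
    (hf' : ∀ c ∈ G ∩ U, f' c ∈ G \ U ∧ f (f' c) = c)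
    (hunit : ∀ b ∈ G \ U, M b (f b) * M b (f b) = 1)
    (hzero : ∀ b ∈ G \ U, ∀ c ∈ G ∩ U, c ≠ f b → M b c = 0) :
    ExactOn M deg up G n := by
  intro z hz hz0
  -- `y` is the preimage under the matching of the `U`-part of `z`; a matched entry has square 1, so
  -- it is its own inverse.
  set y : B → ℤ := fun b => if b ∈ G \ U then M b (f b) * z (f b) else 0 with hydef
  have hy : ∀ b, y b ≠ 0 → b ∈ G \ U ∧ deg b = up n := by
    intro b hb
    have hbG : b ∈ G \ U := by
      by_contra h; exact hb (if_neg h)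
    simp only [hydef, if_pos hbG] at hb
    refine ⟨hbG, ?_⟩
    rw [hdeg b _ (left_ne_zero_of_mul hb), (hz _ (right_ne_zero_of_mul hb)).2]
  have hsum : ∀ x : B → ℤ, (∀ b, x b ≠ 0 → b ∈ G \ U) → ∀ c ∈ G ∩ U,
      ∑ b, x b * M b c = x (f' c) * M (f' c) c := by
    intro x hx c hc
    refine Finset.sum_eq_single _ (fun b _ hb => ?_) (by simp)
    by_cases h : x b = 0
    · simp [h]
    · rw [hzero b (hx b h) c hc, mul_zero]
      rintro rfl
      exact hb (hf b (hx b h)).2.symm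
  have hyz : ∀ c ∈ G ∩ U, ∑ b, y b * M b c = z c := by
    intro c hc
    rw [hsum y (fun b hb => (hy b hb).1) c hc]
    have h1 := (hf' c hc).1
    have h2 := hunit _ h1
    have h3 := (hf' c hc).2
    simp only [hydef, if_pos h1]
    rw [h3] at h2 ⊢
    linear_combination z c * h2
  have hyG : ∀ b, y b ≠ 0 → b ∈ G := fun b hb => (hy b hb).1.1
  set x : B → ℤ := fun c => if c ∈ G then z c - ∑ b, y b * M b c else 0 with hxdef
  have hx : ∀ b, x b ≠ 0 → b ∈ G \ U := by
    intro b hb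
    have hbG : b ∈ G := by
      by_contra h; exact hb (if_neg h)
    refine ⟨hbG, fun hU => hb ?_⟩
    simp only [hxdef, if_pos hbG]
    rw [hyz b ⟨hbG, hU⟩, sub_self]
  have hxM : ∀ e ∈ G, ∑ c, x c * M c e = 0 := by
    intro e he
    have h1 : ∀ c, x c * M c e
        = z c * M c e - (if c ∈ G then ∑ b, y b * M b c else 0) * M c e := by
      intro c
      simp only [hxdef]
      split_ifs with h
      · ring
      · have : z c = 0 := by
          by_contra h'; exact h (hz c h').1
        simp [this]
    rw [Finset.sum_congr rfl fun c _ => h1 c, Finset.sum_sub_distrib, hz0 e he,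
      sum_boundary_boundary hM hG hyG he, sub_zero]
  -- The cycle `x = z - dy` is supported off `U`, so the coordinate of its boundary at `f b` is `x
  -- b` times a unit and nothing else.
  have hx0 : ∀ b ∈ G \ U, x b = 0 := by
    intro b hb
    have h1 := hsum x hx (f b) (hf b hb).1
    rw [hxM _ (hf b hb).1.1, (hf b hb).2] at h1
    have h2 := hunit b hb
    have h3 : x b = x b * M b (f b) * M b (f b) := by rw [mul_assoc, h2, mul_one]
    rw [h3, ← h1, zero_mul]
  refine ⟨y, fun b hb => ⟨hyG b hb, (hy b hb).2⟩, fun c hc => ?_⟩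
  by_cases hcU : c ∈ U
  · exact hyz c ⟨hc, hcU⟩
  · have := hx0 c ⟨hc, hcU⟩
    simp only [hxdef, if_pos hc] at this
    linarith

/-- A subquotient is exact if its matrix from the quotient `G \ U` to the subcomplex `G ∩ U` is
a signed permutation matrix. -/
theorem exactOn_of_existsUnique (hM : ∀ b e, ∑ c, M b c * M c e = 0)
    (hdeg : ∀ b c, M b c ≠ 0 → deg b = up (deg c)) (hG : IsSubquotient M G)
    (hunit : ∀ b c, M b c ≠ 0 → M b c * M b c = 1)
    (h : ∀ b ∈ G \ U, ∃ c ∈ G ∩ U, M b c ≠ 0 ∧ ∀ c' ∈ G ∩ U, M b c' ≠ 0 → c' = c)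
    (h' : ∀ c ∈ G ∩ U, ∃ b ∈ G \ U, M b c ≠ 0 ∧ ∀ b' ∈ G \ U, M b' c ≠ 0 → b' = b) :
    ExactOn M deg up G n := by
  classical
  choose! f hf1 hf2 hf3 using h
  choose! f' hf1' hf2' hf3' using h'
  refine exactOn_of_matching (U := U) hM hdeg hG f f' ?_ ?_ ?_ ?_
  · exact fun b hb => ⟨hf1 b hb, (hf3' _ (hf1 b hb) b hb (hf2 b hb)).symm⟩
  · exact fun c hc => ⟨hf1' c hc, (hf3 _ (hf1' c hc) c hc (hf2' c hc)).symm⟩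
  · exact fun b hb => hunit b _ (hf2 b hb)
  · intro b hb c hc hne
    by_contra h0
    exact hne (hf3 b hb c hc h0)

theorem IsSubquotient.inter (hG : IsSubquotient M G)
    (hUW : ∀ b ∈ G ∩ U, ∀ c ∈ G \ U, M b c = 0) : IsSubquotient M (G ∩ U) := by
  intro b c e hb he hbc hce
  have hc := hG b c e hb.1 he.1 hbc hce
  exact ⟨hc, by_contra fun h => hbc (hUW b hb c ⟨hc, h⟩)⟩

theorem IsSubquotient.sdiff (hG : IsSubquotient M G)
    (hUW : ∀ b ∈ G ∩ U, ∀ c ∈ G \ U, M b c = 0) : IsSubquotient M (G \ U) := by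
  intro b c e hb he hbc hce
  have hc := hG b c e hb.1 he.1 hbc hce
  exact ⟨hc, fun h => hce (hUW c ⟨hc, h⟩ e he)⟩

theorem exactOn_of_forall_ne (h : ∀ b ∈ G, deg b ≠ n) : ExactOn M deg up G n := by
  intro z hz _
  have hz0 : ∀ b, z b = 0 := fun b => by
    by_contra hb; exact h b (hz b hb).1 (hz b hb).2
  exact ⟨fun _ => 0, by simp, fun c _ => by simp [hz0]⟩

end BasedComplex

/-! ### Merging two classes of an equivalence relation -/

section ClassSum

variable {T : Type*}

/-- `r'` arises from `r` by merging the two different classes of `a` and `b`. -/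
def Merges (r r' : Setoid T) (a b : T) : Prop :=
  ¬ r a b ∧ ∀ x y, r' x y ↔ r x y ∨ ((r x a ∨ r x b) ∧ (r y a ∨ r y b))

theorem Merges.le {r r' : Setoid T} {a b : T} (h : Merges r r' a b) {x y : T} (hxy : r x y) :
    r' x y := (h.2 x y).2 (Or.inl hxy)

theorem Merges.rel {r r' : Setoid T} {a b : T} (h : Merges r r' a b) : r' a b :=
  (h.2 a b).2 (Or.inr ⟨Or.inl (r.refl a), Or.inr (r.refl b)⟩)

theorem Merges.symm {r r' : Setoid T} {a b : T} (h : Merges r r' a b) : Merges r r' b a :=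
  ⟨fun h' => h.1 (r.symm h'), fun x y => by rw [h.2 x y, or_comm (a := r x a), or_comm (a := r y a)]⟩

theorem Merges.rel_left_iff {r r' : Setoid T} {a b : T} (h : Merges r r' a b) (x : T) :
    r' x a ↔ r x a ∨ r x b := by
  rw [h.2 x a]
  constructor
  · rintro (h | h)
    · exact Or.inl h
    · exact h.1
  · intro h
    exact Or.inr ⟨h, Or.inl (r.refl a)⟩

theorem Merges.rel_iff_of_not {r r' : Setoid T} {a b : T} (h : Merges r r' a b) {x : T}
    (hx : ¬ r' x a) (y : T) : r' x y ↔ r x y := by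
  rw [h.rel_left_iff] at hx
  rw [h.2 x y]
  tauto

variable [Fintype T]

open Classical in
/-- The sum of a function which is constant on the classes of `r`, over these classes. -/
noncomputable def classSum (r : Setoid T) (f : T → ℚ) : ℚ :=
  ∑ t, f t / (Finset.univ.filter fun u => r t u).card

open Classical in
theorem card_class_ne_zero (r : Setoid T) (t : T) :
    ((Finset.univ.filter fun u => r t u).card : ℚ) ≠ 0 := by
  rw [Nat.cast_ne_zero]
  exact Finset.card_ne_zero_of_mem (a := t) (by simp)

open Classical in
-- The weights are inverse class sizes, so a class with `n` points contributes `n` equal terms `f a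
-- / n`.
theorem sum_class (r : Setoid T) (f : T → ℚ) (a : T) (hf : ∀ t, r a t → f t = f a) :
    ∑ t with r a t, f t / (Finset.univ.filter fun u => r t u).card = f a := by
  have : ∀ t ∈ Finset.univ.filter fun t => r a t,
      f t / (Finset.univ.filter fun u => r t u).card
        = f a / (Finset.univ.filter fun u => r a u).card := by
    intro t ht
    have ht : r a t := by simpa using ht
    rw [hf t ht]
    congr 3
    ext u
    simp only [Finset.mem_filter, Finset.mem_univ, true_and]
    exact ⟨fun h => r.trans ht h, fun h => r.trans (r.symm ht) h⟩
  rw [Finset.sum_congr rfl this, Finset.sum_const, nsmul_eq_mul]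
  field_simp [card_class_ne_zero r a]

open Classical in
theorem classSum_eq_add (r : Setoid T) (f : T → ℚ) (a : T) (hf : ∀ t, r a t → f t = f a) :
    classSum r f = f a + ∑ t with ¬ r a t, f t / (Finset.univ.filter fun u => r t u).card := by
  rw [classSum, ← Finset.sum_filter_add_sum_filter_not _ (fun t => r a t), sum_class r f a hf]

theorem classSum_congr_class (r : Setoid T) (f f' : T → ℚ) (a : T) (hf : ∀ t, r a t → f t = f a)
    (hf' : ∀ t, r a t → f' t = f' a) (h : ∀ t, ¬ r a t → f' t = f t) :
    classSum r f' = classSum r f + f' a - f a := by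
  classical
  rw [classSum_eq_add r f a hf, classSum_eq_add r f' a hf']
  have : ∑ t with ¬ r a t, f' t / ((Finset.univ.filter fun u => r t u).card : ℚ)
      = ∑ t with ¬ r a t, f t / ((Finset.univ.filter fun u => r t u).card : ℚ) :=
    Finset.sum_congr rfl fun t ht => by rw [h t (by simpa using ht)]
  rw [this]; ring

/-- The classes of `a` and `b` contribute `f a + f b` before the merge and `f' a` after it. All
other classes are the same sets for both relations. -/
theorem Merges.classSum_eq {r r' : Setoid T} {a b : T} (hm : Merges r r' a b) (f f' : T → ℚ)
    (hf : ∀ x y, r x y → f x = f y) (hf' : ∀ x y, r' x y → f' x = f' y)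
    (h : ∀ t, ¬ r t a → ¬ r t b → f' t = f t) :
    classSum r' f' = classSum r f + f' a - f a - f b := by
  classical
  have h0 := Finset.sum_filter_add_sum_filter_not Finset.univ (fun t => r a t)
    fun t => f t / ((Finset.univ.filter fun u => r t u).card : ℚ)
  rw [classSum_eq_add r' f' a fun t ht => (hf' _ _ ht).symm, classSum, ← h0,
    sum_class r f a fun t ht => (hf _ _ ht).symm,
    ← Finset.sum_filter_add_sum_filter_not (Finset.univ.filter fun t => ¬ r a t) (fun t => r b t)]
  have h1 : (Finset.univ.filter fun t => ¬ r a t).filter (fun t => r b t)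
      = Finset.univ.filter fun t => r b t := by
    ext t
    simp only [Finset.mem_filter, Finset.mem_univ, true_and, and_iff_right_iff_imp]
    exact fun hb ha => hm.1 (r.trans ha (r.symm hb))
  rw [h1, sum_class r f b fun t ht => (hf _ _ ht).symm]
  have h2 : ∑ t with ¬ r' a t, f' t / ((Finset.univ.filter fun u => r' t u).card : ℚ)
      = ∑ t ∈ (Finset.univ.filter fun t => ¬ r a t).filter (fun t => ¬ r b t),
          f t / ((Finset.univ.filter fun u => r t u).card : ℚ) := by
    have h3 : ∀ t, r' a t ↔ r a t ∨ r b t := by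
      intro t
      rw [r'.comm', hm.rel_left_iff, r.comm', r.comm' (x := t)]
    refine Finset.sum_congr ?_ fun t ht => ?_
    · ext t
      simp [h3]
    · have ht' : ¬ r a t ∧ ¬ r b t := by simpa using ht
      have h4 : ¬ r' t a := by
        rw [r'.comm', h3]; tauto
      rw [h t (fun h => ht'.1 (r.symm h)) (fun h => ht'.2 (r.symm h))]
      congr 3
      ext u
      simp [hm.rel_iff_of_not h4 u]
  rw [h2]; ring

open Classical in
/-- The number of classes of `r` contained in a union `Y` of classes. -/
noncomputable def classCount (r : Setoid T) (Y : Set T) : ℚ :=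
  classSum r fun t => if t ∈ Y then 1 else 0

theorem Merges.classCount_eq {r r' : Setoid T} {a b : T} (hm : Merges r r' a b) {Y : Set T}
    (hY : ∀ x y, r' x y → x ∈ Y → y ∈ Y) (ha : a ∈ Y) :
    classCount r' Y = classCount r Y - 1 := by
  classical
  have hY' : ∀ x y, r' x y → (x ∈ Y ↔ y ∈ Y) := fun x y h => ⟨hY x y h, hY y x (r'.symm h)⟩
  have hb : b ∈ Y := hY a b hm.rel ha
  rw [classCount, hm.classSum_eq (fun t => if t ∈ Y then 1 else 0) _
    (fun x y h => by simp [hY' x y (hm.le h)]) (fun x y h => by simp [hY' x y h])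
    (fun _ _ _ => rfl), classCount]
  simp [ha, hb]

theorem classCount_class {r : Setoid T} {Y : Set T} {a : T} (hY : ∀ t, t ∈ Y ↔ r a t) :
    classCount r Y = 1 := by
  classical
  rw [classCount, classSum_eq_add r _ a]
  · have ha : a ∈ Y := (hY a).2 (r.refl a)
    simp only [ha, if_true, add_eq_left]
    refine Finset.sum_eq_zero fun t ht => ?_
    have : t ∉ Y := by rw [hY]; simpa using ht
    simp [this]
  · intro t ht
    simp [hY, ht]

theorem classCount_sdiff {r : Setoid T} {Y Z : Set T} (hZ : Z ⊆ Y) :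
    classCount r (Y \ Z) = classCount r Y - classCount r Z := by
  classical
  rw [classCount, classCount, classCount, classSum, classSum, classSum, ← Finset.sum_sub_distrib]
  refine Finset.sum_congr rfl fun t _ => ?_
  by_cases h1 : t ∈ Z
  · simp [h1, hZ h1]
  · by_cases h2 : t ∈ Y <;> simp [h1, h2]

end ClassSum

/-! ### Merge and split maps on signs of circles -/

section SignModule

variable {T : Type*}

/-- The sign functions on `T` which are constant on the classes of `r`. -/
def ClassInvariant (r : Setoid T) (ε : T → Bool) : Prop := ∀ x y, r x y → ε x = ε y

/-- The span of the `r`-invariant sign functions. -/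
noncomputable def invariants (r : Setoid T) : Submodule ℤ ((T → Bool) →₀ ℤ) :=
  Finsupp.supported ℤ ℤ {ε | ClassInvariant r ε}

open Classical in
/-- Change the sign of the class of `t` to `c`. -/
noncomputable def setClass (r : Setoid T) (t : T) (c : Bool) (ε : T → Bool) : T → Bool :=
  fun u => if r u t then c else ε u

theorem setClass_of_rel {r : Setoid T} {t u : T} (h : r u t) (c : Bool) (ε : T → Bool) :
    setClass r t c ε u = c := if_pos h

theorem setClass_of_not {r : Setoid T} {t u : T} (h : ¬ r u t) (c : Bool) (ε : T → Bool) :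
    setClass r t c ε u = ε u := if_neg h

theorem setClass_self (r : Setoid T) (t : T) (c : Bool) (ε : T → Bool) :
    setClass r t c ε t = c := if_pos (r.refl t)

theorem setClass_congr {r : Setoid T} {t t' : T} (h : r t t') (c : Bool) (ε : T → Bool) :
    setClass r t c ε = setClass r t' c ε := by
  funext u
  have : r u t ↔ r u t' := ⟨fun h' => r.trans h' h, fun h' => r.trans h' (r.symm h)⟩
  by_cases h' : r u t
  · rw [setClass_of_rel h', setClass_of_rel (this.1 h')]
  · rw [setClass_of_not h', setClass_of_not fun h'' => h' (this.2 h'')]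

theorem ClassInvariant.setClass {r : Setoid T} {ε : T → Bool} (hε : ClassInvariant r ε) (t : T)
    (c : Bool) : ClassInvariant r (setClass r t c ε) := by
  intro x y hxy
  by_cases h : r x t
  · rw [setClass_of_rel h, setClass_of_rel (r.trans (r.symm hxy) h)]
  · rw [setClass_of_not h, setClass_of_not (fun h' => h (r.trans hxy h')), hε x y hxy]

theorem setClass_eq_self {r : Setoid T} {ε : T → Bool} (hε : ClassInvariant r ε) (t : T) :
    setClass r t (ε t) ε = ε := by
  funext u
  by_cases h : r u t
  · rw [setClass_of_rel h, hε u t h]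
  · rw [setClass_of_not h]

theorem single_mem_invariants {r : Setoid T} {ε : T → Bool} (hε : ClassInvariant r ε) :
    Finsupp.single ε (1 : ℤ) ∈ invariants r :=
  Finsupp.single_mem_supported ℤ 1 hε

theorem eqOn_invariants {r : Setoid T} {V : Type*} [AddCommGroup V]
    {f g : ((T → Bool) →₀ ℤ) →ₗ[ℤ] V}
    (h : ∀ ε, ClassInvariant r ε → f (Finsupp.single ε 1) = g (Finsupp.single ε 1))
    {z : (T → Bool) →₀ ℤ} (hz : z ∈ invariants r) : f z = g z := by
  rw [invariants, Finsupp.supported_eq_span_single] at hz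
  refine LinearMap.eqOn_span ?_ hz
  rintro _ ⟨ε, hε, rfl⟩
  exact h ε hε

theorem map_mem_invariants {r r' : Setoid T} {f : ((T → Bool) →₀ ℤ) →ₗ[ℤ] ((T → Bool) →₀ ℤ)}
    (h : ∀ ε, ClassInvariant r ε → f (Finsupp.single ε 1) ∈ invariants r')
    {z : (T → Bool) →₀ ℤ} (hz : z ∈ invariants r) : f z ∈ invariants r' := by
  rw [invariants, Finsupp.supported_eq_span_single] at hz
  have : Submodule.span ℤ ((fun ε => Finsupp.single ε (1 : ℤ)) '' {ε | ClassInvariant r ε})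
      ≤ (invariants r').comap f := by
    rw [Submodule.span_le]
    rintro _ ⟨ε, hε, rfl⟩
    exact h ε hε
  exact this hz

open Classical in
/-- Multiplication by the sign of the class of `t`, where `-` is the unit and the square
of `+` is zero. -/
noncomputable def mulClass (r : Setoid T) (t : T) : ((T → Bool) →₀ ℤ) →ₗ[ℤ] ((T → Bool) →₀ ℤ) :=
  Finsupp.linearCombination ℤ fun ε =>
    if ε t = true then 0 else Finsupp.single (setClass r t true ε) 1

open Classical in
/-- The map of signs belonging to the merging of the classes of `a` and `b`. -/
noncomputable def mergeMap (r' : Setoid T) (a b : T) :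
    ((T → Bool) →₀ ℤ) →ₗ[ℤ] ((T → Bool) →₀ ℤ) :=
  Finsupp.linearCombination ℤ fun ε =>
    if ε a = true ∧ ε b = true then 0 else Finsupp.single (setClass r' a (ε a || ε b) ε) 1

open Classical in
/-- The map of signs belonging to the splitting of a class into the classes of `a` and `b`. -/
noncomputable def splitMap (r' : Setoid T) (a b : T) :
    ((T → Bool) →₀ ℤ) →ₗ[ℤ] ((T → Bool) →₀ ℤ) :=
  Finsupp.linearCombination ℤ fun ε =>
    if ε a = true then Finsupp.single ε 1 else
      Finsupp.single (setClass r' a true ε) 1 + Finsupp.single (setClass r' b true ε) 1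

theorem mulClass_single_of_true (r : Setoid T) {t : T} {ε : T → Bool} (h : ε t = true) :
    mulClass r t (Finsupp.single ε 1) = 0 := by
  simp [mulClass, h]

theorem mulClass_single_of_false (r : Setoid T) {t : T} {ε : T → Bool} (h : ε t = false) :
    mulClass r t (Finsupp.single ε 1) = Finsupp.single (setClass r t true ε) 1 := by
  simp [mulClass, h]

theorem mergeMap_single_of_true (r' : Setoid T) {a b : T} {ε : T → Bool} (ha : ε a = true)
    (hb : ε b = true) : mergeMap r' a b (Finsupp.single ε 1) = 0 := by
  simp [mergeMap, ha, hb]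

theorem mergeMap_single_of_not (r' : Setoid T) {a b : T} {ε : T → Bool}
    (h : ¬ (ε a = true ∧ ε b = true)) : mergeMap r' a b (Finsupp.single ε 1)
      = Finsupp.single (setClass r' a (ε a || ε b) ε) 1 := by
  simp only [mergeMap, Finsupp.linearCombination_single, if_neg h, one_smul]

theorem splitMap_single_of_true (r' : Setoid T) {a b : T} {ε : T → Bool} (ha : ε a = true) :
    splitMap r' a b (Finsupp.single ε 1) = Finsupp.single ε 1 := by
  simp [splitMap, ha]

theorem splitMap_single_of_false (r' : Setoid T) {a b : T} {ε : T → Bool} (ha : ε a = false) :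
    splitMap r' a b (Finsupp.single ε 1) =
      Finsupp.single (setClass r' a true ε) 1 + Finsupp.single (setClass r' b true ε) 1 := by
  simp [splitMap, ha]

theorem mulClass_mem {r : Setoid T} (t : T) {z : (T → Bool) →₀ ℤ} (hz : z ∈ invariants r) :
    mulClass r t z ∈ invariants r := by
  refine map_mem_invariants (fun ε hε => ?_) hz
  cases h : ε t
  · rw [mulClass_single_of_false r h]
    exact single_mem_invariants (hε.setClass t true)
  · rw [mulClass_single_of_true r h]
    exact Submodule.zero_mem _

theorem mulClass_congr {r : Setoid T} {t u : T} (h : r t u) {z : (T → Bool) →₀ ℤ}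
    (hz : z ∈ invariants r) : mulClass r t z = mulClass r u z := by
  refine eqOn_invariants (fun ε hε => ?_) hz
  have htu := hε t u h
  cases ht : ε t
  · rw [mulClass_single_of_false r ht, mulClass_single_of_false r (htu ▸ ht), setClass_congr h]
  · rw [mulClass_single_of_true r ht, mulClass_single_of_true r (htu ▸ ht)]

theorem mulClass_comm {r : Setoid T} (t u : T) {z : (T → Bool) →₀ ℤ}
    (hz : z ∈ invariants r) : mulClass r t (mulClass r u z) = mulClass r u (mulClass r t z) := by
  by_cases hr : r t u
  · rw [mulClass_congr hr (mulClass_mem u hz), mulClass_congr hr hz]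
  have hr' : ¬ r u t := fun h => hr (r.symm h)
  refine eqOn_invariants (f := mulClass r t ∘ₗ mulClass r u) (g := mulClass r u ∘ₗ mulClass r t)
    (fun ε hε => ?_) hz
  simp only [LinearMap.comp_apply]
  cases ht : ε t <;> cases hu : ε u
  · rw [mulClass_single_of_false r ht, mulClass_single_of_false r hu,
      mulClass_single_of_false r (by rw [setClass_of_not hr, ht]),
      mulClass_single_of_false r (by rw [setClass_of_not hr', hu])]
    congr 1
    funext x
    by_cases h1 : r x t <;> by_cases h2 : r x u <;> simp [setClass, h1, h2]
  · rw [mulClass_single_of_false r ht, mulClass_single_of_true r hu,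
      mulClass_single_of_true r (by rw [setClass_of_not hr', hu]), map_zero]
  · rw [mulClass_single_of_true r ht, mulClass_single_of_false r hu,
      mulClass_single_of_true r (by rw [setClass_of_not hr, ht]), map_zero]
  · rw [mulClass_single_of_true r ht, mulClass_single_of_true r hu, map_zero, map_zero]

theorem Merges.classInvariant_setClass {r r' : Setoid T} {a b : T} (hm : Merges r r' a b)
    {ε : T → Bool} (hε : ClassInvariant r ε) (c : Bool) : ClassInvariant r' (setClass r' a c ε) := by
  intro x y hxy
  by_cases h : r' x a
  · rw [setClass_of_rel h, setClass_of_rel (r'.trans (r'.symm hxy) h)]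
  · rw [setClass_of_not h, setClass_of_not (fun h' => h (r'.trans hxy h')),
      hε x y ((hm.rel_iff_of_not h y).1 hxy)]

theorem Merges.classInvariant {r r' : Setoid T} {a b : T} (hm : Merges r r' a b)
    {ε : T → Bool} (hε : ClassInvariant r' ε) : ClassInvariant r ε :=
  fun x y h => hε x y (hm.le h)

theorem Merges.mergeMap_mem {r r' : Setoid T} {a b : T} (hm : Merges r r' a b)
    {z : (T → Bool) →₀ ℤ} (hz : z ∈ invariants r) : mergeMap r' a b z ∈ invariants r' := by
  refine map_mem_invariants (fun ε hε => ?_) hz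
  by_cases h : ε a = true ∧ ε b = true
  · rw [mergeMap_single_of_true r' h.1 h.2]
    exact Submodule.zero_mem _
  · rw [mergeMap_single_of_not r' h]
    exact single_mem_invariants (hm.classInvariant_setClass hε _)

theorem Merges.splitMap_mem {r r' : Setoid T} {a b : T} (hm : Merges r' r a b)
    {z : (T → Bool) →₀ ℤ} (hz : z ∈ invariants r) : splitMap r' a b z ∈ invariants r' := by
  refine map_mem_invariants (fun ε hε => ?_) hz
  have hε' := hm.classInvariant hε
  cases h : ε a
  · rw [splitMap_single_of_false r' h]
    exact Submodule.add_mem _ (single_mem_invariants (hε'.setClass _ _))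
      (single_mem_invariants (hε'.setClass _ _))
  · rw [splitMap_single_of_true r' h]
    exact single_mem_invariants hε'

theorem mergeMap_comm (r' : Setoid T) {a b : T} (hab : r' a b) :
    mergeMap r' a b = mergeMap r' b a := by
  refine Finsupp.lhom_ext' fun ε => LinearMap.ext_ring ?_
  simp only [LinearMap.comp_apply, Finsupp.lsingle_apply]
  by_cases h : ε a = true ∧ ε b = true
  · rw [mergeMap_single_of_true r' h.1 h.2, mergeMap_single_of_true r' h.2 h.1]
  · rw [mergeMap_single_of_not r' h, mergeMap_single_of_not r' (fun h' => h h'.symm),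
      setClass_congr hab, Bool.or_comm]

/-- The merge map is the multiplication of the algebra with unit `-` and `+² = 0`, hence linear over
it. Only the class of `a` needs computation: that of `b` follows by symmetry, and other classes take
no part in the merge. -/
theorem Merges.mergeMap_mulClass {r r' : Setoid T} {a b : T} (hm : Merges r r' a b) (t : T)
    {z : (T → Bool) →₀ ℤ} (hz : z ∈ invariants r) :
    mergeMap r' a b (mulClass r t z) = mulClass r' t (mergeMap r' a b z) := by
  have key : ∀ {a b : T}, Merges r r' a b → ∀ z ∈ invariants r,
      mergeMap r' a b (mulClass r a z) = mulClass r' a (mergeMap r' a b z) := by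
    intro a b hm z hz
    refine eqOn_invariants (f := mergeMap r' a b ∘ₗ mulClass r a)
      (g := mulClass r' a ∘ₗ mergeMap r' a b) (fun ε hε => ?_) hz
    simp only [LinearMap.comp_apply]
    have hba : ¬ r b a := fun h => hm.1 (r.symm h)
    cases ha : ε a
    · rw [mulClass_single_of_false r ha, mergeMap_single_of_not (ε := ε) r' (by simp [ha]), ha]
      have h1 : setClass r a true ε a = true := setClass_self _ _ _ _
      have h2 : setClass r a true ε b = ε b := setClass_of_not hba _ _
      cases hb : ε b
      · rw [mergeMap_single_of_not r' (by simp [h2, hb]), h1,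
          mulClass_single_of_false r' (by rw [setClass_self]; rfl)]
        congr 1
        funext x
        by_cases h : r' x a
        · simp [setClass, h]
        · have : ¬ r x a := fun h' => h (hm.le h')
          simp [setClass, h, this]
      · rw [mergeMap_single_of_true r' h1 (by rw [h2, hb]),
          mulClass_single_of_true r' (by rw [setClass_self]; rfl)]
    · rw [mulClass_single_of_true r ha, map_zero]
      by_cases hb : ε b = true
      · rw [mergeMap_single_of_true r' ha hb, map_zero]
      · rw [mergeMap_single_of_not r' (by simp [hb]),
          mulClass_single_of_true r' (by rw [setClass_self, ha]; rfl)]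
  by_cases hta : r t a
  · rw [mulClass_congr hta hz, mulClass_congr (hm.le hta) (hm.mergeMap_mem hz), key hm z hz]
  by_cases htb : r t b
  · rw [mulClass_congr htb hz, mulClass_congr (hm.le htb) (hm.mergeMap_mem hz),
      mergeMap_comm r' hm.rel, key hm.symm z hz]
  have ht : ¬ r' t a := by rw [hm.rel_left_iff]; tauto
  refine eqOn_invariants (f := mergeMap r' a b ∘ₗ mulClass r t)
    (g := mulClass r' t ∘ₗ mergeMap r' a b) (fun ε hε => ?_) hz
  simp only [LinearMap.comp_apply]
  have h1 : setClass r t true ε a = ε a := setClass_of_not (fun h => hta (r.symm h)) _ _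
  have h2 : setClass r t true ε b = ε b := setClass_of_not (fun h => htb (r.symm h)) _ _
  cases h3 : ε t
  · rw [mulClass_single_of_false r h3]
    by_cases h : ε a = true ∧ ε b = true
    · rw [mergeMap_single_of_true r' h.1 h.2, mergeMap_single_of_true r' (h1 ▸ h.1) (h2 ▸ h.2),
        map_zero]
    · rw [mergeMap_single_of_not r' h, mergeMap_single_of_not r' (by rwa [h1, h2]),
        mulClass_single_of_false r' (by rw [setClass_of_not ht, h3]), h1, h2]
      congr 1
      funext x
      by_cases h4 : r' x a
      · have h5 : ¬ r' x t := fun h => ht (r'.trans (r'.symm h) h4)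
        simp [setClass, h4, h5]
      · have h5 : r' x t ↔ r x t := hm.rel_iff_of_not h4 t
        by_cases h6 : r x t
        · simp [setClass, h4, h5.2 h6, h6]
        · simp [setClass, h4, mt h5.1 h6, h6]
  · rw [mulClass_single_of_true r h3, map_zero]
    by_cases h : ε a = true ∧ ε b = true
    · rw [mergeMap_single_of_true r' h.1 h.2, map_zero]
    · rw [mergeMap_single_of_not r' h,
        mulClass_single_of_true r' (by rw [setClass_of_not ht, h3])]

theorem Merges.splitMap_comm {r r' : Setoid T} {a b : T} (hm : Merges r' r a b)
    {z : (T → Bool) →₀ ℤ} (hz : z ∈ invariants r) : splitMap r' a b z = splitMap r' b a z := by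
  refine eqOn_invariants (fun ε hε => ?_) hz
  have hab := hε a b hm.rel
  cases h : ε a
  · rw [splitMap_single_of_false r' h, splitMap_single_of_false r' (hab ▸ h), add_comm]
  · rw [splitMap_single_of_true r' h, splitMap_single_of_true r' (hab ▸ h)]

/-- The comultiplication of a Frobenius algebra is a bimodule map: a factor on the circle may be put
on either of the circles into which it splits. -/
theorem Merges.splitMap_mulClass {r r' : Setoid T} {a b : T} (hm : Merges r' r a b) (t : T)
    {z : (T → Bool) →₀ ℤ} (hz : z ∈ invariants r) :
    splitMap r' a b (mulClass r t z) = mulClass r' t (splitMap r' a b z) := by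
  have key : ∀ {a b : T}, Merges r' r a b → ∀ z ∈ invariants r,
      splitMap r' a b (mulClass r a z) = mulClass r' a (splitMap r' a b z) := by
    intro a b hm z hz
    refine eqOn_invariants (f := splitMap r' a b ∘ₗ mulClass r a)
      (g := mulClass r' a ∘ₗ splitMap r' a b) (fun ε hε => ?_) hz
    simp only [LinearMap.comp_apply]
    have hba : ¬ r' b a := fun h => hm.1 (r'.symm h)
    cases ha : ε a
    · rw [mulClass_single_of_false r ha, splitMap_single_of_false r' ha,
        splitMap_single_of_true r' (setClass_self _ _ _ _), map_add,
        mulClass_single_of_true r' (setClass_self _ _ _ _), zero_add,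
        mulClass_single_of_false r' (by rw [setClass_of_not hm.1, ha])]
      congr 1
      funext x
      have := hm.rel_left_iff x
      by_cases h1 : r' x a <;> by_cases h2 : r' x b <;> simp [setClass, h1, h2, this]
    · rw [mulClass_single_of_true r ha, map_zero, splitMap_single_of_true r' ha,
        mulClass_single_of_true r' ha]
  by_cases hta : r' t a
  · rw [mulClass_congr (hm.le hta) hz, mulClass_congr hta (hm.splitMap_mem hz), key hm z hz]
  by_cases htb : r' t b
  · rw [mulClass_congr (hm.le htb) hz, mulClass_congr htb (hm.splitMap_mem hz),
      hm.splitMap_comm (mulClass_mem b hz), hm.splitMap_comm hz, key hm.symm z hz]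
  have ht : ¬ r t a := by rw [hm.rel_left_iff]; tauto
  have ht' : ∀ x, r x t ↔ r' x t := fun x => by
    rw [r.comm', r'.comm', hm.rel_iff_of_not ht]
  refine eqOn_invariants (f := splitMap r' a b ∘ₗ mulClass r t)
    (g := mulClass r' t ∘ₗ splitMap r' a b) (fun ε hε => ?_) hz
  simp only [LinearMap.comp_apply]
  have h1 : setClass r t true ε a = ε a := setClass_of_not (fun h => ht (r.symm h)) _ _
  have hset : setClass r t true ε = setClass r' t true ε := by
    funext x
    by_cases h : r' x t
    · rw [setClass_of_rel h, setClass_of_rel ((ht' x).2 h)]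
    · rw [setClass_of_not h, setClass_of_not (mt (ht' x).1 h)]
  have hcomm : ∀ c, ¬ r' t c → setClass r' c true (setClass r' t true ε)
      = setClass r' t true (setClass r' c true ε) := by
    intro c _
    funext x
    by_cases h1 : r' x c <;> by_cases h2 : r' x t <;> simp [setClass, h1, h2]
  cases h3 : ε t
  · rw [mulClass_single_of_false r h3]
    cases ha : ε a
    · rw [splitMap_single_of_false r' ha, splitMap_single_of_false r' (h1 ▸ ha), map_add,
        mulClass_single_of_false r' (by rw [setClass_of_not hta, h3]),
        mulClass_single_of_false r' (by rw [setClass_of_not htb, h3]), hset,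
        hcomm a hta, hcomm b htb]
    · rw [splitMap_single_of_true r' ha, splitMap_single_of_true r' (h1 ▸ ha),
        mulClass_single_of_false r' h3, hset]
  · rw [mulClass_single_of_true r h3, map_zero]
    cases ha : ε a
    · rw [splitMap_single_of_false r' ha, map_add,
        mulClass_single_of_true r' (by rw [setClass_of_not hta, h3]),
        mulClass_single_of_true r' (by rw [setClass_of_not htb, h3]), add_zero]
    · rw [splitMap_single_of_true r' ha, mulClass_single_of_true r' h3]

open Classical in
/-- The merge map or the split map from signs for `r` to signs for `r'`. -/
noncomputable def edgeMap (r r' : Setoid T) (a b : T) :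
    ((T → Bool) →₀ ℤ) →ₗ[ℤ] ((T → Bool) →₀ ℤ) :=
  if Merges r r' a b then mergeMap r' a b else splitMap r' a b

theorem Merges.edgeMap_eq {r r' : Setoid T} {a b : T} (hm : Merges r r' a b) :
    edgeMap r r' a b = mergeMap r' a b := if_pos hm

theorem Merges.edgeMap_eq_split {r r' : Setoid T} {a b : T} (hm : Merges r' r a b) :
    edgeMap r r' a b = splitMap r' a b := if_neg fun h => h.1 hm.rel

theorem edgeMap_mem {r r' : Setoid T} {a b : T} (h : Merges r r' a b ∨ Merges r' r a b)
    {z : (T → Bool) →₀ ℤ} (hz : z ∈ invariants r) : edgeMap r r' a b z ∈ invariants r' := by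
  rcases h with h | h
  · rw [h.edgeMap_eq]; exact h.mergeMap_mem hz
  · rw [h.edgeMap_eq_split]; exact h.splitMap_mem hz

theorem edgeMap_mulClass {r r' : Setoid T} {a b : T} (h : Merges r r' a b ∨ Merges r' r a b)
    (t : T) {z : (T → Bool) →₀ ℤ} (hz : z ∈ invariants r) :
    edgeMap r r' a b (mulClass r t z) = mulClass r' t (edgeMap r r' a b z) := by
  rcases h with h | h
  · rw [h.edgeMap_eq]; exact h.mergeMap_mulClass t hz
  · rw [h.edgeMap_eq_split]; exact h.splitMap_mulClass t hz

/-- The unit: all signs are negative. -/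
noncomputable def unitSigns (T : Type*) : (T → Bool) →₀ ℤ := Finsupp.single (fun _ => false) 1

theorem unitSigns_mem (r : Setoid T) : unitSigns T ∈ invariants r :=
  single_mem_invariants fun _ _ _ => rfl

theorem Merges.edgeMap_unit {r r' : Setoid T} {a b : T} (hm : Merges r r' a b) :
    edgeMap r r' a b (unitSigns T) = unitSigns T := by
  rw [hm.edgeMap_eq, unitSigns, mergeMap_single_of_not r' (by simp)]
  congr 1
  funext x
  simp [setClass]

theorem Merges.edgeMap_unit_split {r r' : Setoid T} {a b : T} (hm : Merges r' r a b) :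
    edgeMap r r' a b (unitSigns T)
      = mulClass r' a (unitSigns T) + mulClass r' b (unitSigns T) := by
  rw [hm.edgeMap_eq_split, unitSigns, splitMap_single_of_false r' rfl,
    mulClass_single_of_false r' rfl, mulClass_single_of_false r' rfl]

variable [Fintype T]

/-- Maps compatible with the multiplications are determined by their value on the unit. -/
theorem eqOn_of_unit {r r' : Setoid T} {f g : ((T → Bool) →₀ ℤ) →ₗ[ℤ] ((T → Bool) →₀ ℤ)}
    (hf : ∀ t, ∀ z ∈ invariants r, f (mulClass r t z) = mulClass r' t (f z))
    (hg : ∀ t, ∀ z ∈ invariants r, g (mulClass r t z) = mulClass r' t (g z))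
    (h : f (unitSigns T) = g (unitSigns T)) {z : (T → Bool) →₀ ℤ} (hz : z ∈ invariants r) :
    f z = g z := by
  refine eqOn_invariants (fun ε hε => ?_) hz
  induction hn : (Finset.univ.filter fun t => ε t = true).card using Nat.strong_induction_on
    generalizing ε with
  | _ n ih =>
    by_cases h0 : ∃ t, ε t = true
    · obtain ⟨t, ht⟩ := h0
      -- Peel off a positive class: `ε` is the product of this class with the signs in which it is
      -- made negative, and these have fewer positive points.
      have h1 : Finsupp.single ε (1 : ℤ)
          = mulClass r t (Finsupp.single (setClass r t false ε) 1) := by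
        rw [mulClass_single_of_false r (setClass_self _ _ _ _)]
        congr 1
        funext u
        by_cases hu : r u t
        · rw [setClass_of_rel hu, hε u t hu, ht]
        · rw [setClass_of_not hu, setClass_of_not hu]
      have h2 : ClassInvariant r (setClass r t false ε) := hε.setClass t false
      have h3 := single_mem_invariants h2
      rw [h1, hf t _ h3, hg t _ h3, ih _ ?_ _ h2 rfl]
      rw [← hn]
      refine Finset.card_lt_card ⟨?_, fun hsub => ?_⟩
      · intro u hu
        simp only [Finset.mem_filter, Finset.mem_univ, true_and] at hu ⊢
        by_cases h : r u t
        · rw [setClass_of_rel h] at hu; simp at hu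
        · rwa [setClass_of_not h] at hu
      · have := hsub (by simpa using ht : t ∈ Finset.univ.filter fun t => ε t = true)
        simp [setClass_self] at this
    · have : ε = fun _ => false := by
        funext t
        cases ht : ε t
        · rfl
        · exact absurd ⟨t, ht⟩ h0
      rw [this]; exact h

theorem Merges.classCount_univ {r r' : Setoid T} {a b : T} (hm : Merges r r' a b) :
    classCount r' Set.univ = classCount r Set.univ - 1 :=
  hm.classCount_eq (fun _ _ _ _ => trivial) trivial

/-- The merge and split maps at two crossings commute. -/
theorem edgeMap_edgeMap_comm {r r₁ r₂ r₃ : Setoid T} {a b c d : T}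
    (h₁ : Merges r r₁ a b ∨ Merges r₁ r a b) (h₁₃ : Merges r₁ r₃ c d ∨ Merges r₃ r₁ c d)
    (h₂ : Merges r r₂ c d ∨ Merges r₂ r c d) (h₂₃ : Merges r₂ r₃ a b ∨ Merges r₃ r₂ a b)
    {z : (T → Bool) →₀ ℤ} (hz : z ∈ invariants r) :
    edgeMap r₁ r₃ c d (edgeMap r r₁ a b z) = edgeMap r₂ r₃ a b (edgeMap r r₂ c d z) := by
  refine eqOn_of_unit (r := r) (r' := r₃) (f := edgeMap r₁ r₃ c d ∘ₗ edgeMap r r₁ a b)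
    (g := edgeMap r₂ r₃ a b ∘ₗ edgeMap r r₂ c d) ?_ ?_ ?_ hz
  · intro t z hz
    simp only [LinearMap.comp_apply]
    rw [edgeMap_mulClass h₁ t hz, edgeMap_mulClass h₁₃ t (edgeMap_mem h₁ hz)]
  · intro t z hz
    simp only [LinearMap.comp_apply]
    rw [edgeMap_mulClass h₂ t hz, edgeMap_mulClass h₂₃ t (edgeMap_mem h₂ hz)]
  simp only [LinearMap.comp_apply]
  have hu := fun r : Setoid T => unitSigns_mem r
  -- A merge lowers the number of classes by one and a split raises it by one. Both paths join `r`
  -- to `r₃`, so only six of the sixteen patterns survive.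
  rcases h₁ with m₁ | m₁ <;> rcases h₁₃ with m₁₃ | m₁₃ <;> rcases h₂ with m₂ | m₂ <;>
    rcases h₂₃ with m₂₃ | m₂₃ <;>
    first
    | (exfalso
       linarith [m₁.classCount_univ, m₁₃.classCount_univ, m₂.classCount_univ,
         m₂₃.classCount_univ])
    | skip
  · rw [m₁.edgeMap_unit, m₂.edgeMap_unit, m₁₃.edgeMap_unit, m₂₃.edgeMap_unit]
  · rw [m₁.edgeMap_unit, m₂.edgeMap_unit, m₁₃.edgeMap_unit_split, m₂₃.edgeMap_unit_split]
    -- `a` and `b` are separated in `r₃` but joined by merging the classes of `c` and `d`; hence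
    -- these are the classes of `a` and `b`, in one of two orders.
    have h := (m₁₃.2 a b).1 m₁.rel
    have hab := m₂₃.1
    have hcd := m₁₃.1
    rcases h with h | ⟨h | h, h' | h'⟩
    · exact absurd h hab
    · exact absurd (r₃.trans h (r₃.symm h')) hab
    · rw [mulClass_congr h (hu r₃), mulClass_congr h' (hu r₃)]
    · rw [mulClass_congr h (hu r₃), mulClass_congr h' (hu r₃), add_comm]
    · exact absurd (r₃.trans h (r₃.symm h')) hab
  · rw [m₁.edgeMap_unit, m₂.edgeMap_unit_split, m₁₃.edgeMap_unit_split, map_add,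
      edgeMap_mulClass (Or.inl m₂₃) _ (hu r₂), edgeMap_mulClass (Or.inl m₂₃) _ (hu r₂),
      m₂₃.edgeMap_unit]
  · rw [m₁.edgeMap_unit_split, m₂.edgeMap_unit, m₂₃.edgeMap_unit_split, map_add,
      edgeMap_mulClass (Or.inl m₁₃) _ (hu r₁), edgeMap_mulClass (Or.inl m₁₃) _ (hu r₁),
      m₁₃.edgeMap_unit]
  · rw [m₁.edgeMap_unit_split, m₂.edgeMap_unit_split, map_add, map_add,
      edgeMap_mulClass (Or.inl m₁₃) _ (hu r₁), edgeMap_mulClass (Or.inl m₁₃) _ (hu r₁),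
      edgeMap_mulClass (Or.inl m₂₃) _ (hu r₂), edgeMap_mulClass (Or.inl m₂₃) _ (hu r₂),
      m₁₃.edgeMap_unit, m₂₃.edgeMap_unit]
    have hab := m₂₃.rel
    have hcd := m₁₃.rel
    -- All four points lie on one circle of `r₃`, so both sides are twice the multiplication by this
    -- circle.
    have hac : r₃ a c := by
      rcases (m₁.2 c d).1 m₂.rel with h | ⟨h | h, -⟩
      · exact absurd h m₁₃.1
      · exact r₃.symm (m₁₃.le h)
      · exact r₃.trans hab (r₃.symm (m₁₃.le h))
    rw [mulClass_congr (r₃.symm hab) (hu r₃), mulClass_congr hac (hu r₃),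
      mulClass_congr (r₃.symm hcd) (hu r₃)]
  · rw [m₁.edgeMap_unit_split, m₂.edgeMap_unit_split, map_add, map_add,
      edgeMap_mulClass (Or.inr m₁₃) _ (hu r₁), edgeMap_mulClass (Or.inr m₁₃) _ (hu r₁),
      edgeMap_mulClass (Or.inr m₂₃) _ (hu r₂), edgeMap_mulClass (Or.inr m₂₃) _ (hu r₂),
      m₁₃.edgeMap_unit_split, m₂₃.edgeMap_unit_split]
    simp only [map_add]
    rw [mulClass_comm a c (hu r₃), mulClass_comm a d (hu r₃), mulClass_comm b c (hu r₃),
      mulClass_comm b d (hu r₃)]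
    abel

end SignModule

/-! ### Systems of circles -/

section EdgeRule

variable {T : Type*} [Fintype T]

/-- A sign as a number. -/
def signValue (c : Bool) : ℚ := if c = true then 1 else -1

/-- The number of positive minus the number of negative classes. -/
noncomputable def signSum (r : Setoid T) (ε : T → Bool) : ℚ := classSum r fun t => signValue (ε t)

/-- The signs off the classes of `a` and `b` agree, and the sum of the signs grows by one. -/
def EdgeRule (r r' : Setoid T) (a b : T) (ε ε' : T → Bool) : Prop :=
  (∀ t, ¬ r t a → ¬ r t b → ε' t = ε t) ∧ signSum r' ε' = signSum r ε + 1

theorem Merges.signSum_eq {r r' : Setoid T} {a b : T} (hm : Merges r r' a b) {ε ε' : T → Bool}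
    (hε : ClassInvariant r ε) (hε' : ClassInvariant r' ε')
    (h : ∀ t, ¬ r t a → ¬ r t b → ε' t = ε t) :
    signSum r' ε' = signSum r ε + signValue (ε' a) - signValue (ε a) - signValue (ε b) :=
  hm.classSum_eq _ _ (fun x y hxy => by rw [hε x y hxy]) (fun x y hxy => by rw [hε' x y hxy])
    fun t ha hb => by rw [h t ha hb]

/-- The degree condition reads ε'(a) = ε(a) + ε(b) + 1 for signs ±1. It has no solution for two
positive circles and exactly one otherwise, which is the multiplication table. -/
theorem Merges.edgeRule_iff {r r' : Setoid T} {a b : T} (hm : Merges r r' a b) {ε ε' : T → Bool}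
    (hε : ClassInvariant r ε) (hε' : ClassInvariant r' ε') :
    EdgeRule r r' a b ε ε' ↔
      ¬ (ε a = true ∧ ε b = true) ∧ ε' = setClass r' a (ε a || ε b) ε := by
  constructor
  · rintro ⟨h1, h2⟩
    rw [hm.signSum_eq hε hε' h1] at h2
    have h3 : ¬ (ε a = true ∧ ε b = true) ∧ ε' a = (ε a || ε b) := by
      have h3 : signValue (ε' a) = signValue (ε a) + signValue (ε b) + 1 := by linarith
      revert h3
      cases ha : ε a <;> cases hb : ε b <;> cases ha' : ε' a <;> norm_num [signValue]
    refine ⟨h3.1, ?_⟩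
    funext x
    by_cases hx : r' x a
    · rw [setClass_of_rel hx, hε' x a hx, h3.2]
    · rw [setClass_of_not hx]
      rw [hm.rel_left_iff] at hx
      exact h1 x (fun h => hx (Or.inl h)) (fun h => hx (Or.inr h))
  · rintro ⟨h1, rfl⟩
    have h2 : ∀ t, ¬ r t a → ¬ r t b → setClass r' a (ε a || ε b) ε t = ε t := by
      intro t ha hb
      refine setClass_of_not ?_ _ _
      rw [hm.rel_left_iff]; tauto
    refine ⟨h2, ?_⟩
    rw [hm.signSum_eq hε hε' h2, setClass_self]
    cases ha : ε a <;> cases hb : ε b <;> simp [ha, hb, signValue] at h1 ⊢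

/-- Here the degree condition is ε'(a) + ε'(b) = ε(a) + 1: two positive circles come out of a
positive one, two circles of opposite signs out of a negative one. -/
theorem Merges.edgeRule_split_iff {r r' : Setoid T} {a b : T} (hm : Merges r' r a b)
    {ε ε' : T → Bool} (hε : ClassInvariant r ε) (hε' : ClassInvariant r' ε') :
    EdgeRule r r' a b ε ε' ↔ (ε a = true ∧ ε' = ε) ∨
      (ε a = false ∧ (ε' = setClass r' a true ε ∨ ε' = setClass r' b true ε)) := by
  have hba : ¬ r' b a := fun h => hm.1 (r'.symm h)
  have hab : ε b = ε a := (hε a b hm.rel).symm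
  have hoff : (∀ t, ¬ r t a → ¬ r t b → ε' t = ε t) ↔
      ∀ t, ¬ r' t a → ¬ r' t b → ε' t = ε t := by
    refine forall_congr' fun t => ?_
    have h1 := hm.rel_left_iff t
    have h2 := hm.symm.rel_left_iff t
    tauto
  have hsum (h : ∀ t, ¬ r' t a → ¬ r' t b → ε' t = ε t) : signSum r' ε' = signSum r ε + 1 ↔
      signValue (ε' a) + signValue (ε' b) = signValue (ε a) + 1 := by
    rw [hm.signSum_eq hε' hε fun t ha hb => (h t ha hb).symm]
    constructor <;> intro h <;> linarith
  rw [EdgeRule, hoff]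
  constructor
  · rintro ⟨h1, h2⟩
    rw [hsum h1] at h2
    have hx : ∀ ε₁ : T → Bool, ε₁ a = ε' a → ε₁ b = ε' b → ClassInvariant r' ε₁ →
        (∀ t, ¬ r' t a → ¬ r' t b → ε₁ t = ε t) → ε' = ε₁ := by
      intro ε₁ ha hb hi ho
      funext x
      by_cases hxa : r' x a
      · rw [hε' x a hxa, hi x a hxa, ha]
      by_cases hxb : r' x b
      · rw [hε' x b hxb, hi x b hxb, hb]
      rw [h1 x hxa hxb, ho x hxa hxb]
    have hi : ClassInvariant r' ε := hm.classInvariant hε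
    cases ha : ε a
    · right
      refine ⟨rfl, ?_⟩
      cases ha' : ε' a
      · right
        have hb' : ε' b = true := by
          cases hb' : ε' b
          · simp only [ha, ha', hb', signValue] at h2; norm_num at h2
          · rfl
        exact hx _ (by rw [setClass_of_not hm.1, ha, ha']) (by rw [setClass_self, hb'])
          (hi.setClass _ _) fun t _ hb => setClass_of_not hb _ _
      · left
        have hb' : ε' b = false := by
          cases hb' : ε' b
          · rfl
          · simp only [ha, ha', hb', signValue] at h2; norm_num at h2
        exact hx _ (by rw [setClass_self, ha']) (by rw [setClass_of_not hba, hab, ha, hb'])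
          (hi.setClass _ _) fun t ha _ => setClass_of_not ha _ _
    · left
      refine ⟨rfl, ?_⟩
      have h3 : ε' a = true ∧ ε' b = true := by
        revert h2
        cases ha' : ε' a <;> cases hb' : ε' b <;> norm_num [signValue, ha]
      exact hx _ (by rw [h3.1, ha]) (by rw [h3.2, hab, ha]) hi fun _ _ _ => rfl
  · rintro (⟨ha, rfl⟩ | ⟨ha, rfl | rfl⟩)
    · refine ⟨fun _ _ _ => rfl, (hsum fun _ _ _ => rfl).2 ?_⟩
      rw [hab, ha]; simp [signValue]
    · have h1 : ∀ t, ¬ r' t a → ¬ r' t b → setClass r' a true ε t = ε t :=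
        fun t ha _ => setClass_of_not ha _ _
      refine ⟨h1, (hsum h1).2 ?_⟩
      rw [setClass_self, setClass_of_not hba, hab, ha]; simp [signValue]
    · have h1 : ∀ t, ¬ r' t a → ¬ r' t b → setClass r' b true ε t = ε t :=
        fun t _ hb => setClass_of_not hb _ _
      refine ⟨h1, (hsum h1).2 ?_⟩
      rw [setClass_self, setClass_of_not hm.1, ha]; simp [signValue]

open Classical in
theorem edgeMap_single_apply {r r' : Setoid T} {a b : T}
    (h : Merges r r' a b ∨ Merges r' r a b) {ε ε' : T → Bool} (hε : ClassInvariant r ε)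
    (hε' : ClassInvariant r' ε') :
    edgeMap r r' a b (Finsupp.single ε 1) ε' = if EdgeRule r r' a b ε ε' then 1 else 0 := by
  rcases h with hm | hm
  · rw [hm.edgeMap_eq]
    simp only [hm.edgeRule_iff hε hε']
    by_cases h : ε a = true ∧ ε b = true
    · rw [mergeMap_single_of_true r' h.1 h.2]
      simp [h]
    · rw [mergeMap_single_of_not r' h, Finsupp.single_apply]
      simp only [h, not_false_eq_true, true_and]
      exact if_congr eq_comm rfl rfl
  · rw [hm.edgeMap_eq_split]
    simp only [hm.edgeRule_split_iff hε hε']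
    cases ha : ε a
    · rw [splitMap_single_of_false r' ha, Finsupp.add_apply, Finsupp.single_apply,
        Finsupp.single_apply]
      -- The two terms of the split map are different basis elements, so no coefficient is 2.
      have hne : setClass r' a true ε ≠ setClass r' b true ε := by
        intro h
        have := congrFun h a
        rw [setClass_self, setClass_of_not hm.1, ha] at this
        exact absurd this (by simp)
      by_cases h1 : ε' = setClass r' a true ε
      · subst h1
        simp [hne.symm]
      · by_cases h2 : ε' = setClass r' b true ε
        · subst h2
          simp [hne]
        · simp [h1, h2, Ne.symm h1, Ne.symm h2]
    · rw [splitMap_single_of_true r' ha, Finsupp.single_apply]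
      simp [eq_comm]

end EdgeRule

/-! ### Cubes of circle systems and their differential -/

section MarkerSystem

/-- Change the marker at `v`. -/
def flipAt {X : Type*} [DecidableEq X] (s : X → Bool) (v : X) : X → Bool :=
  Function.update s v (!s v)

section flipAt

variable {X : Type*} [DecidableEq X] (s : X → Bool) {v w x : X}

theorem flipAt_self (v : X) : flipAt s v v = !s v := by simp [flipAt]

theorem flipAt_of_ne (h : x ≠ v) : flipAt s v x = s x := by simp [flipAt, h]

theorem flipAt_flipAt (v : X) : flipAt (flipAt s v) v = s := by
  funext x
  by_cases h : x = v
  · subst h; simp [flipAt_self]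
  · rw [flipAt_of_ne _ h, flipAt_of_ne _ h]

theorem flipAt_comm (v w : X) : flipAt (flipAt s v) w = flipAt (flipAt s w) v := by
  by_cases hvw : v = w
  · rw [hvw]
  funext x
  by_cases hv : x = v
  · subst hv; rw [flipAt_of_ne _ hvw, flipAt_self, flipAt_self, flipAt_of_ne _ hvw]
  · by_cases hw : x = w
    · subst hw; rw [flipAt_of_ne _ hv, flipAt_self, flipAt_self, flipAt_of_ne _ hv]
    · rw [flipAt_of_ne _ hw, flipAt_of_ne _ hv, flipAt_of_ne _ hv, flipAt_of_ne _ hw]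

end flipAt

/-- A cube of equivalence relations on `T`, indexed by the states of `X`, in which a change of the
marker at `v` merges or splits the classes of `left v` and `right v`. -/
structure MarkerSystem (X T : Type*) [DecidableEq X] where
  /-- the equivalence relation whose classes are the circles -/
  rel : (X → Bool) → Setoid T
  /-- a point on one of the arcs at a crossing -/
  left : X → T
  /-- a point on the other arc at a crossing -/
  right : X → T
  merges_or : ∀ s v, Merges (rel s) (rel (flipAt s v)) (left v) (right v) ∨
    Merges (rel (flipAt s v)) (rel s) (left v) (right v)

namespace MarkerSystem

variable {X T : Type*} [Fintype X] [LinearOrder X] [Fintype T] (A : MarkerSystem X T)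

/-- States with invariant signs. -/
@[ext] structure Enhanced where
  /-- the markers -/
  marker : X → Bool
  /-- the signs of the circles -/
  sign : T → Bool
  invariant : ClassInvariant (A.rel marker) sign

instance : Finite A.Enhanced :=
  Finite.of_injective (β := (X → Bool) × (T → Bool)) (fun S => ⟨S.marker, S.sign⟩)
    fun _ _ h => Enhanced.ext (congrArg Prod.fst h) (congrArg Prod.snd h)

noncomputable instance : Fintype A.Enhanced := Fintype.ofFinite _

variable {A}

/-- The incidence condition at the crossing `v`. -/
def Incidence (v : X) (S S' : A.Enhanced) : Prop :=
  S.marker v = true ∧ S'.marker = flipAt S.marker v ∧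
    EdgeRule (A.rel S.marker) (A.rel S'.marker) (A.left v) (A.right v) S.sign S'.sign

/-- The number of negative markers at crossings bigger than `v`. -/
def negAbove (s : X → Bool) (v : X) : ℕ := (Finset.univ.filter fun x => v < x ∧ s x = false).card

open Classical in
/-- The matrix of the differential. -/
noncomputable def matrix (S S' : A.Enhanced) : ℤ :=
  ∑ v : X, if Incidence v S S' then (-1) ^ negAbove S.marker v else 0

theorem negAbove_flipAt {s : X → Bool} {v w : X} (hv : s v = true) :
    negAbove (flipAt s v) w = negAbove s w + if w < v then 1 else 0 := by
  unfold negAbove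
  split_ifs with h
  · rw [← Finset.card_insert_of_notMem (a := v)]
    · congr 1
      ext x
      by_cases hx : x = v
      · subst hx; simp [flipAt_self, hv, h]
      · simp [flipAt_of_ne _ hx, hx]
    · simp [hv]
  · congr 1
    ext x
    by_cases hx : x = v
    · subst hx; simp [h]
    · simp [flipAt_of_ne _ hx]

open Classical in
theorem sum_enhanced (s : X → Bool) (f : A.Enhanced → ℤ) (hf : ∀ c, f c ≠ 0 → c.marker = s) :
    ∑ c, f c = ∑ ε : T → Bool, if h : ClassInvariant (A.rel s) ε then f ⟨s, ε, h⟩ else 0 := by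
  rw [← Finset.sum_filter_add_sum_filter_not _ (fun c : A.Enhanced => c.marker = s),
    Finset.sum_eq_zero (s := Finset.univ.filter fun c : A.Enhanced => ¬ c.marker = s), add_zero]
  · refine Finset.sum_of_injOn (fun c => c.sign) ?_ (fun _ _ => by simp) ?_ ?_
    · intro c hc c' hc' h
      simp only [Finset.coe_filter, Finset.mem_univ, true_and] at hc hc'
      exact Enhanced.ext (hc.trans hc'.symm) h
    · intro ε _ hε
      rw [dif_neg]
      intro h
      refine hε ⟨⟨s, ε, h⟩, ?_, rfl⟩
      simp only [Finset.coe_filter, Finset.mem_univ, true_and]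
      exact rfl
    · rintro ⟨s1, ε1, h1⟩ hc
      obtain rfl : s1 = s := (Finset.mem_filter.1 hc).2
      rw [dif_pos h1]
  · intro c hc
    by_contra h
    exact (Finset.mem_filter.1 hc).2 (hf c h)

theorem linearMap_apply_eq_sum {α β : Type*} [Fintype α] (f : (α →₀ ℤ) →ₗ[ℤ] (β →₀ ℤ))
    (z : α →₀ ℤ) (e : β) : f z e = ∑ c, z c * f (Finsupp.single c 1) e := by
  have hz : z = ∑ c, z c • Finsupp.single c (1 : ℤ) := by
    simp
  conv_lhs => rw [hz]
  rw [map_sum, Finsupp.finsetSum_apply]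
  exact Finset.sum_congr rfl fun c _ => by rw [map_smul]; rfl

open Classical in
/-- The number of ways to get from `b` to `e` over the edges at `v` and then at `w`. -/
theorem sum_incidence_mul_incidence {v w : X} (hvw : v ≠ w) {b e : A.Enhanced}
    (hv : b.marker v = true) (hw : b.marker w = true) (he : e.marker = flipAt (flipAt b.marker v) w) :
    ∑ c, (if Incidence v b c then (1 : ℤ) else 0) * (if Incidence w c e then 1 else 0)
      = edgeMap (A.rel (flipAt b.marker v)) (A.rel e.marker) (A.left w) (A.right w)
          (edgeMap (A.rel b.marker) (A.rel (flipAt b.marker v)) (A.left v) (A.right v)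
            (Finsupp.single b.sign 1)) e.sign := by
  rw [linearMap_apply_eq_sum, sum_enhanced (flipAt b.marker v)]
  · refine Finset.sum_congr rfl fun ε _ => ?_
    by_cases h : ClassInvariant (A.rel (flipAt b.marker v)) ε
    · have h2 := A.merges_or (flipAt b.marker v) w
      rw [← he] at h2
      rw [dif_pos h, edgeMap_single_apply (A.merges_or b.marker v) b.invariant h,
        edgeMap_single_apply h2 h e.invariant]
      have h3 : flipAt b.marker v w = true := by rw [flipAt_of_ne _ hvw.symm, hw]
      congr 1
      · exact if_congr ⟨fun h => h.2.2, fun h => ⟨hv, rfl, h⟩⟩ rfl rfl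
      · exact if_congr ⟨fun h => h.2.2, fun h => ⟨h3, he, h⟩⟩ rfl rfl
    -- Sign functions that are not constant on circles carry no enhanced state; they do not occur in
    -- the image of the edge map either.
    · have : edgeMap (A.rel b.marker) (A.rel (flipAt b.marker v)) (A.left v) (A.right v)
            (Finsupp.single b.sign 1) ε = 0 := by
        by_contra h0
        have h1 := edgeMap_mem (A.merges_or b.marker v) (single_mem_invariants b.invariant)
        have h2 := (Finsupp.mem_supported ℤ _).1 h1 (Finsupp.mem_support_iff.2 h0)
        exact h h2
      rw [dif_neg h, this, zero_mul]
  · intro c hc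
    have := left_ne_zero_of_mul hc
    by_contra h
    exact this (if_neg fun h' => h h'.2.1)

/-- Sort the paths from `b` to `e` by the ordered pair of crossings changed. Exchanging the two
crossings keeps the value of the composed edge maps and reverses the sign. -/
theorem matrix_mul_matrix (b e : A.Enhanced) : ∑ c, matrix b c * matrix c e = 0 := by
  classical
  set F : X → X → ℤ := fun v w => ∑ c,
    (if Incidence v b c then (-1) ^ negAbove b.marker v else 0) *
      (if Incidence w c e then (-1) ^ negAbove c.marker w else 0) with hF
  have h1 : ∑ c, matrix b c * matrix c e = ∑ v, ∑ w, F v w := by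
    simp only [matrix, Finset.sum_mul_sum]
    rw [Finset.sum_comm]
    refine Finset.sum_congr rfl fun v _ => ?_
    rw [Finset.sum_comm]
  have hterm : ∀ v w, F v w ≠ 0 → v ≠ w ∧ b.marker v = true ∧ b.marker w = true ∧
      e.marker = flipAt (flipAt b.marker v) w := by
    intro v w h
    obtain ⟨c, -, hc⟩ := Finset.exists_ne_zero_of_sum_ne_zero h
    have hv : Incidence v b c := by
      by_contra h'; exact hc (by simp [h'])
    have hw : Incidence w c e := by
      by_contra h'; exact hc (by simp [h'])
    have hvw : v ≠ w := by
      rintro rfl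
      have := hw.1
      rw [hv.2.1, flipAt_self, hv.1] at this
      simp at this
    refine ⟨hvw, hv.1, ?_, ?_⟩
    · have := hw.1
      rwa [hv.2.1, flipAt_of_ne _ hvw.symm] at this
    · rw [← hv.2.1]; exact hw.2.1
  have hval : ∀ v w, v ≠ w → b.marker v = true → b.marker w = true →
      e.marker = flipAt (flipAt b.marker v) w →
      F v w = (-1) ^ negAbove b.marker v * (-1) ^ negAbove (flipAt b.marker v) w *
        edgeMap (A.rel (flipAt b.marker v)) (A.rel e.marker) (A.left w) (A.right w)
          (edgeMap (A.rel b.marker) (A.rel (flipAt b.marker v)) (A.left v) (A.right v)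
            (Finsupp.single b.sign 1)) e.sign := by
    intro v w hvw hv hw he
    rw [← sum_incidence_mul_incidence hvw hv hw he, Finset.mul_sum]
    refine Finset.sum_congr rfl fun c _ => ?_
    by_cases h : Incidence v b c
    · rw [if_pos h, if_pos h, h.2.1]
      split_ifs <;> ring
    · simp [h]
  have hanti : ∀ v w, F v w = - F w v := by
    have key : ∀ v w, F v w ≠ 0 → F v w = - F w v := by
      intro v w h
      obtain ⟨hvw, hv, hw, he⟩ := hterm v w h
      have he' : e.marker = flipAt (flipAt b.marker w) v := by rw [he, flipAt_comm]
      rw [hval v w hvw hv hw he, hval w v hvw.symm hw hv he', negAbove_flipAt hv,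
        negAbove_flipAt hw]
      have h2 := A.merges_or (flipAt b.marker v) w
      have h3 := A.merges_or (flipAt b.marker w) v
      rw [← he] at h2
      rw [← he'] at h3
      rw [edgeMap_edgeMap_comm (A.merges_or b.marker v) h2 (A.merges_or b.marker w) h3
        (single_mem_invariants b.invariant)]
      -- The change at the larger crossing adds one negative marker above the smaller one, but not
      -- conversely; so exactly one of the two orders acquires an extra sign.
      rcases lt_or_gt_of_ne hvw with hlt | hlt
      · rw [if_neg (not_lt.2 hlt.le), if_pos hlt]; ring
      · rw [if_pos hlt, if_neg (not_lt.2 hlt.le)]; ring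
    intro v w
    by_cases h : F v w = 0
    · by_cases h' : F w v = 0
      · rw [h, h', neg_zero]
      · rw [key w v h', neg_neg]
    · exact key v w h
  rw [h1]
  have h2 : ∑ v, ∑ w, F v w = - ∑ v, ∑ w, F v w := by
    conv_lhs => rw [Finset.sum_comm]
    rw [← Finset.sum_neg_distrib]
    refine Finset.sum_congr rfl fun v _ => ?_
    rw [← Finset.sum_neg_distrib]
    exact Finset.sum_congr rfl fun w _ => hanti w v
  linarith

end MarkerSystem

end MarkerSystem

/-! ### Subcubes -/

namespace MarkerSystem

variable {X T : Type*} [Fintype X] [LinearOrder X]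

/-- The states `s` which agree with `s₀` off `W`. -/
def InCube (W : Finset X) (s₀ s : X → Bool) : Prop := ∀ x, x ∉ W → s x = s₀ x

/-- The state in the cube of `s₀` with positive markers on `W`. -/
def topState (W : Finset X) (s₀ : X → Bool) : X → Bool := fun x => if x ∈ W then true else s₀ x

/-- The state in the cube of `s₀` with negative markers on `W`. -/
def botState (W : Finset X) (s₀ : X → Bool) : X → Bool := fun x => if x ∈ W then false else s₀ x

variable {W : Finset X} {s₀ s : X → Bool} {v : X}

theorem InCube.refl (W : Finset X) (s : X → Bool) : InCube W s s := fun _ _ => rfl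

theorem InCube.symm (h : InCube W s₀ s) : InCube W s s₀ := fun x hx => (h x hx).symm

theorem InCube.trans {s' : X → Bool} (h : InCube W s₀ s) (h' : InCube W s s') :
    InCube W s₀ s' := fun x hx => (h' x hx).trans (h x hx)

theorem InCube.mono {W' : Finset X} (h : InCube W s₀ s) (hW : W ⊆ W') : InCube W' s₀ s :=
  fun x hx => h x fun hx' => hx (hW hx')

theorem inCube_update (hv : v ∈ W) (m : Bool) : InCube W s₀ (Function.update s₀ v m) := by
  intro x hx
  rw [Function.update_of_ne]
  rintro rfl
  exact hx hv

theorem inCube_flipAt (hv : v ∈ W) : InCube W s (flipAt s v) := inCube_update hv _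

theorem inCube_topState : InCube W s₀ (topState W s₀) := fun _ hx => if_neg hx

theorem inCube_botState : InCube W s₀ (botState W s₀) := fun _ hx => if_neg hx

theorem inCube_erase_update (hv : v ∈ W) (m : Bool) :
    InCube (W.erase v) (Function.update s₀ v m) s ↔ InCube W s₀ s ∧ s v = m := by
  constructor
  · intro h
    exact ⟨(inCube_update hv m).trans (h.mono (Finset.erase_subset v W)),
      by rw [h v (by simp), Function.update_self]⟩
  · rintro ⟨h, hvm⟩ x hx
    by_cases hxv : x = v
    · subst hxv; rw [hvm, Function.update_self]
    · rw [Function.update_of_ne hxv]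
      exact h x fun hxW => hx (Finset.mem_erase.2 ⟨hxv, hxW⟩)

theorem topState_erase_true (hv : v ∈ W) :
    topState (W.erase v) (Function.update s₀ v true) = topState W s₀ := by
  funext x
  by_cases h : x = v
  · subst h; simp [topState, hv]
  · simp [topState, h]

theorem botState_erase_false (hv : v ∈ W) :
    botState (W.erase v) (Function.update s₀ v false) = botState W s₀ := by
  funext x
  by_cases h : x = v
  · subst h; simp [botState, hv]
  · simp [botState, h]

theorem topState_erase_false (hv : v ∈ W) :
    topState (W.erase v) (Function.update s₀ v false) = flipAt (topState W s₀) v := by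
  funext x
  by_cases h : x = v
  · subst h; simp [topState, hv, flipAt_self]
  · simp [topState, h, flipAt_of_ne]

theorem botState_erase_true (hv : v ∈ W) :
    botState (W.erase v) (Function.update s₀ v true) = flipAt (botState W s₀) v := by
  funext x
  by_cases h : x = v
  · subst h; simp [botState, hv, flipAt_self]
  · simp [botState, h, flipAt_of_ne]

theorem inCube_induction {P : (X → Bool) → Prop} (h0 : P s₀)
    (hstep : ∀ s, P s → ∀ w ∈ W, P (flipAt s w)) (hs : InCube W s₀ s) : P s := by
  induction hn : (Finset.univ.filter fun x => s x ≠ s₀ x).card generalizing s with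
  | zero =>
    have : s = s₀ := by
      funext x
      by_contra h
      rw [Finset.card_eq_zero] at hn
      exact Finset.notMem_empty x (hn ▸ (by simpa using h))
    exact this ▸ h0
  | succ n ih =>
    obtain ⟨x, hx⟩ := Finset.card_pos.1 (by rw [hn]; exact Nat.succ_pos n)
    have hx' : s x ≠ s₀ x := (Finset.mem_filter.1 hx).2
    have hxW : x ∈ W := by
      by_contra h; exact hx' (hs x h)
    rw [← flipAt_flipAt s x]
    refine hstep _ (ih (hs.trans (inCube_flipAt hxW)) ?_) x hxW
    have h1 : (Finset.univ.filter fun y => flipAt s x y ≠ s₀ y)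
        = (Finset.univ.filter fun y => s y ≠ s₀ y).erase x := by
      ext y
      by_cases hy : y = x
      · subst hy
        have : (!s y) = s₀ y := by
          revert hx'; cases s y <;> cases s₀ y <;> simp
        simp [flipAt_self, this]
      · simp [flipAt_of_ne, hy]
    rw [h1, Finset.card_erase_of_mem hx, hn]; rfl

variable (A : MarkerSystem X T)

/-- A union of circles, for one and then for all states of the cube, which contains with one of the
two arcs at a crossing of `W` also the other one. -/
def Saturated (W : Finset X) (s₀ : X → Bool) (Z : Set T) : Prop :=
  (∀ x y, A.rel s₀ x y → x ∈ Z → y ∈ Z) ∧ ∀ w ∈ W, (A.left w ∈ Z ↔ A.right w ∈ Z)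

variable {A} {Y Z : Set T}

/-- A change of marker at `w` only merges or splits the circles of the two arcs at `w`, and these
arcs lie on the same side of `Z`. Hence saturation does not depend on the chosen state of the cube.
-/
theorem Saturated.inCube (h : A.Saturated W s₀ Z) (hs : InCube W s₀ s) : A.Saturated W s Z := by
  refine inCube_induction (P := fun s => A.Saturated W s Z) h ?_ hs
  rintro s ⟨h1, h2⟩ w hw
  refine ⟨?_, h2⟩
  intro x y hxy hx
  rcases A.merges_or s w with hm | hm
  · rcases (hm.2 x y).1 hxy with h | ⟨hx', hy'⟩
    · exact h1 x y h hx
    · have hl : A.left w ∈ Z := by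
        rcases hx' with h | h
        · exact h1 _ _ h hx
        · exact (h2 w hw).2 (h1 _ _ h hx)
      rcases hy' with h | h
      · exact h1 _ _ ((A.rel s).symm h) hl
      · exact h1 _ _ ((A.rel s).symm h) ((h2 w hw).1 hl)
  · exact h1 x y (hm.le hxy) hx

theorem Saturated.mono {W' : Finset X} (h : A.Saturated W s₀ Z) (hW : W' ⊆ W) :
    A.Saturated W' s₀ Z := ⟨h.1, fun w hw => h.2 w (hW hw)⟩

theorem Saturated.mem_iff (h : A.Saturated W s₀ Z) {x y : T} (hxy : A.rel s₀ x y) :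
    x ∈ Z ↔ y ∈ Z := ⟨h.1 x y hxy, h.1 y x ((A.rel s₀).symm hxy)⟩

theorem Saturated.erase (h : A.Saturated W s₀ Z) (hv : v ∈ W) (m : Bool) :
    A.Saturated (W.erase v) (Function.update s₀ v m) Z :=
  (h.inCube (inCube_update hv m)).mono (Finset.erase_subset v W)

theorem Saturated.insert (h : A.Saturated (W.erase v) s Z) (hs : InCube W s₀ s)
    (hvZ : A.left v ∈ Z ↔ A.right v ∈ Z) : A.Saturated W s₀ Z := by
  refine Saturated.inCube ⟨h.1, fun w hw => ?_⟩ hs.symm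
  by_cases hwv : w = v
  · rw [hwv]; exact hvZ
  · exact h.2 w (Finset.mem_erase.2 ⟨hwv, hw⟩)

theorem Saturated.sdiff (h : A.Saturated W s₀ Y) (h' : A.Saturated W s₀ Z) :
    A.Saturated W s₀ (Y \ Z) :=
  ⟨fun x y hxy hx => ⟨h.1 x y hxy hx.1, fun hy => hx.2 ((h'.mem_iff hxy).2 hy)⟩,
    fun w hw => by rw [Set.mem_sdiff, Set.mem_sdiff, h.2 w hw, h'.2 w hw]⟩

theorem Saturated.union (h : A.Saturated W s₀ Y) (h' : A.Saturated W s₀ Z) :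
    A.Saturated W s₀ (Y ∪ Z) :=
  ⟨fun x y hxy hx => hx.imp (h.1 x y hxy) (h'.1 x y hxy),
    fun w hw => by rw [Set.mem_union, Set.mem_union, h.2 w hw, h'.2 w hw]⟩

/-- The circles in a union of circles without crossings of `W` do not change in the cube. -/
theorem rel_iff_of_forall_notMem (hZ : ∀ x y, A.rel s₀ x y → x ∈ Z → y ∈ Z)
    (hW : ∀ w ∈ W, A.left w ∉ Z ∧ A.right w ∉ Z) (hs : InCube W s₀ s) {x : T} (hx : x ∈ Z)
    (y : T) : A.rel s x y ↔ A.rel s₀ x y := by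
  revert x y
  refine inCube_induction (P := fun s => ∀ {x : T}, x ∈ Z → ∀ y, A.rel s x y ↔ A.rel s₀ x y)
    (fun _ _ => Iff.rfl) ?_ hs
  intro s ih w hw x hx y
  rw [← ih hx]
  have hl : ¬ A.rel s x (A.left w) := fun h => (hW w hw).1 (hZ _ _ ((ih hx _).1 h) hx)
  have hr : ¬ A.rel s x (A.right w) := fun h => (hW w hw).2 (hZ _ _ ((ih hx _).1 h) hx)
  rcases A.merges_or s w with hm | hm
  · rw [hm.2 x y]; tauto
  · have hl' : ¬ A.rel s x (A.left w) := hl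
    rw [hm.rel_iff_of_not hl']

variable (A) in
/-- The cube is connected on the union `Y` of circles. -/
structure ConnectedOn (W : Finset X) (s₀ : X → Bool) (Y : Set T) : Prop where
  saturated : A.Saturated W s₀ Y
  left_mem : ∀ w ∈ W, A.left w ∈ Y
  nonempty : Y.Nonempty
  eq_of_subset : ∀ Z ⊆ Y, Z.Nonempty → A.Saturated W s₀ Z → Z = Y

namespace ConnectedOn

theorem right_mem (h : A.ConnectedOn W s₀ Y) {w : X} (hw : w ∈ W) : A.right w ∈ Y :=
  (h.saturated.2 w hw).1 (h.left_mem w hw)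

/-- The face inherits connectedness unless a saturated set of the face separates the two arcs at
`v`: a saturated set which does not is saturated for the whole cube. -/
theorem erase_of_forall (h : A.ConnectedOn W s₀ Y) (hv : v ∈ W) {m : Bool}
    (hsep : ∀ Z ⊆ Y, A.Saturated (W.erase v) (Function.update s₀ v m) Z →
      (A.left v ∈ Z ↔ A.right v ∈ Z)) :
    A.ConnectedOn (W.erase v) (Function.update s₀ v m) Y where
  saturated := h.saturated.erase hv m
  left_mem := fun w hw => h.left_mem w (Finset.mem_of_mem_erase hw)
  nonempty := h.nonempty
  eq_of_subset := fun Z hZ hne hsat =>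
    h.eq_of_subset Z hZ hne (hsat.insert (inCube_update hv m) (hsep Z hZ hsat))

theorem erase_of_rel (h : A.ConnectedOn W s₀ Y) (hv : v ∈ W) {m : Bool}
    (hs : InCube (W.erase v) (Function.update s₀ v m) s)
    (hrel : A.rel s (A.left v) (A.right v)) :
    A.ConnectedOn (W.erase v) (Function.update s₀ v m) Y :=
  h.erase_of_forall hv fun _ _ hsat => (hsat.inCube hs).mem_iff hrel

variable [Fintype T]

/-- If no crossing joins two different circles at `s`, each circle is saturated by itself and so, by
connectedness, exhausts `Y`. -/
theorem classCount_eq_one (h : A.ConnectedOn W s₀ Y) (hs : InCube W s₀ s)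
    (hrel : ∀ w ∈ W, A.rel s (A.left w) (A.right w)) : classCount (A.rel s) Y = 1 := by
  obtain ⟨a, ha⟩ := h.nonempty
  have hsub : {t | A.rel s a t} ⊆ Y := fun t ht => (h.saturated.inCube hs).1 a t ht ha
  have hsat : A.Saturated W s {t | A.rel s a t} :=
    ⟨fun x y hxy hx => (A.rel s).trans hx hxy, fun w hw =>
      ⟨fun hx => (A.rel s).trans hx (hrel w hw),
        fun hx => (A.rel s).trans hx ((A.rel s).symm (hrel w hw))⟩⟩
  have hY := h.eq_of_subset _ hsub ⟨a, (A.rel s).refl a⟩ (hsat.inCube hs.symm)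
  exact classCount_class (a := a) fun t => by rw [← hY]; rfl

theorem merges_classCount (h : A.ConnectedOn W s₀ Y) (hv : v ∈ W) (hs : InCube W s₀ s)
    (hm : Merges (A.rel s) (A.rel (flipAt s v)) (A.left v) (A.right v)) :
    classCount (A.rel (flipAt s v)) Y = classCount (A.rel s) Y - 1 :=
  hm.classCount_eq (h.saturated.inCube (hs.trans (inCube_flipAt hv))).1 (h.left_mem v hv)

theorem split_classCount (h : A.ConnectedOn W s₀ Y) (hv : v ∈ W) (hs : InCube W s₀ s)
    (hm : Merges (A.rel (flipAt s v)) (A.rel s) (A.left v) (A.right v)) :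
    classCount (A.rel (flipAt s v)) Y = classCount (A.rel s) Y + 1 := by
  rw [hm.classCount_eq (h.saturated.inCube hs).1 (h.left_mem v hv)]; ring

/-- Two opposite states of a connected cube have together at most two circles more than the cube
has crossings. -/
theorem classCount_add_classCount_le (h : A.ConnectedOn W s₀ Y) :
    classCount (A.rel (topState W s₀)) Y + classCount (A.rel (botState W s₀)) Y ≤ W.card + 2 := by
  induction hn : W.card generalizing W s₀ with
  | zero =>
    have h0 : W = ∅ := Finset.card_eq_zero.1 hn
    rw [h.classCount_eq_one inCube_topState (by simp [h0]),
      h.classCount_eq_one inCube_botState (by simp [h0])]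
    norm_num
  | succ n ih =>
    have hcard : ∀ v ∈ W, (W.erase v).card = n := fun v hv => by
      rw [Finset.card_erase_of_mem hv, hn]; rfl
    -- A merge at the bottom leads to a connected face with one crossing and one circle fewer and
    -- the same top state, so the bound for the face suffices. The top state is treated in the same
    -- way.
    by_cases h1 : ∃ v ∈ W,
        Merges (A.rel (botState W s₀)) (A.rel (flipAt (botState W s₀) v)) (A.left v) (A.right v)
    · obtain ⟨v, hv, hm⟩ := h1
      have h2 : A.ConnectedOn (W.erase v) (Function.update s₀ v true) Y := by
        refine h.erase_of_rel hv (s := flipAt (botState W s₀) v) ?_ hm.rel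
        rw [← botState_erase_true hv]; exact inCube_botState
      have h3 := ih h2 (hcard v hv)
      rw [topState_erase_true hv, botState_erase_true hv,
        h.merges_classCount hv inCube_botState hm] at h3
      push_cast; linarith
    by_cases h2 : ∃ v ∈ W,
        Merges (A.rel (topState W s₀)) (A.rel (flipAt (topState W s₀) v)) (A.left v) (A.right v)
    · obtain ⟨v, hv, hm⟩ := h2
      have h2 : A.ConnectedOn (W.erase v) (Function.update s₀ v false) Y := by
        refine h.erase_of_rel hv (s := flipAt (topState W s₀) v) ?_ hm.rel
        rw [← topState_erase_false hv]; exact inCube_topState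
      have h3 := ih h2 (hcard v hv)
      rw [topState_erase_false hv, botState_erase_false hv,
        h.merges_classCount hv inCube_topState hm] at h3
      push_cast; linarith
    -- Without such a merge both arcs at each crossing share a circle in both extreme states, so
    -- each of these has a single circle.
    · rw [h.classCount_eq_one inCube_topState, h.classCount_eq_one inCube_botState]
      · push_cast; linarith [Nat.cast_nonneg (α := ℚ) n]
      · intro w hw
        exact ((A.merges_or _ w).resolve_left fun hm => h1 ⟨w, hw, hm⟩).rel
      · intro w hw
        exact ((A.merges_or _ w).resolve_left fun hm => h2 ⟨w, hw, hm⟩).rel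

end ConnectedOn

/-! ### Thin cubes and separating crossings -/

variable [Fintype T]

variable (A) in
/-- A connected cube in which the two extreme states have as many circles as possible. -/
structure Thin (W : Finset X) (s₀ : X → Bool) (Y : Set T) : Prop
    extends A.ConnectedOn W s₀ Y where
  count : classCount (A.rel (topState W s₀)) Y + classCount (A.rel (botState W s₀)) Y = W.card + 2

variable (A) in
/-- If the marker at `v` is `m`, then `Z` is separated from its complement, and only one arc at `v`
belongs to `Z`. -/
def Separates (W : Finset X) (s₀ : X → Bool) (v : X) (m : Bool) (Z : Set T) : Prop :=
  A.Saturated (W.erase v) (Function.update s₀ v m) Z ∧ ¬ (A.left v ∈ Z ↔ A.right v ∈ Z)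

variable (A) in
/-- The change of the marker at `v` in each of the two extreme states merges circles. -/
def MergesAtEnds (W : Finset X) (s₀ : X → Bool) (v : X) : Prop :=
  Merges (A.rel (topState W s₀)) (A.rel (flipAt (topState W s₀) v)) (A.left v) (A.right v) ∧
    Merges (A.rel (botState W s₀)) (A.rel (flipAt (botState W s₀) v)) (A.left v) (A.right v)

namespace Thin

theorem card_erase (hv : v ∈ W) : ((W.erase v).card : ℚ) = W.card - 1 := by
  rw [Finset.card_erase_of_mem hv, Nat.cast_sub (Finset.card_pos.2 ⟨v, hv⟩), Nat.cast_one]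

/-- Each face contains one of the two merged states, where the arcs at `v` share a circle, so it
stays connected. One crossing and one circle are lost, so equality in the bound persists. -/
theorem erase (h : A.Thin W s₀ Y) (hv : v ∈ W) (hm : A.MergesAtEnds W s₀ v) (m : Bool) :
    A.Thin (W.erase v) (Function.update s₀ v m) Y := by
  have hc := h.count
  cases m
  · refine ⟨h.erase_of_rel hv (s := flipAt (topState W s₀) v) ?_ hm.1.rel, ?_⟩
    · rw [← topState_erase_false hv]; exact inCube_topState
    · rw [topState_erase_false hv, botState_erase_false hv,
        h.merges_classCount hv inCube_topState hm.1, card_erase hv]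
      linarith
  · refine ⟨h.erase_of_rel hv (s := flipAt (botState W s₀) v) ?_ hm.2.rel, ?_⟩
    · rw [← botState_erase_true hv]; exact inCube_botState
    · rw [topState_erase_true hv, botState_erase_true hv,
        h.merges_classCount hv inCube_botState hm.2, card_erase hv]
      linarith

/-- If the change at `v` splits a circle at one extreme state, the face reached there has one
crossing fewer but one circle more than the thin cube, which violates the bound for connected cubes.
-/
theorem exists_separates (h : A.Thin W s₀ Y) (hv : v ∈ W) (hm : ¬ A.MergesAtEnds W s₀ v) :
    ∃ m, ∃ Z ⊆ Y, A.Separates W s₀ v m Z := by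
  by_contra hcon
  have hconn : ∀ m, A.ConnectedOn (W.erase v) (Function.update s₀ v m) Y := fun m =>
    h.erase_of_forall hv fun Z hZ hsat => by
      by_contra h'
      exact hcon ⟨m, Z, hZ, hsat, h'⟩
  have hc := h.count
  rw [MergesAtEnds, not_and_or] at hm
  rcases hm with hm | hm
  · have h1 := (A.merges_or _ v).resolve_left hm
    have h2 := (hconn false).classCount_add_classCount_le
    rw [topState_erase_false hv, botState_erase_false hv,
      h.split_classCount hv inCube_topState h1, card_erase hv] at h2
    linarith
  · have h1 := (A.merges_or _ v).resolve_left hm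
    have h2 := (hconn true).classCount_add_classCount_le
    rw [topState_erase_true hv, botState_erase_true hv,
      h.split_classCount hv inCube_botState h1, card_erase hv] at h2
    linarith

/-- If no crossing merges circles at both extreme states, then there is a separating crossing with
no other crossing on one of its sides. -/
theorem exists_separates_forall_notMem (h : A.Thin W s₀ Y) (hW : W.Nonempty)
    (hm : ∀ v ∈ W, ¬ A.MergesAtEnds W s₀ v) :
    ∃ v ∈ W, ∃ m, ∃ Z ⊆ Y, A.Separates W s₀ v m Z ∧
      ∀ w ∈ W.erase v, A.left w ∉ Z ∧ A.right w ∉ Z := by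
  classical
  set P : ℕ → Prop := fun n =>
    ∃ v ∈ W, ∃ m, ∃ Z ⊆ Y, A.Separates W s₀ v m Z ∧ Z.ncard = n with hP
  have hex : ∃ n, P n := by
    obtain ⟨v, hv⟩ := hW
    obtain ⟨m, Z, hZ, hsep⟩ := h.exists_separates hv (hm v hv)
    exact ⟨_, v, hv, m, Z, hZ, hsep, rfl⟩
  -- Take a separating side with the fewest points among all crossings and markers.
  obtain ⟨v, hv, m, Z, hZ, hsep, hcard⟩ := Nat.find_spec hex
  refine ⟨v, hv, m, Z, hZ, hsep, ?_⟩
  intro w hw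
  have hiff := hsep.1.2 w hw
  suffices A.left w ∉ Z from ⟨this, fun hr => this (hiff.2 hr)⟩
  intro hl
  have hr := hiff.1 hl
  have hwv : w ≠ v := Finset.ne_of_mem_erase hw
  have hwW : w ∈ W := Finset.mem_of_mem_erase hw
  obtain ⟨m', Z', -, hsep'⟩ := h.exists_separates hwW (hm w hwW)
  have hvw : v ∈ W.erase w := Finset.mem_erase.2 ⟨hwv.symm, hv⟩
  have h1 := hsep.1.inCube (inCube_update hw m')
  have h2 := hsep'.1.inCube (inCube_update hvw m)
  rw [Function.update_comm hwv] at h2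
  -- A part `V` of `Z` that separates `w` but not `v` would be a separating side for `w`. It is
  -- smaller, since `Z` contains both arcs at `w`.
  have hinter : ∀ V ⊆ Z, A.Saturated ((W.erase v).erase w)
      (Function.update (Function.update s₀ v m) w m') V → (A.left v ∈ V ↔ A.right v ∈ V) →
      ¬ (A.left w ∈ V ↔ A.right w ∈ V) → False := by
    intro V hVZ hV hvV hwV
    have h3 : A.Saturated (W.erase w) (Function.update s₀ w m') V := by
      refine Saturated.insert (v := v) (s := Function.update (Function.update s₀ w m') v m)
        ?_ (inCube_update hvw m) hvV
      rw [Function.update_comm hwv, Finset.erase_right_comm]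
      exact hV
    have hlt : V.ncard < Z.ncard := by
      refine Set.ncard_lt_ncard ⟨hVZ, fun hsub => hwV ?_⟩ (Set.toFinite _)
      exact ⟨fun _ => hsub hr, fun _ => hsub hl⟩
    rw [hcard] at hlt
    exact Nat.find_min hex hlt ⟨w, hwW, m', V, hVZ.trans hZ, ⟨h3, hwV⟩, rfl⟩
  have h1' := h1.mono (Finset.erase_subset w (W.erase v))
  have h2' := h2.mono (W' := (W.erase v).erase w)
    (by rw [Finset.erase_right_comm]; exact Finset.erase_subset v (W.erase w))
  have hvZ' := h2.2 v hvw
  -- The arcs at `v` are both in `Z'` or both outside. The part of `Z` outside `Z'`, respectively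
  -- inside it, contains neither of them and still separates the arcs at `w`.
  by_cases hlv : A.left v ∈ Z'
  · refine hinter (Z \ Z') Set.sdiff_subset (h1'.sdiff h2') ?_ ?_
    · simp [hlv, hvZ'.1 hlv]
    · simp only [Set.mem_sdiff, hl, hr, true_and, not_iff_not]
      exact hsep'.2
  · have hrv : A.right v ∉ Z' := fun h' => hlv (hvZ'.2 h')
    refine hinter (Z \ (Z \ Z')) Set.sdiff_subset (h1'.sdiff (h1'.sdiff h2')) ?_ ?_
    · simp [hlv, hrv]
    · simp only [Set.mem_sdiff, hl, hr, true_and, not_not]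
      exact hsep'.2

end Thin

/-- The side of a separating crossing which contains no other crossing is one circle. -/
theorem ConnectedOn.mem_iff_rel_of_separates (h : A.ConnectedOn W s₀ Y) (hv : v ∈ W) {m : Bool}
    (hZ : Z ⊆ Y) (hsep : A.Separates W s₀ v m Z)
    (hno : ∀ w ∈ W.erase v, A.left w ∉ Z ∧ A.right w ∉ Z) {y z : T}
    (hyz : (y = A.left v ∧ z = A.right v) ∨ (y = A.right v ∧ z = A.left v))
    (hy : y ∈ Z) (hz : z ∉ Z) (hs : InCube (W.erase v) (Function.update s₀ v m) s) (t : T) :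
    t ∈ Z ↔ A.rel s y t := by
  have hsat := hsep.1.inCube hs
  have hsub : {t | A.rel s y t} ⊆ Z := fun t ht => hsat.1 y t ht hy
  have hsat' : A.Saturated (W.erase v) s {t | A.rel s y t} :=
    ⟨fun a b hab ha => (A.rel s).trans ha hab, fun w hw =>
      ⟨fun h' => absurd (hsub h') (hno w hw).1, fun h' => absurd (hsub h') (hno w hw).2⟩⟩
  have hy' : y ∉ Z \ {t | A.rel s y t} := fun h' => h'.2 ((A.rel s).refl y)
  have hz' : z ∉ Z \ {t | A.rel s y t} := fun h' => hz h'.1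
  have hW : InCube W s₀ s :=
    (inCube_update hv m).trans (hs.mono (Finset.erase_subset v W))
  -- What is left of `Z` without the circle of `y` contains neither arc at `v`, so it is saturated
  -- for the whole cube. Were it not empty, it would be all of `Y` and contain `y`.
  have h1 : A.Saturated W s₀ (Z \ {t | A.rel s y t}) := by
    refine (hsat.sdiff hsat').insert hW ?_
    rcases hyz with ⟨rfl, rfl⟩ | ⟨rfl, rfl⟩ <;> simp only [hy', hz']
  refine ⟨fun ht => ?_, fun ht => hsub ht⟩
  by_contra hnt
  have h2 := h.eq_of_subset _ (Set.sdiff_subset.trans hZ) ⟨t, ht, hnt⟩ h1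
  exact hy' (h2 ▸ hZ hy)

end MarkerSystem

/-! ### The homology of thin cubes -/

section Signs

variable {T : Type*} [Fintype T] {r r' : Setoid T} {a b : T} {ε ε' : T → Bool}

theorem EdgeRule.symm (h : EdgeRule r r' a b ε ε') : EdgeRule r r' b a ε ε' :=
  ⟨fun t hb ha => h.1 t ha hb, h.2⟩

theorem setClass_setClass (r : Setoid T) (a : T) (c c' : Bool) (ε : T → Bool) :
    setClass r a c (setClass r a c' ε) = setClass r a c ε := by
  funext x
  by_cases h : r x a
  · rw [setClass_of_rel h, setClass_of_rel h]
  · rw [setClass_of_not h, setClass_of_not h, setClass_of_not h]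

theorem Merges.classInvariant_of_eq (hm : Merges r r' a b) (hε : ClassInvariant r ε)
    (hab : ε a = ε b) : ClassInvariant r' ε := by
  intro x y hxy
  rcases (hm.2 x y).1 hxy with h | ⟨hx, hy⟩
  · exact hε x y h
  · have hx' : ε x = ε a := hx.elim (fun h => hε _ _ h) fun h => (hε _ _ h).trans hab.symm
    have hy' : ε y = ε a := hy.elim (fun h => hε _ _ h) fun h => (hε _ _ h).trans hab.symm
    rw [hx', hy']

/-- A merge with a negative circle: the source is determined by the target. -/
theorem Merges.edgeRule_of_false_iff (hm : Merges r r' a b) (hε : ClassInvariant r ε)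
    (hε' : ClassInvariant r' ε') :
    ε a = false ∧ EdgeRule r r' a b ε ε' ↔ ε = setClass r a false ε' := by
  have hba : ¬ r b a := fun h => hm.1 (r.symm h)
  have hoff : ∀ x, ¬ r x a → ¬ r x b → ¬ r' x a := fun x ha hb => by
    rw [hm.rel_left_iff]; tauto
  rw [hm.edgeRule_iff hε hε']
  constructor
  · rintro ⟨ha, -, rfl⟩
    funext x
    by_cases hxa : r x a
    · rw [setClass_of_rel hxa, hε x a hxa, ha]
    rw [setClass_of_not hxa]
    by_cases hxb : r x b
    · rw [setClass_of_rel ((hm.rel_left_iff x).2 (Or.inr hxb)), ha, Bool.false_or, hε x b hxb]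
    · rw [setClass_of_not (hoff x hxa hxb)]
  · rintro rfl
    rw [setClass_self, setClass_of_not hba]
    refine ⟨rfl, by simp, ?_⟩
    funext x
    by_cases hx : r' x a
    · rw [setClass_of_rel hx, Bool.false_or, hε' x a hx, hε' a b hm.rel]
    · rw [setClass_of_not hx, setClass_of_not fun h => hx (hm.le h)]

/-- A merge with a negative circle: the target is determined by the source. -/
theorem Merges.edgeRule_iff_of_false (hm : Merges r r' a b) (hε : ClassInvariant r ε)
    (hε' : ClassInvariant r' ε') (ha : ε a = false) :
    EdgeRule r r' a b ε ε' ↔ ε' = setClass r' a (ε b) ε := by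
  rw [hm.edgeRule_iff hε hε', ha]
  simp

/-- A split with a positive circle: the target is determined by the source. -/
theorem Merges.edgeRule_split_of_true_iff (hm : Merges r' r a b) (hε : ClassInvariant r ε)
    (hε' : ClassInvariant r' ε') :
    ε' a = true ∧ EdgeRule r r' a b ε ε' ↔ ε' = setClass r' a true ε := by
  rw [hm.edgeRule_split_iff hε hε']
  constructor
  · rintro ⟨ha, ⟨h1, rfl⟩ | ⟨h1, rfl | rfl⟩⟩
    · rw [← h1, setClass_eq_self hε']
    · rfl
    · rw [setClass_of_not hm.1, h1] at ha
      exact absurd ha (by simp)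
  · rintro rfl
    refine ⟨setClass_self _ _ _ _, ?_⟩
    cases ha : ε a
    · exact Or.inr ⟨rfl, Or.inl rfl⟩
    · exact Or.inl ⟨rfl, by rw [← ha, setClass_eq_self (hm.classInvariant hε)]⟩

/-- A split with a positive circle: the source is determined by the target. -/
theorem Merges.edgeRule_split_iff_of_true (hm : Merges r' r a b) (hε : ClassInvariant r ε)
    (hε' : ClassInvariant r' ε') (ha : ε' a = true) :
    EdgeRule r r' a b ε ε' ↔ ε = setClass r' a (ε' b) ε' := by
  have h1 := hm.edgeRule_split_of_true_iff hε hε'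
  have hba : ¬ r' b a := fun h => hm.1 (r'.symm h)
  have h2 : EdgeRule r r' a b ε ε' ↔ ε' = setClass r' a true ε := by
    rw [← h1]; simp [ha]
  rw [h2]
  constructor
  · rintro rfl
    rw [setClass_of_not hba, setClass_setClass, ← hε a b hm.rel,
      setClass_eq_self (hm.classInvariant hε)]
  · intro h
    rw [h, setClass_setClass, ← ha, setClass_eq_self hε']

end Signs

/-! ### Bidegrees, subquotients of cubes and their diagonals -/

namespace MarkerSystem

variable {X T : Type*} [Fintype X] [LinearOrder X] [Fintype T] {A : MarkerSystem X T}
  {W : Finset X} {s₀ s : X → Bool} {v : X} {Y Z : Set T} {sg : T → Bool}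

/-- The sum of the markers of a state. -/
def markerSum (s : X → Bool) : ℤ := ∑ x, if s x = true then 1 else -1

theorem markerSum_flipAt (h : s v = true) : markerSum (flipAt s v) = markerSum s - 2 := by
  rw [markerSum, markerSum, ← Finset.add_sum_erase _ _ (Finset.mem_univ v),
    ← Finset.add_sum_erase (a := v) _ (fun x => if s x = true then (1 : ℤ) else -1)
      (Finset.mem_univ v)]
  have : ∑ x ∈ Finset.univ.erase v, (if flipAt s v x = true then (1 : ℤ) else -1)
      = ∑ x ∈ Finset.univ.erase v, if s x = true then (1 : ℤ) else -1 :=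
    Finset.sum_congr rfl fun x hx => by rw [flipAt_of_ne _ (Finset.ne_of_mem_erase hx)]
  rw [this]
  simp only [flipAt_self, h, Bool.not_true, if_true]
  simp only [Bool.false_eq_true, if_false]
  ring

/-- The bidegree of an enhanced state. -/
noncomputable def bidegree (S : A.Enhanced) : ℤ × ℚ :=
  (markerSum S.marker, markerSum S.marker + 2 * signSum (A.rel S.marker) S.sign)

/-- The bidegree of the source of the differential. -/
def sourceDegree (n : ℤ × ℚ) : ℤ × ℚ := (n.1 + 2, n.2)

theorem sourceDegree_injective : Function.Injective sourceDegree := by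
  rintro ⟨i, j⟩ ⟨i', j'⟩ h
  simp only [sourceDegree, Prod.mk.injEq] at h
  ext
  · simpa using h.1
  · exact h.2

theorem Incidence.unique {v w : X} {b c : A.Enhanced} (h : Incidence v b c)
    (h' : Incidence w b c) : v = w := by
  by_contra hvw
  have h1 := congrFun (h.2.1.symm.trans h'.2.1) v
  rw [flipAt_self, flipAt_of_ne _ hvw] at h1
  simp at h1

theorem Incidence.matrix_eq {b c : A.Enhanced} (h : Incidence v b c) :
    matrix b c = (-1) ^ negAbove b.marker v := by
  classical
  rw [matrix, Finset.sum_eq_single v, if_pos h]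
  · intro w _ hw
    exact if_neg fun h' => hw (h'.unique h)
  · simp

theorem matrix_ne_zero_iff {b c : A.Enhanced} : matrix b c ≠ 0 ↔ ∃ v, Incidence v b c := by
  classical
  constructor
  · intro h
    obtain ⟨v, -, hv⟩ := Finset.exists_ne_zero_of_sum_ne_zero h
    exact ⟨v, by_contra fun h' => hv (if_neg h')⟩
  · rintro ⟨v, hv⟩
    rw [hv.matrix_eq]
    exact pow_ne_zero _ (by norm_num)

theorem matrix_mul_self {b c : A.Enhanced} (h : matrix b c ≠ 0) : matrix b c * matrix b c = 1 := by
  obtain ⟨v, hv⟩ := matrix_ne_zero_iff.1 h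
  rw [hv.matrix_eq, ← mul_pow]
  norm_num

theorem bidegree_eq {b c : A.Enhanced} (h : matrix b c ≠ 0) :
    bidegree b = sourceDegree (bidegree c) := by
  obtain ⟨v, hv1, hv2, hv3⟩ := matrix_ne_zero_iff.1 h
  have h1 := markerSum_flipAt hv1
  rw [← hv2] at h1
  have h2 := hv3.2
  ext
  · simp [bidegree, sourceDegree, h1]
  · simp only [bidegree, sourceDegree, h1, h2]
    push_cast; ring

variable (A) in
/-- The enhanced states whose markers off `W` are those of `s₀` and whose signs off `Y` are those
of `sg`. -/
def cubeStates (W : Finset X) (s₀ : X → Bool) (Y : Set T) (sg : T → Bool) : Set A.Enhanced :=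
  {S | InCube W s₀ S.marker ∧ ∀ t, t ∉ Y → S.sign t = sg t}

theorem exists_incidence_of_mem {b c : A.Enhanced} (hb : b ∈ A.cubeStates W s₀ Y sg)
    (hc : c ∈ A.cubeStates W s₀ Y sg) (h : matrix b c ≠ 0) : ∃ v ∈ W, Incidence v b c := by
  obtain ⟨v, hv⟩ := matrix_ne_zero_iff.1 h
  refine ⟨v, ?_, hv⟩
  by_contra hvW
  have h1 := (hc.1 v hvW).trans (hb.1 v hvW).symm
  rw [hv.2.1, flipAt_self] at h1
  simp at h1

/-- A saturated set which does not contain the arcs at `v` keeps its signs. -/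
theorem Incidence.sign_eq {b c : A.Enhanced} (h : Incidence v b c)
    (hY : ∀ x y, A.rel b.marker x y → x ∈ Y → y ∈ Y) {t : T} (ht : t ∈ Y)
    (hl : A.left v ∉ Y) (hr : A.right v ∉ Y) : c.sign t = b.sign t :=
  h.2.2.1 t (fun h' => hl (hY _ _ h' ht)) fun h' => hr (hY _ _ h' ht)

theorem ConnectedOn.notMem_of_rel (h : A.ConnectedOn W s₀ Y) (hs : InCube W s₀ s) {x y : T}
    (hxy : A.rel s x y) (hx : x ∉ Y) : y ∉ Y :=
  fun hy => hx (((h.saturated.inCube hs).mem_iff hxy).2 hy)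

/-- Markers only turn from positive to negative, so a crossing changed on the way from `b` to `e`
has different markers at `b` and `e` and belongs to `W`. Its arcs lie in `Y`, so the signs off `Y`
stay fixed. -/
theorem ConnectedOn.isSubquotient (h : A.ConnectedOn W s₀ Y) :
    IsSubquotient matrix (A.cubeStates W s₀ Y sg) := by
  intro b c e hb he hbc hce
  obtain ⟨v, hv⟩ := matrix_ne_zero_iff.1 hbc
  obtain ⟨w, hw⟩ := matrix_ne_zero_iff.1 hce
  have hcv : c.marker v = false := by rw [hv.2.1, flipAt_self, hv.1]; rfl
  have hvW : v ∈ W := by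
    by_contra hvW
    have h1 := (hb.1 v hvW).trans (he.1 v hvW).symm
    have hvw : v ≠ w := by
      rintro rfl
      rw [hw.1] at hcv
      simp at hcv
    rw [hw.2.1, flipAt_of_ne _ hvw, hcv, hv.1] at h1
    simp at h1
  refine ⟨?_, fun t ht => ?_⟩
  · rw [hv.2.1]
    exact hb.1.trans (inCube_flipAt hvW)
  · rw [← hb.2 t ht]
    exact hv.sign_eq (Y := Yᶜ) (fun x y hxy hx => h.notMem_of_rel hb.1 hxy hx) ht
      (fun h' => h' (h.left_mem v hvW)) fun h' => h' (h.right_mem hvW)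

theorem mem_cubeStates_erase (hv : v ∈ W) (m : Bool) {S : A.Enhanced} :
    S ∈ A.cubeStates (W.erase v) (Function.update s₀ v m) Y sg ↔
      S ∈ A.cubeStates W s₀ Y sg ∧ S.marker v = m := by
  simp only [cubeStates, Set.mem_ofPred_eq, inCube_erase_update hv]
  tauto

open Classical in
/-- The values of the signs which are positive on `Y` and equal to `sg` off `Y`. -/
noncomputable def topValue (Y : Set T) (sg : T → Bool) (t : T) : ℚ :=
  if t ∈ Y then 1 else signValue (sg t)

theorem topValue_of_mem {t : T} (ht : t ∈ Y) : topValue Y sg t = 1 := if_pos ht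

theorem topValue_of_notMem {t : T} (ht : t ∉ Y) : topValue Y sg t = signValue (sg t) := if_neg ht

variable (A) in
/-- The diagonal of the enhanced state with positive signs and markers where these are free. -/
noncomputable def topDiagonal (W : Finset X) (s₀ : X → Bool) (Y : Set T) (sg : T → Bool) : ℚ :=
  2 * classSum (A.rel (topState W s₀)) (topValue Y sg) -
    markerSum (topState W s₀)

variable (A) in
/-- The homology of the subquotient belonging to a cube lies on two adjacent diagonals. -/
def OnTwoDiagonals (W : Finset X) (s₀ : X → Bool) (Y : Set T) (sg : T → Bool) : Prop :=
  ∀ (i : ℤ) (j : ℚ), j - 2 * i ≠ A.topDiagonal W s₀ Y sg →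
    j - 2 * i ≠ A.topDiagonal W s₀ Y sg - 4 →
    ExactOn matrix bidegree sourceDegree (A.cubeStates W s₀ Y sg) (i, j)

/-- The fixed signs off `Y` are constant on circles. -/
def FixedSigns (A : MarkerSystem X T) (s₀ : X → Bool) (Y : Set T) (sg : T → Bool) : Prop :=
  ∀ x y, A.rel s₀ x y → x ∉ Y → sg x = sg y

/-- The circles off `Y` meet no crossing of `W`, hence they are the same for all states of the cube.
-/
theorem ConnectedOn.fixedSigns (h : A.ConnectedOn W s₀ Y) (hsg : A.FixedSigns s₀ Y sg)
    (hs : InCube W s₀ s) : A.FixedSigns s Y sg := by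
  intro x y hxy hx
  refine hsg x y ?_ hx
  rwa [← rel_iff_of_forall_notMem (Z := Yᶜ)
    (fun x y hxy hx => h.notMem_of_rel (InCube.refl W s₀) hxy hx)
    (fun w hw => ⟨fun h' => h' (h.left_mem w hw), fun h' => h' (h.right_mem hw)⟩) hs hx]

theorem ConnectedOn.topValue_eq (h : A.ConnectedOn W s₀ Y) (hsg : A.FixedSigns s₀ Y sg)
    (hs : InCube W s₀ s) {x y : T} (hxy : A.rel s x y) :
    topValue Y sg x = topValue Y sg y := by
  have h1 := (h.saturated.inCube hs).mem_iff hxy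
  by_cases hx : x ∈ Y
  · rw [topValue_of_mem hx, topValue_of_mem (h1.1 hx)]
  · rw [topValue_of_notMem hx, topValue_of_notMem (mt h1.2 hx), h.fixedSigns hsg hs x y hxy hx]

/-- Only one state remains and `Y` is one circle. Its positive sign gives the top diagonal; the
negative sign lowers 2τ by 4. -/
theorem ConnectedOn.onTwoDiagonals_of_empty (h : A.ConnectedOn ∅ s₀ Y)
    (hsg : A.FixedSigns s₀ Y sg) : A.OnTwoDiagonals ∅ s₀ Y sg := by
  classical
  intro i j hij hij'
  refine exactOn_of_forall_ne ?_
  rintro ⟨s, ε, hε⟩ ⟨hs, hS⟩ hdeg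
  replace hS : ∀ t, t ∉ Y → ε t = sg t := hS
  obtain rfl : s = s₀ := funext fun x => hs x (Finset.notMem_empty x)
  have htop : topState ∅ s = s := funext fun x => if_neg (Finset.notMem_empty x)
  rw [topDiagonal, htop] at hij hij'
  obtain ⟨a, ha⟩ := h.nonempty
  have hsub : {t | A.rel s a t} ⊆ Y := fun t ht => h.saturated.1 a t ht ha
  have hYa := h.eq_of_subset {t | A.rel s a t} hsub ⟨a, (A.rel s).refl a⟩
    ⟨fun x y hxy hx => (A.rel s).trans hx hxy, by simp⟩
  have hY : ∀ t, t ∈ Y ↔ A.rel s a t := fun t => by rw [← hYa]; rfl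
  have h1 : j - 2 * i = 2 * signSum (A.rel s) ε - markerSum s := by
    simp only [bidegree, Prod.mk.injEq] at hdeg
    rw [← hdeg.1, ← hdeg.2]; ring
  have h2 := classSum_congr_class (A.rel s) (topValue Y sg)
    (fun t => signValue (ε t)) a
    (fun t ht => (h.topValue_eq hsg (InCube.refl _ _) ht).symm)
    (fun t ht => by rw [hε a t ht]) fun t ht => by
      have : t ∉ Y := by rwa [hY]
      rw [topValue_of_notMem this, hS t this]
  rw [h1, signSum, h2] at hij hij'
  rw [topValue_of_mem ha] at hij hij'
  cases hεa : ε a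
  · rw [hεa] at hij'
    apply hij'
    simp only [signValue, Bool.false_eq_true, if_false]
    ring
  · rw [hεa] at hij
    apply hij
    simp only [signValue, if_true]
    ring

theorem topDiagonal_erase_true (hv : v ∈ W) :
    A.topDiagonal (W.erase v) (Function.update s₀ v true) Y sg = A.topDiagonal W s₀ Y sg := by
  rw [topDiagonal, topDiagonal, topState_erase_true hv]

theorem topState_apply (hv : v ∈ W) : topState W s₀ v = true := if_pos hv

/-- The diagonal is 2τ - σ. Changing the marker at `v` lowers σ by 2, and the merge of two positive
circles into one positive circle lowers 2τ by 2. -/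
theorem ConnectedOn.topDiagonal_erase_false (h : A.ConnectedOn W s₀ Y)
    (hsg : A.FixedSigns s₀ Y sg) (hv : v ∈ W) (hm : A.MergesAtEnds W s₀ v) :
    A.topDiagonal (W.erase v) (Function.update s₀ v false) Y sg = A.topDiagonal W s₀ Y sg := by
  classical
  rw [topDiagonal, topDiagonal, topState_erase_false hv, markerSum_flipAt (topState_apply hv),
    hm.1.classSum_eq (topValue Y sg) _
      (fun x y hxy => h.topValue_eq hsg inCube_topState hxy)
      (fun x y hxy => h.topValue_eq hsg (inCube_topState.trans (inCube_flipAt hv)) hxy)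
      (fun _ _ _ => rfl)]
  rw [topValue_of_mem (h.left_mem v hv), topValue_of_mem (h.right_mem hv)]
  push_cast; ring

/-- The differential does not raise markers. -/
theorem matrix_eq_zero_of_marker {b c : A.Enhanced} (hb : b.marker v = false)
    (hc : c.marker v = true) : matrix b c = 0 := by
  by_contra h
  obtain ⟨w, hw⟩ := matrix_ne_zero_iff.1 h
  by_cases hvw : v = w
  · subst hvw
    rw [hw.1] at hb
    simp at hb
  · rw [hw.2.1, flipAt_of_ne _ hvw, hb] at hc
    simp at hc

/-- The states with negative marker at `v` form a subcomplex with the positive ones as quotient.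
Both faces have the diagonals of the cube, so exactness elsewhere passes to the extension. -/
theorem ConnectedOn.onTwoDiagonals_of_merges (h : A.ConnectedOn W s₀ Y)
    (hsg : A.FixedSigns s₀ Y sg) (hv : v ∈ W) (hm : A.MergesAtEnds W s₀ v)
    (ih : ∀ m, A.OnTwoDiagonals (W.erase v) (Function.update s₀ v m) Y sg) :
    A.OnTwoDiagonals W s₀ Y sg := by
  intro i j hij hij'
  have h0 := ih false i j (by rwa [h.topDiagonal_erase_false hsg hv hm])
    (by rwa [h.topDiagonal_erase_false hsg hv hm])
  have h1 := ih true i j (by rwa [topDiagonal_erase_true hv]) (by rwa [topDiagonal_erase_true hv])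
  refine ExactOn.extension (U := {S | S.marker v = false}) matrix_mul_matrix
    (fun _ _ => bidegree_eq) sourceDegree_injective h.isSubquotient ?_ ?_ ?_
  · intro b hb c hc
    exact matrix_eq_zero_of_marker hb.2 (by simpa using hc.2)
  · convert h0 using 1
    ext S
    rw [mem_cubeStates_erase hv]; rfl
  · convert h1 using 1
    ext S
    rw [mem_cubeStates_erase hv]
    simp

/-- At a crossing `v` where `Z` is a circle if the marker is `m`: the part of the subquotient in
which not both the marker is `m` and the sign of `Z` is `m`, is acyclic. -/
theorem ConnectedOn.exactOn_complement (h : A.ConnectedOn W s₀ Y) (hv : v ∈ W) {m : Bool}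
    {G : Set A.Enhanced} {y z : T}
    (hyz : (y = A.left v ∧ z = A.right v) ∨ (y = A.right v ∧ z = A.left v))
    (hsep : ∀ s, InCube W s₀ s → s v = m → ¬ A.rel s y z)
    (hG : ∀ S, S ∈ G ↔ S ∈ A.cubeStates W s₀ Y sg ∧ ¬ (S.marker v = m ∧ S.sign y = m))
    (hsub : IsSubquotient matrix G) (n : ℤ × ℚ) : ExactOn matrix bidegree sourceDegree G n := by
  have hyY : y ∈ Y := by
    rcases hyz with ⟨rfl, -⟩ | ⟨rfl, -⟩
    · exact h.left_mem v hv
    · exact h.right_mem hv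
  have hor : ∀ s, Merges (A.rel s) (A.rel (flipAt s v)) y z ∨
      Merges (A.rel (flipAt s v)) (A.rel s) y z := by
    intro s
    rcases hyz with ⟨rfl, rfl⟩ | ⟨rfl, rfl⟩
    · exact A.merges_or s v
    · exact (A.merges_or s v).imp Merges.symm Merges.symm
  have hrule : ∀ b c : A.Enhanced, b.marker v = true → c.marker v = false →
      (matrix b c ≠ 0 ↔ c.marker = flipAt b.marker v ∧
        EdgeRule (A.rel b.marker) (A.rel c.marker) y z b.sign c.sign) := by
    intro b c hb hc
    rw [matrix_ne_zero_iff]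
    have h1 : EdgeRule (A.rel b.marker) (A.rel c.marker) y z b.sign c.sign ↔
        EdgeRule (A.rel b.marker) (A.rel c.marker) (A.left v) (A.right v) b.sign c.sign := by
      rcases hyz with ⟨rfl, rfl⟩ | ⟨rfl, rfl⟩
      · rfl
      · exact ⟨EdgeRule.symm, EdgeRule.symm⟩
    rw [h1]
    constructor
    · rintro ⟨w, hw⟩
      obtain rfl : v = w := by
        by_contra hvw
        rw [hw.2.1, flipAt_of_ne _ hvw, hb] at hc
        simp at hc
      exact hw.2
    · exact fun h2 => ⟨v, hb, h2⟩
  have hset : ∀ {s : X → Bool} (t : T), InCube W s₀ s → t ∉ Y → ¬ A.rel s t y :=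
    fun t hs ht htr => h.notMem_of_rel hs htr ht hyY
  have hflip : ∀ {s : X → Bool}, InCube W s₀ s → InCube W s₀ (flipAt s v) :=
    fun hs => hs.trans (inCube_flipAt hv)
  refine exactOn_of_existsUnique (U := {S | S.marker v = false}) matrix_mul_matrix
    (fun _ _ => bidegree_eq) hsub (fun _ _ => matrix_mul_self) ?_ ?_
  · rintro ⟨s, ε, hε⟩ ⟨hbG, hb⟩
    obtain ⟨⟨hs, hfix⟩, hbm⟩ := (hG _).1 hbG
    have hsv : s v = true := by simpa using hb
    have hsv' : flipAt s v v = false := by rw [flipAt_self, hsv]; rfl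
    simp only at hs hfix hbm
    cases m
    -- For `m = false` the change at `v` splits `Z` off. Among the resulting terms exactly one has
    -- `Z` positive, and the other new circle then carries the sign of the old one; this is the
    -- matching.
    · have hm : Merges (A.rel (flipAt s v)) (A.rel s) y z :=
        (hor s).resolve_left fun hm => hsep _ (hflip hs) hsv' hm.rel
      have hi : ClassInvariant (A.rel (flipAt s v)) (setClass (A.rel (flipAt s v)) y true ε) :=
        (hm.classInvariant hε).setClass y true
      refine ⟨⟨flipAt s v, _, hi⟩, ⟨(hG _).2 ⟨⟨hflip hs, fun t ht => ?_⟩, ?_⟩, hsv'⟩, ?_, ?_⟩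
      · rw [← hfix t ht]
        exact setClass_of_not (hset t (hflip hs) ht) _ _
      · rintro ⟨-, h2⟩
        simp only [setClass_self] at h2
        simp at h2
      · rw [hrule _ _ hsv hsv']
        exact ⟨rfl, ((hm.edgeRule_split_of_true_iff hε hi).2 rfl).2⟩
      · rintro ⟨s', ε', hε'⟩ ⟨hcG, hc⟩ hne
        obtain ⟨rfl, hr⟩ := (hrule ⟨s, ε, hε⟩ ⟨s', ε', hε'⟩ hsv hc).1 hne
        have hy' : ε' y = true := by
          have := ((hG _).1 hcG).2
          simp only [hsv', true_and, Bool.not_eq_false] at this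
          exact this
        exact Enhanced.ext rfl ((hm.edgeRule_split_of_true_iff hε hε').1 ⟨hy', hr⟩)
    -- For `m = true` the change at `v` merges `Z` into another circle. Here `Z` is negative, which
    -- is the unit, so the other circle keeps its sign.
    · have hm : Merges (A.rel s) (A.rel (flipAt s v)) y z :=
        (hor s).resolve_right fun hm => hsep _ hs hsv hm.rel
      have hy : ε y = false := by simpa [hsv] using hbm
      have hi := hm.classInvariant_setClass hε (ε z)
      refine ⟨⟨flipAt s v, _, hi⟩, ⟨(hG _).2 ⟨⟨hflip hs, fun t ht => ?_⟩, ?_⟩, hsv'⟩, ?_, ?_⟩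
      · rw [← hfix t ht]
        exact setClass_of_not (hset t (hflip hs) ht) _ _
      · rintro ⟨h2, -⟩
        simp only [hsv'] at h2
        simp at h2
      · rw [hrule _ _ hsv hsv']
        exact ⟨rfl, (hm.edgeRule_iff_of_false hε hi hy).2 rfl⟩
      · rintro ⟨s', ε', hε'⟩ ⟨hcG, hc⟩ hne
        obtain ⟨rfl, hr⟩ := (hrule ⟨s, ε, hε⟩ ⟨s', ε', hε'⟩ hsv hc).1 hne
        exact Enhanced.ext rfl ((hm.edgeRule_iff_of_false hε hε' hy).1 hr)
  · rintro ⟨s', ε', hε'⟩ ⟨hcG, hc⟩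
    obtain ⟨⟨hs', hfix⟩, hcm⟩ := (hG _).1 hcG
    have hsv' : s' v = false := hc
    obtain ⟨s, rfl⟩ : ∃ s, s' = flipAt s v := ⟨flipAt s' v, (flipAt_flipAt s' v).symm⟩
    have hsv : s v = true := by
      rw [flipAt_self] at hsv'
      simpa using hsv'
    have hs : InCube W s₀ s := by
      have := hflip hs'
      rwa [flipAt_flipAt] at this
    simp only at hs' hfix hcm
    cases m
    · have hm : Merges (A.rel (flipAt s v)) (A.rel s) y z :=
        (hor s).resolve_left fun hm => hsep _ (hflip hs) hsv' hm.rel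
      have hzy : ¬ A.rel (flipAt s v) z y := fun h' => hm.1 ((A.rel _).symm h')
      have hy : ε' y = true := by simpa [hsv'] using hcm
      have hi : ClassInvariant (A.rel s) (setClass (A.rel (flipAt s v)) y (ε' z) ε') :=
        hm.classInvariant_of_eq (hε'.setClass _ _) (by rw [setClass_self, setClass_of_not hzy])
      refine ⟨⟨s, _, hi⟩, ⟨(hG _).2 ⟨⟨hs, fun t ht => ?_⟩, ?_⟩, ?_⟩, ?_, ?_⟩
      · rw [← hfix t ht]
        exact setClass_of_not (hset t (hflip hs) ht) _ _
      · rintro ⟨h2, -⟩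
        simp only [hsv] at h2
        simp at h2
      · simp [hsv]
      · rw [hrule _ _ hsv hsv']
        exact ⟨rfl, (hm.edgeRule_split_iff_of_true hi hε' hy).2 rfl⟩
      · rintro ⟨s₁, ε, hε⟩ ⟨hbG, hb⟩ hne
        have hsv₁ : s₁ v = true := by simpa using hb
        obtain ⟨h1, hr⟩ := (hrule ⟨s₁, ε, hε⟩ ⟨_, ε', hε'⟩ hsv₁ hc).1 hne
        obtain rfl : s = s₁ := by
          rw [← flipAt_flipAt s v, ← flipAt_flipAt s₁ v]
          exact congrArg (flipAt · v) h1
        exact Enhanced.ext rfl ((hm.edgeRule_split_iff_of_true hε hε' hy).1 hr)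
    · have hm : Merges (A.rel s) (A.rel (flipAt s v)) y z :=
        (hor s).resolve_right fun hm => hsep _ hs hsv hm.rel
      have hi : ClassInvariant (A.rel s) (setClass (A.rel s) y false ε') :=
        (hm.classInvariant hε').setClass y false
      have hri := (hm.edgeRule_of_false_iff hi hε').2 rfl
      refine ⟨⟨s, _, hi⟩, ⟨(hG _).2 ⟨⟨hs, fun t ht => ?_⟩, ?_⟩, ?_⟩, ?_, ?_⟩
      · rw [← hfix t ht]
        exact setClass_of_not (hset t hs ht) _ _
      · rintro ⟨-, h2⟩
        simp only [setClass_self] at h2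
        simp at h2
      · simp [hsv]
      · rw [hrule _ _ hsv hsv']
        exact ⟨rfl, hri.2⟩
      · rintro ⟨s₁, ε, hε⟩ ⟨hbG, hb⟩ hne
        have hsv₁ : s₁ v = true := by simpa using hb
        obtain ⟨h1, hr⟩ := (hrule ⟨s₁, ε, hε⟩ ⟨_, ε', hε'⟩ hsv₁ hc).1 hne
        obtain rfl : s = s₁ := by
          rw [← flipAt_flipAt s v, ← flipAt_flipAt s₁ v]
          exact congrArg (flipAt · v) h1
        have hy : ε y = false := by
          have := ((hG _).1 hbG).2
          simpa [hsv] using this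
        exact Enhanced.ext rfl ((hm.edgeRule_of_false_iff hε hε').1 ⟨hy, hr⟩)

end MarkerSystem

/-! ### Removing a circle cut off by a separating crossing -/

namespace MarkerSystem

variable {X T : Type*} [Fintype X] [LinearOrder X] [Fintype T] {A : MarkerSystem X T}
  {W : Finset X} {s₀ s : X → Bool} {v : X} {Y Z : Set T} {sg : T → Bool}

open Classical in
/-- Give the circle `Z` the sign `m`. -/
noncomputable def fixSign (Z : Set T) (m : Bool) (sg : T → Bool) : T → Bool :=
  fun t => if t ∈ Z then m else sg t

section Separated

variable {m : Bool} {y z : T}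

/-- At a separating crossing `v` with no other crossing on the side `Z`, which contains the
arc `y` but not the arc `z`, one passes to the marker `m` at `v` and removes `Z`. -/
structure EndCircle (A : MarkerSystem X T) (W : Finset X) (s₀ : X → Bool) (Y Z : Set T) (v : X)
    (m : Bool) (y z : T) : Prop where
  mem : v ∈ W
  subset : Z ⊆ Y
  arcs : (y = A.left v ∧ z = A.right v) ∨ (y = A.right v ∧ z = A.left v)
  left_mem : y ∈ Z
  right_notMem : z ∉ Z
  saturated : A.Saturated (W.erase v) (Function.update s₀ v m) Z
  notMem : ∀ w ∈ W.erase v, A.left w ∉ Z ∧ A.right w ∉ Z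

namespace EndCircle

theorem right_mem (h : A.EndCircle W s₀ Y Z v m y z) (hY : A.ConnectedOn W s₀ Y) : z ∈ Y := by
  rcases h.arcs with ⟨-, rfl⟩ | ⟨-, rfl⟩
  · exact hY.right_mem h.mem
  · exact hY.left_mem v h.mem

theorem mem_iff_rel (h : A.EndCircle W s₀ Y Z v m y z) (hY : A.ConnectedOn W s₀ Y)
    (hs : InCube W s₀ s) (hsv : s v = m) (t : T) : t ∈ Z ↔ A.rel s y t := by
  refine hY.mem_iff_rel_of_separates h.mem h.subset ⟨h.saturated, ?_⟩ h.notMem h.arcs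
    h.left_mem h.right_notMem ((inCube_erase_update h.mem m).2 ⟨hs, hsv⟩) t
  have := h.left_mem
  have := h.right_notMem
  rcases h.arcs with ⟨rfl, rfl⟩ | ⟨rfl, rfl⟩ <;> tauto

theorem not_rel (h : A.EndCircle W s₀ Y Z v m y z) (hY : A.ConnectedOn W s₀ Y)
    (hs : InCube W s₀ s) (hsv : s v = m) : ¬ A.rel s y z :=
  fun h' => h.right_notMem ((h.mem_iff_rel hY hs hsv z).2 h')

theorem merges (h : A.EndCircle W s₀ Y Z v m y z) (hY : A.ConnectedOn W s₀ Y)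
    (hs : InCube W s₀ s) (hsv : s v = !m) : Merges (A.rel (flipAt s v)) (A.rel s) y z := by
  have h1 : ¬ A.rel (flipAt s v) y z :=
    h.not_rel hY (hs.trans (inCube_flipAt h.mem)) (by rw [flipAt_self, hsv, Bool.not_not])
  have h2 : Merges (A.rel s) (A.rel (flipAt s v)) y z ∨
      Merges (A.rel (flipAt s v)) (A.rel s) y z := by
    rcases h.arcs with ⟨rfl, rfl⟩ | ⟨rfl, rfl⟩
    · exact A.merges_or s v
    · exact (A.merges_or s v).imp Merges.symm Merges.symm
  exact h2.resolve_left fun hm => h1 hm.rel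

/-- `Z` is attached to the rest only at `v`. A saturated set of the rest containing `z` becomes
saturated in the cube after adding `Z`; one without `z` is already saturated there, which is
impossible since it misses `y`. -/
theorem connectedOn (h : A.EndCircle W s₀ Y Z v m y z) (hY : A.ConnectedOn W s₀ Y) :
    A.ConnectedOn (W.erase v) (Function.update s₀ v m) (Y \ Z) where
  saturated := (hY.saturated.erase h.mem m).sdiff h.saturated
  left_mem := fun w hw => ⟨hY.left_mem w (Finset.mem_of_mem_erase hw), (h.notMem w hw).1⟩
  nonempty := ⟨z, h.right_mem hY, h.right_notMem⟩
  eq_of_subset := by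
    intro V hV hne hsat
    have hyV : y ∉ V := fun h' => (hV h').2 h.left_mem
    by_cases hzV : z ∈ V
    · have h1 : A.Saturated W s₀ (V ∪ Z) := by
        refine (hsat.union h.saturated).insert (inCube_update h.mem m) ?_
        have hy : y ∈ V ∪ Z := Or.inr h.left_mem
        have hz : z ∈ V ∪ Z := Or.inl hzV
        rcases h.arcs with ⟨rfl, rfl⟩ | ⟨rfl, rfl⟩ <;> simp only [hy, hz]
      have h2 := hY.eq_of_subset _ (Set.union_subset (hV.trans Set.sdiff_subset) h.subset)
        ⟨y, Or.inr h.left_mem⟩ h1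
      refine hV.antisymm fun t ht => ?_
      rw [← h2] at ht
      exact ht.1.resolve_right ht.2
    · exfalso
      have h1 : A.Saturated W s₀ V := by
        refine hsat.insert (inCube_update h.mem m) ?_
        rcases h.arcs with ⟨rfl, rfl⟩ | ⟨rfl, rfl⟩ <;> simp only [hyV, hzV]
      have h2 := hY.eq_of_subset _ (hV.trans Set.sdiff_subset) hne h1
      exact hyV (h2 ▸ h.subset h.left_mem)

theorem classCount_eq (h : A.EndCircle W s₀ Y Z v m y z) (hY : A.ConnectedOn W s₀ Y)
    (hs : InCube W s₀ s) (hsv : s v = m) :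
    classCount (A.rel s) (Y \ Z) = classCount (A.rel s) Y - 1 := by
  rw [classCount_sdiff h.subset, classCount_class (h.mem_iff_rel hY hs hsv)]

theorem classCount_flipAt_eq (h : A.EndCircle W s₀ Y Z v m y z) (hY : A.ConnectedOn W s₀ Y)
    (hs : InCube W s₀ s) (hsv : s v = !m) :
    classCount (A.rel (flipAt s v)) (Y \ Z) = classCount (A.rel s) Y := by
  rw [h.classCount_eq hY (hs.trans (inCube_flipAt h.mem))
    (by rw [flipAt_self, hsv, Bool.not_not]), (h.merges hY hs hsv).classCount_eq
    (hY.saturated.inCube hs).1 (h.subset h.left_mem)]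

/-- At the extreme state with marker `m` the circle `Z` is dropped. At the other one the change of
marker first splits `Z` off, so dropping it restores the count. Thus one circle and one crossing are
lost in total. -/
theorem thin (h : A.EndCircle W s₀ Y Z v m y z) (hY : A.Thin W s₀ Y) :
    A.Thin (W.erase v) (Function.update s₀ v m) (Y \ Z) := by
  refine ⟨h.connectedOn hY.toConnectedOn, ?_⟩
  have hc := hY.count
  have htop : topState W s₀ v = true := if_pos h.mem
  have hbot : botState W s₀ v = false := if_pos h.mem
  cases m
  · rw [topState_erase_false h.mem, botState_erase_false h.mem, Thin.card_erase h.mem,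
      h.classCount_eq hY.toConnectedOn inCube_botState hbot,
      h.classCount_flipAt_eq hY.toConnectedOn inCube_topState htop]
    linarith
  · rw [topState_erase_true h.mem, botState_erase_true h.mem, Thin.card_erase h.mem,
      h.classCount_eq hY.toConnectedOn inCube_topState htop,
      h.classCount_flipAt_eq hY.toConnectedOn inCube_botState hbot]
    linarith

theorem fixedSigns (h : A.EndCircle W s₀ Y Z v m y z) (hY : A.ConnectedOn W s₀ Y)
    (hsg : A.FixedSigns s₀ Y sg) :
    A.FixedSigns (Function.update s₀ v m) (Y \ Z) (fixSign Z m sg) := by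
  intro a b hab ha
  have hiff := h.saturated.mem_iff hab
  by_cases haZ : a ∈ Z
  · simp only [fixSign, haZ, hiff.1 haZ, if_true]
  · have haY : a ∉ Y := fun h' => ha ⟨h', haZ⟩
    simp only [fixSign, haZ, mt hiff.2 haZ, if_false]
    exact hY.fixedSigns hsg (inCube_update h.mem m) a b hab haY

/-- For `m = true` the top state is unchanged and `Z` keeps its positive sign. For `m = false` σ
drops by 2, while the new circle `Z` enters with negative sign and lowers 2τ by 2. This is why the
sign kept on `Z` is `m`. -/
theorem topDiagonal_eq (h : A.EndCircle W s₀ Y Z v m y z) (hY : A.ConnectedOn W s₀ Y)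
    (hsg : A.FixedSigns s₀ Y sg) :
    A.topDiagonal (W.erase v) (Function.update s₀ v m) (Y \ Z) (fixSign Z m sg)
      = A.topDiagonal W s₀ Y sg := by
  classical
  have htop : topState W s₀ v = true := if_pos h.mem
  have hoff : ∀ t, t ∉ Z → topValue (Y \ Z) (fixSign Z m sg) t = topValue Y sg t := by
    intro t ht
    simp [topValue, fixSign, ht]
  cases m
  · have hconn := h.connectedOn hY
    have hfix := h.fixedSigns hY hsg
    have hin : InCube (W.erase v) (Function.update s₀ v false) (flipAt (topState W s₀) v) := by
      rw [← topState_erase_false h.mem]; exact inCube_topState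
    have h1 := (h.merges hY inCube_topState htop).classSum_eq
      (topValue (Y \ Z) (fixSign Z false sg)) (topValue Y sg)
      (fun a b hab => hconn.topValue_eq hfix hin hab)
      (fun a b hab => hY.topValue_eq hsg inCube_topState hab)
      (fun t hty _ => (hoff t fun htZ => hty (((A.rel _).symm
        ((h.mem_iff_rel hY (inCube_topState.trans (inCube_flipAt h.mem))
          (by rw [flipAt_self, htop]; rfl) t).1 htZ)))).symm)
    have h2 : y ∈ Y := h.subset h.left_mem
    have h3 : z ∈ Y := h.right_mem hY
    have h4 := h.left_mem
    have h5 := h.right_notMem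
    have h6 : z ∈ Y \ Z := ⟨h3, h5⟩
    rw [topValue_of_mem h2, topValue_of_notMem (fun h' => h'.2 h4), topValue_of_mem h6,
      show signValue (fixSign Z false sg y) = -1 by simp [fixSign, h4, signValue]] at h1
    rw [topDiagonal, topDiagonal, topState_erase_false h.mem, markerSum_flipAt htop, h1]
    push_cast; ring
  · rw [topDiagonal, topDiagonal, topState_erase_true h.mem]
    congr 3
    funext t
    by_cases ht : t ∈ Z
    · simp [topValue, ht, h.subset ht, fixSign, signValue]
    · exact hoff t ht

theorem mem_cubeStates_iff (h : A.EndCircle W s₀ Y Z v m y z) (hY : A.ConnectedOn W s₀ Y)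
    (S : A.Enhanced) :
    S ∈ A.cubeStates (W.erase v) (Function.update s₀ v m) (Y \ Z) (fixSign Z m sg) ↔
      S ∈ A.cubeStates W s₀ Y sg ∧ S.marker v = m ∧ S.sign y = m := by
  simp only [cubeStates, Set.mem_ofPred_eq, inCube_erase_update h.mem]
  constructor
  · rintro ⟨⟨h1, h2⟩, h3⟩
    refine ⟨⟨h1, fun t ht => ?_⟩, h2, ?_⟩
    · have htZ : t ∉ Z := fun h' => ht (h.subset h')
      rw [h3 t fun h' => ht h'.1]
      simp [fixSign, htZ]
    · rw [h3 y fun h' => h'.2 h.left_mem]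
      simp [fixSign, h.left_mem]
  · rintro ⟨⟨h1, h3⟩, h2, h4⟩
    refine ⟨⟨h1, h2⟩, fun t ht => ?_⟩
    by_cases htZ : t ∈ Z
    · rw [← S.invariant y t ((h.mem_iff_rel hY h1 h2 t).1 htZ), h4]
      simp [fixSign, htZ]
    · rw [h3 t fun h' => ht ⟨h', htZ⟩]
      simp [fixSign, htZ]

/-- Edges at other crossings preserve the sign of the circle `Z`. -/
theorem sign_eq (h : A.EndCircle W s₀ Y Z v m y z) {b c : A.Enhanced} {w : X}
    (hb : b ∈ A.cubeStates W s₀ Y sg) (hbv : b.marker v = m) (hw : w ∈ W) (hwv : w ≠ v)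
    (hi : Incidence w b c) : c.sign y = b.sign y := by
  have hw' : w ∈ W.erase v := Finset.mem_erase.2 ⟨hwv, hw⟩
  exact hi.sign_eq (h.saturated.inCube ((inCube_erase_update h.mem m).2 ⟨hb.1, hbv⟩)).1
    h.left_mem (h.notMem w hw').1 (h.notMem w hw').2

/-- The states with marker `m` at `v` and sign `m` on `Z` form the smaller cube. They are a
subcomplex or a quotient according to `m`, and the complementary part is acyclic. -/
theorem onTwoDiagonals (h : A.EndCircle W s₀ Y Z v m y z) (hY : A.ConnectedOn W s₀ Y)
    (hsg : A.FixedSigns s₀ Y sg)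
    (ih : A.OnTwoDiagonals (W.erase v) (Function.update s₀ v m) (Y \ Z) (fixSign Z m sg)) :
    A.OnTwoDiagonals W s₀ Y sg := by
  intro i j hij hij'
  have h0 := ih i j (by rwa [h.topDiagonal_eq hY hsg]) (by rwa [h.topDiagonal_eq hY hsg])
  have hsep : ∀ s, InCube W s₀ s → s v = m → ¬ A.rel s y z := fun s hs hsv => h.not_rel hY hs hsv
  have hsub := hY.isSubquotient (sg := sg)
  cases m
  -- A negative marker at `v` never changes again and the other crossings do not touch `Z`, so the
  -- kept states form a subcomplex.
  · have hUW : ∀ b ∈ A.cubeStates W s₀ Y sg ∩ {S | S.marker v = false ∧ S.sign y = false},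
        ∀ c ∈ A.cubeStates W s₀ Y sg \ {S | S.marker v = false ∧ S.sign y = false},
        matrix b c = 0 := by
      rintro b ⟨hb, hbv, hby⟩ c ⟨hc, hcU⟩
      by_contra hne
      obtain ⟨w, hw, hi⟩ := exists_incidence_of_mem hb hc hne
      have hwv : w ≠ v := by
        rintro rfl
        rw [hi.1] at hbv
        simp at hbv
      refine hcU ⟨?_, ?_⟩
      · rw [hi.2.1, flipAt_of_ne _ hwv.symm, hbv]
      · rw [h.sign_eq hb hbv hw hwv hi, hby]
    refine ExactOn.extension (U := {S | S.marker v = false ∧ S.sign y = false}) matrix_mul_matrix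
      (fun _ _ => bidegree_eq) sourceDegree_injective hsub hUW ?_ ?_
    · convert h0 using 1
      ext S
      rw [h.mem_cubeStates_iff hY]; rfl
    · exact hY.exactOn_complement h.mem h.arcs hsep (fun S => Iff.rfl) (hsub.sdiff hUW) _
  -- A positive marker at `v` in the target was already positive in the source, with the same sign
  -- on `Z`. So nothing maps into the kept states from outside, and they form the quotient.
  · have hUW : ∀ b ∈ A.cubeStates W s₀ Y sg ∩ {S | ¬ (S.marker v = true ∧ S.sign y = true)},
        ∀ c ∈ A.cubeStates W s₀ Y sg \ {S | ¬ (S.marker v = true ∧ S.sign y = true)},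
        matrix b c = 0 := by
      rintro b ⟨hb, hbU⟩ c ⟨hc, hcU⟩
      by_contra hne
      obtain ⟨hcv, hcy⟩ : c.marker v = true ∧ c.sign y = true := by
        by_contra h'; exact hcU h'
      obtain ⟨w, hw, hi⟩ := exists_incidence_of_mem hb hc hne
      have hwv : w ≠ v := by
        rintro rfl
        rw [hi.2.1, flipAt_self, hi.1] at hcv
        simp at hcv
      have hbv : b.marker v = true := by
        rwa [hi.2.1, flipAt_of_ne _ hwv.symm] at hcv
      exact hbU ⟨hbv, by rw [← h.sign_eq hb hbv hw hwv hi, hcy]⟩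
    refine ExactOn.extension (U := {S | ¬ (S.marker v = true ∧ S.sign y = true)})
      matrix_mul_matrix (fun _ _ => bidegree_eq) sourceDegree_injective hsub hUW ?_ ?_
    · exact hY.exactOn_complement h.mem h.arcs hsep (fun S => Iff.rfl) (hsub.inter hUW) _
    · convert h0 using 1
      ext S
      rw [h.mem_cubeStates_iff hY]
      simp

end EndCircle

end Separated

/-- The homology of a thin cube lies on two adjacent diagonals. -/
theorem Thin.onTwoDiagonals (h : A.Thin W s₀ Y) (hsg : A.FixedSigns s₀ Y sg) :
    A.OnTwoDiagonals W s₀ Y sg := by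
  induction hn : W.card generalizing W s₀ Y sg with
  | zero =>
    obtain rfl : W = ∅ := Finset.card_eq_zero.1 hn
    exact h.toConnectedOn.onTwoDiagonals_of_empty hsg
  | succ n ih =>
    have hcard : ∀ v ∈ W, (W.erase v).card = n := fun v hv => by
      rw [Finset.card_erase_of_mem hv, hn]; rfl
    by_cases hm : ∃ v ∈ W, A.MergesAtEnds W s₀ v
    · obtain ⟨v, hv, hm⟩ := hm
      exact h.toConnectedOn.onTwoDiagonals_of_merges hsg hv hm fun m =>
        ih (h.erase hv hm m) (h.toConnectedOn.fixedSigns hsg (inCube_update hv m)) (hcard v hv)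
    · have hW : W.Nonempty := Finset.card_pos.1 (by rw [hn]; exact Nat.succ_pos n)
      obtain ⟨v, hv, m, Z, hZ, hsep, hno⟩ :=
        h.exists_separates_forall_notMem hW fun v hv hm' => hm ⟨v, hv, hm'⟩
      obtain ⟨y, z, he⟩ : ∃ y z, A.EndCircle W s₀ Y Z v m y z := by
        by_cases hl : A.left v ∈ Z
        · exact ⟨_, _, hv, hZ, Or.inl ⟨rfl, rfl⟩, hl, fun hr => hsep.2 (by simp only [hl, hr]),
            hsep.1, hno⟩
        · have hr : A.right v ∈ Z := by
            by_contra hr; exact hsep.2 (by simp only [hl, hr])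
          exact ⟨_, _, hv, hZ, Or.inr ⟨rfl, rfl⟩, hr, hl, hsep.1, hno⟩
      exact he.onTwoDiagonals h.toConnectedOn hsg
        (ih (he.thin h) (he.fixedSigns h.toConnectedOn hsg) (hcard v hv))

end MarkerSystem

/-! ### Cycles of a permutation after multiplication with a transposition -/

section SwapMul

variable {α : Type*} [Finite α] [DecidableEq α]

/-- Since `h ^ n` fixes `x`, every power can be reduced modulo `n`, and the first `n` points exhaust
the cycle of `x`. -/
theorem not_sameCycle_of_pow_eq {h : Equiv.Perm α} {x y : α} {n : ℕ} (hn : 0 < n)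
    (hx : (h ^ n) x = x) (hy : ∀ k < n, (h ^ k) x ≠ y) : ¬ h.SameCycle x y := by
  intro hc
  obtain ⟨k, -, hk⟩ := hc.exists_pow_eq'
  apply hy (k % n) (Nat.mod_lt k hn)
  rw [← hk]
  conv_rhs => rw [← Nat.mod_add_div k n, pow_add, pow_mul, Equiv.Perm.mul_apply]
  have : ∀ m : ℕ, ((h ^ n) ^ m) x = x := by
    intro m
    induction m with
    | zero => rfl
    | succ m ih => rw [pow_succ, Equiv.Perm.mul_apply, hx, ih]
  rw [this]

/-- Multiplication with the transposition of `x` and `y` merges the cycles of `x` and `y`, or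
splits their common cycle. -/
theorem sameCycle_swap_mul_iff (g : Equiv.Perm α) {x y : α} (hxy : x ≠ y) :
    (Equiv.swap x y * g).SameCycle x y ↔ ¬ g.SameCycle x y := by
  -- Follow the orbit of `x` until it first meets `{x, y}` again. Up to then the transposition has
  -- no effect; at that moment it exchanges the outcomes "back at `x`" and "arrived at `y`".
  have hex : ∃ n, 0 < n ∧ ((g ^ n) x = x ∨ (g ^ n) x = y) :=
    ⟨orderOf g, orderOf_pos g, Or.inl (by rw [pow_orderOf_eq_one]; rfl)⟩
  obtain ⟨hn, hnx⟩ := Nat.find_spec hex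
  have hmin := fun k hk => Nat.find_min hex (m := k) hk
  set n := Nat.find hex
  have hlt : ∀ k < n, ((Equiv.swap x y * g) ^ k) x = (g ^ k) x := by
    intro k
    induction k with
    | zero => intro _; rfl
    | succ k ih =>
      intro hk
      have h1 := hmin (k + 1) hk
      rw [pow_succ', Equiv.Perm.mul_apply, ih (by omega), pow_succ', Equiv.Perm.mul_apply,
        Equiv.Perm.mul_apply]
      rw [pow_succ', Equiv.Perm.mul_apply] at h1
      exact Equiv.swap_apply_of_ne_of_ne (fun h => h1 ⟨by omega, Or.inl h⟩)
        fun h => h1 ⟨by omega, Or.inr h⟩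
  have hne : ∀ k < n, (g ^ k) x ≠ y := by
    intro k hk h
    rcases Nat.eq_zero_or_pos k with rfl | h0
    · exact hxy h
    · exact hmin k hk ⟨h0, Or.inr h⟩
  have hend : ((Equiv.swap x y * g) ^ n) x = Equiv.swap x y ((g ^ n) x) := by
    obtain ⟨m, hm⟩ : ∃ m, n = m + 1 := ⟨n - 1, by omega⟩
    have h1 := hlt m (by omega)
    rw [hm, pow_succ', Equiv.Perm.mul_apply, h1, pow_succ', Equiv.Perm.mul_apply,
      Equiv.Perm.mul_apply]
  rcases hnx with h | h
  · rw [h, Equiv.swap_apply_left] at hend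
    exact iff_of_true ⟨n, by rw [zpow_natCast]; exact hend⟩ (not_sameCycle_of_pow_eq hn h hne)
  · rw [h, Equiv.swap_apply_right] at hend
    refine iff_of_false (not_sameCycle_of_pow_eq hn hend fun k hk => ?_) (not_not.2 ⟨n, ?_⟩)
    · rw [hlt k hk]; exact hne k hk
    · rw [zpow_natCast]; exact h

end SwapMul

theorem classSum_ker {T C : Type*} [Fintype T] [Fintype C] (p : T → C)
    (hp : Function.Surjective p) (f : C → ℚ) :
    classSum (Setoid.ker p) (fun t => f (p t)) = ∑ c, f c := by
  classical
  rw [classSum, ← Finset.sum_fiberwise _ p]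
  refine Finset.sum_congr rfl fun c _ => ?_
  obtain ⟨a, rfl⟩ := hp c
  have h := sum_class (Setoid.ker p) (fun t => f (p t)) a
    fun t (ht : p a = p t) => by rw [ht]
  rw [← h]
  refine Finset.sum_congr ?_ fun _ _ => rfl
  ext t
  simp only [Finset.mem_filter, Finset.mem_univ, true_and]
  exact eq_comm

theorem merges_of_le {T : Type*} {r r' : Setoid T} {a b : T} (hab : ¬ r a b) (hab' : r' a b)
    (hle : ∀ x y, r x y → r' x y)
    (hge : ∀ x y, r' x y → r x y ∨ ((r x a ∨ r x b) ∧ (r y a ∨ r y b))) : Merges r r' a b := by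
  refine ⟨hab, fun x y => ⟨hge x y, ?_⟩⟩
  rintro (h | ⟨hx, hy⟩)
  · exact hle x y h
  · have hx' : r' x a := hx.elim (hle x a) fun h => r'.trans (hle x b h) (r'.symm hab')
    have hy' : r' y a := hy.elim (hle y a) fun h => r'.trans (hle y b h) (r'.symm hab')
    exact r'.trans hx' (r'.symm hy')

namespace LinkDiagram

/-! ### The circles of a link diagram -/

variable {X : Type*} [Fintype X] (D : LinkDiagram X)

/-- The arms of the diagram and its crossingless components. -/
abbrev Point : Type _ := (X × Fin 4) ⊕ Fin D.circles

/-- The circle of `D_s` through a point. -/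
def pointCircle (s : X → Bool) : D.Point → D.Circle s :=
  Sum.elim (D.circleOf s) (D.freeCircle s)

theorem pointCircle_surjective (s : X → Bool) : Function.Surjective (D.pointCircle s) := by
  rintro (q | f)
  · obtain ⟨a, rfl⟩ := Quot.exists_rep q
    exact ⟨Sum.inl a, rfl⟩
  · exact ⟨Sum.inr f, rfl⟩

/-- Being on the same circle of `D_s`. -/
def circleSetoid (s : X → Bool) : Setoid D.Point := Setoid.ker (D.pointCircle s)

/-- The next arm on the same circle. -/
def ArmStep (s : X → Bool) (a b : X × Fin 4) : Prop :=
  b = D.glue a ∨ b = (a.1, smoothArm (s a.1) a.2)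

variable {D} {s : X → Bool}

theorem circleSetoid_inl_iff {a b : X × Fin 4} :
    D.circleSetoid s (Sum.inl a) (Sum.inl b) ↔ Relation.EqvGen (D.ArmStep s) a b := by
  rw [← Quot.eq]
  exact Sum.inl_injective.eq_iff

theorem not_circleSetoid_inr_inl {f : Fin D.circles} {a : X × Fin 4} :
    ¬ D.circleSetoid s (Sum.inr f) (Sum.inl a) := fun h => Sum.inr_ne_inl h

theorem circleSetoid_glue (a : X × Fin 4) :
    D.circleSetoid s (Sum.inl a) (Sum.inl (D.glue a)) :=
  circleSetoid_inl_iff.2 (.rel _ _ (Or.inl rfl))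

theorem circleSetoid_smooth (x : X) (k : Fin 4) :
    D.circleSetoid s (Sum.inl (x, k)) (Sum.inl (x, smoothArm (s x) k)) :=
  circleSetoid_inl_iff.2 (.rel _ _ (Or.inr rfl))

/-- Each arm at a crossing is joined to the arm `0` or to the arm `2`. -/
theorem circleSetoid_arm (v : X) (k : Fin 4) :
    D.circleSetoid s (Sum.inl (v, k)) (Sum.inl (v, 0)) ∨
      D.circleSetoid s (Sum.inl (v, k)) (Sum.inl (v, 2)) := by
  have h := circleSetoid_smooth (D := D) (s := s) v k
  have hrefl := fun a => (D.circleSetoid s).refl (Sum.inl a)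
  fin_cases k
  · exact Or.inl (hrefl _)
  · cases hs : s v
    · rw [hs] at h; exact Or.inr h
    · rw [hs] at h; exact Or.inl h
  · exact Or.inr (hrefl _)
  · cases hs : s v
    · rw [hs] at h; exact Or.inl h
    · rw [hs] at h; exact Or.inr h

/-- The other smoothing at `v` at most merges the circles of the arms `0` and `2` at `v`. -/
theorem circleSetoid_of_flipAt [DecidableEq X] {v : X} {x y : D.Point}
    (h : D.circleSetoid (flipAt s v) x y) :
    D.circleSetoid s x y ∨
      ((D.circleSetoid s x (Sum.inl (v, 0)) ∨ D.circleSetoid s x (Sum.inl (v, 2))) ∧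
        (D.circleSetoid s y (Sum.inl (v, 0)) ∨ D.circleSetoid s y (Sum.inl (v, 2)))) := by
  rcases x with a | f
  · rcases y with b | g
    · rw [circleSetoid_inl_iff] at h
      induction h with
      | rel a b hab =>
        rcases hab with rfl | rfl
        · exact Or.inl (circleSetoid_glue a)
        · obtain ⟨x, k⟩ := a
          by_cases hx : x = v
          · subst hx
            exact Or.inr ⟨circleSetoid_arm x k, circleSetoid_arm x _⟩
          · left
            simp only [flipAt_of_ne s hx]
            exact circleSetoid_smooth x k
      | refl a => exact Or.inl ((D.circleSetoid s).refl _)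
      | symm a b _ ih => exact ih.imp (D.circleSetoid s).symm And.symm
      | trans a b c _ _ ih1 ih2 =>
        have ht := fun {p q r : D.Point} (h : D.circleSetoid s p q) (h' : D.circleSetoid s q r) =>
          (D.circleSetoid s).trans h h'
        rcases ih1 with h1 | ⟨h1, h1'⟩
        · rcases ih2 with h2 | ⟨h2, h2'⟩
          · exact Or.inl (ht h1 h2)
          · exact Or.inr ⟨h2.imp (ht h1) (ht h1), h2'⟩
        · rcases ih2 with h2 | ⟨h2, h2'⟩
          · have h3 := (D.circleSetoid s).symm h2
            exact Or.inr ⟨h1, h1'.imp (ht h3) (ht h3)⟩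
          · exact Or.inr ⟨h1, h2'⟩
    · exact absurd h.symm not_circleSetoid_inr_inl
  · rcases y with b | g
    · exact absurd h not_circleSetoid_inr_inl
    · left
      have : f = g := Sum.inr_injective h
      rw [this]

/-- Going back from the flipped state, a relation of `s` can only add a link between the circles of
the arms `0` and `2`, and these are already joined after the flip. -/
theorem merges_of_not_rel [DecidableEq X] {v : X}
    (h : ¬ D.circleSetoid s (Sum.inl (v, 0)) (Sum.inl (v, 2)))
    (h' : D.circleSetoid (flipAt s v) (Sum.inl (v, 0)) (Sum.inl (v, 2))) :
    Merges (D.circleSetoid s) (D.circleSetoid (flipAt s v)) (Sum.inl (v, 0)) (Sum.inl (v, 2)) := by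
  refine merges_of_le h h' (fun x y hxy => ?_) fun x y => circleSetoid_of_flipAt
  rw [← flipAt_flipAt s v] at hxy
  have hs := fun {p q : D.Point} (h : D.circleSetoid (flipAt s v) p q) =>
    (D.circleSetoid (flipAt s v)).symm h
  have ht := fun {p q r : D.Point} (h : D.circleSetoid (flipAt s v) p q)
    (h' : D.circleSetoid (flipAt s v) q r) => (D.circleSetoid (flipAt s v)).trans h h'
  rcases circleSetoid_of_flipAt hxy with h1 | ⟨hx, hy⟩
  · exact h1
  · have hx' := hx.elim id fun h => ht h (hs h')
    have hy' := hy.elim id fun h => ht h (hs h')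
    exact ht hx' (hs hy')

theorem smoothArm_smoothArm (m : Bool) (k : Fin 4) : smoothArm m (smoothArm m k) = k := by
  revert m k; decide

/-- The permutation of the arms given by the edges. -/
def gluePerm (D : LinkDiagram X) : Equiv.Perm (X × Fin 4) where
  toFun := D.glue
  invFun := D.glue
  left_inv := D.glue_glue
  right_inv := D.glue_glue

/-- The permutation of the arms given by the smoothing. -/
def smoothPerm (s : X → Bool) : Equiv.Perm (X × Fin 4) where
  toFun a := (a.1, smoothArm (s a.1) a.2)
  invFun a := (a.1, smoothArm (s a.1) a.2)
  left_inv a := by simp [smoothArm_smoothArm]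
  right_inv a := by simp [smoothArm_smoothArm]

theorem isOver_smooth (s : X → Bool) (a : X × Fin 4) :
    IsOver (a.1, smoothArm (s a.1) a.2) ↔ ¬ IsOver a := by
  have : ∀ (m : Bool) (k : Fin 4), (smoothArm m k = 1 ∨ smoothArm m k = 3) ↔ ¬ (k = 1 ∨ k = 3) := by
    decide
  exact this _ _

instance (a : X × Fin 4) : Decidable (IsOver a) := by unfold IsOver; infer_instance

/-- The arms on the under-strands. -/
abbrev UnderArm (X : Type*) : Type _ := {a : X × Fin 4 // ¬ IsOver a}

/-- For an alternating diagram: the next arm on an under-strand on the same circle. -/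
def circlePerm (hD : D.Alternating) (s : X → Bool) : Equiv.Perm (UnderArm X) :=
  (smoothPerm s * D.gluePerm).subtypePerm fun a => by
    have h1 := isOver_smooth s (D.glue a)
    have h2 := hD a
    change ¬ IsOver ((D.glue a).1, smoothArm (s (D.glue a).1) (D.glue a).2) ↔ ¬ IsOver a
    tauto

theorem circlePerm_apply (hD : D.Alternating) (s : X → Bool) (a : UnderArm X) :
    (circlePerm hD s a : X × Fin 4)
      = ((D.glue a.1).1, smoothArm (s (D.glue a.1).1) (D.glue a.1).2) := rfl

/-- The arm itself or the arm joined to it, whichever lies on the under-strand. -/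
def toUnderArm (s : X → Bool) (a : X × Fin 4) : UnderArm X :=
  if h : IsOver a then ⟨(a.1, smoothArm (s a.1) a.2), by rw [isOver_smooth]; exact not_not.2 h⟩
  else ⟨a, h⟩

theorem toUnderArm_of_not {a : X × Fin 4} (h : ¬ IsOver a) : toUnderArm s a = ⟨a, h⟩ := dif_neg h

theorem coe_toUnderArm_of_isOver {a : X × Fin 4} (h : IsOver a) :
    (toUnderArm s a : X × Fin 4) = (a.1, smoothArm (s a.1) a.2) := by
  rw [toUnderArm, dif_pos h]

theorem toUnderArm_smooth (a : X × Fin 4) :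
    toUnderArm s (a.1, smoothArm (s a.1) a.2) = toUnderArm s a := by
  have h1 := isOver_smooth s a
  by_cases h : IsOver a
  · rw [toUnderArm_of_not (mt h1.1 (not_not.2 h))]
    exact Subtype.ext (coe_toUnderArm_of_isOver h).symm
  · refine Subtype.ext ?_
    rw [coe_toUnderArm_of_isOver (h1.2 h), toUnderArm_of_not h]
    simp [smoothArm_smoothArm]

theorem circlePerm_toUnderArm (hD : D.Alternating) {a : X × Fin 4} (h : ¬ IsOver a) :
    circlePerm hD s (toUnderArm s a) = toUnderArm s (D.glue a) := by
  refine Subtype.ext ?_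
  rw [coe_toUnderArm_of_isOver ((hD a).2 h), circlePerm_apply, toUnderArm_of_not h]

/-- Along a circle, edges and smoothing arcs alternate, and each of the two exchanges over- and
under-arms. Leaving every under-arm along its edge thus orients the circle, and `circlePerm` is the
return map to the under-arms. -/
theorem sameCycle_iff (hD : D.Alternating) (a b : UnderArm X) :
    (circlePerm hD s).SameCycle a b ↔ D.circleSetoid s (Sum.inl a.1) (Sum.inl b.1) := by
  constructor
  · intro h
    obtain ⟨n, -, rfl⟩ := h.exists_pow_eq'
    clear h
    induction n with
    | zero => exact (D.circleSetoid s).refl _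
    | succ n ih =>
      rw [pow_succ', Equiv.Perm.mul_apply]
      refine (D.circleSetoid s).trans ih ((D.circleSetoid s).trans (circleSetoid_glue _) ?_)
      rw [circlePerm_apply]
      exact circleSetoid_smooth _ _
  · rw [circleSetoid_inl_iff]
    intro h
    have key : ∀ {a b : X × Fin 4}, Relation.EqvGen (D.ArmStep s) a b →
        (circlePerm hD s).SameCycle (toUnderArm s a) (toUnderArm s b) := by
      intro a b h
      induction h with
      | rel a b hab =>
        rcases hab with rfl | rfl
        · by_cases ha : IsOver a
          · have h1 : ¬ IsOver (D.glue a) := fun h => (hD a).1 h ha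
            have h2 := circlePerm_toUnderArm (s := s) hD h1
            rw [D.glue_glue] at h2
            rw [← h2]
            exact Equiv.Perm.sameCycle_apply_left.2 (Equiv.Perm.SameCycle.refl _ _)
          · rw [← circlePerm_toUnderArm hD ha]
            exact Equiv.Perm.sameCycle_apply_right.2 (Equiv.Perm.SameCycle.refl _ _)
        · rw [toUnderArm_smooth]
      | refl a => exact Equiv.Perm.SameCycle.refl _ _
      | symm a b _ ih => exact ih.symm
      | trans a b c _ _ ih1 ih2 => exact ih1.trans ih2
    have h1 := key h
    rwa [toUnderArm_of_not a.2, toUnderArm_of_not b.2] at h1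

theorem not_isOver_zero (v : X) : ¬ IsOver ((v, 0) : X × Fin 4) := by
  simp [IsOver]

theorem not_isOver_two (v : X) : ¬ IsOver ((v, 2) : X × Fin 4) := by
  simp [IsOver]

theorem smoothArm_not (m : Bool) {k : Fin 4} (hk : k = 1 ∨ k = 3) :
    smoothArm (!m) k = Equiv.swap 0 2 (smoothArm m k) := by
  rcases hk with rfl | rfl <;> revert m <;> decide

/-- `circlePerm` applies the smoothing only to over-arms, and the two smoothings of an over-arm at
`v` end at the arms `0` and `2` in exchanged roles. -/
theorem circlePerm_flipAt [DecidableEq X] (hD : D.Alternating) (v : X) :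
    circlePerm hD (flipAt s v)
      = Equiv.swap ⟨(v, 0), not_isOver_zero v⟩ ⟨(v, 2), not_isOver_two v⟩ * circlePerm hD s := by
  refine Equiv.ext fun a => Subtype.ext ?_
  have hover : IsOver (D.glue a.1) := (hD a.1).2 a.2
  rw [Equiv.Perm.mul_apply]
  have hcoe : ∀ b : UnderArm X, ((Equiv.swap ⟨(v, 0), not_isOver_zero v⟩
      ⟨(v, 2), not_isOver_two v⟩ b : UnderArm X) : X × Fin 4)
      = Equiv.swap (v, 0) (v, 2) b.1 := by
    intro b
    simp only [Equiv.swap_apply_def, Subtype.ext_iff]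
    split_ifs <;> rfl
  rw [hcoe, circlePerm_apply, circlePerm_apply]
  generalize D.glue a.1 = c at hover
  obtain ⟨x, k⟩ := c
  by_cases hx : x = v
  · subst hx
    rw [flipAt_self, smoothArm_not _ hover]
    simp only [Equiv.swap_apply_def, Prod.mk.injEq, true_and]
    split_ifs <;> rfl
  · rw [flipAt_of_ne _ hx, Equiv.swap_apply_of_ne_of_ne]
    · exact fun h => hx (congrArg Prod.fst h)
    · exact fun h => hx (congrArg Prod.fst h)

/-- The circles of the smoothings of an alternating diagram. -/
def markerSystem [DecidableEq X] (hD : D.Alternating) : MarkerSystem X D.Point where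
  rel := D.circleSetoid
  left v := Sum.inl (v, 0)
  right v := Sum.inl (v, 2)
  merges_or s v := by
    -- The transposition law says that the arms `0` and `2` share a circle in exactly one of the two
    -- states, so no change of marker keeps the number of circles.
    have h1 := sameCycle_swap_mul_iff (circlePerm hD s)
      (x := ⟨(v, 0), not_isOver_zero v⟩) (y := ⟨(v, 2), not_isOver_two v⟩) (by simp)
    rw [← circlePerm_flipAt, sameCycle_iff, sameCycle_iff] at h1
    by_cases h : D.circleSetoid s (Sum.inl (v, 0)) (Sum.inl (v, 2))
    · have h2 := merges_of_not_rel (D := D) (s := flipAt s v) (v := v)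
        (fun h' => h1.1 h' h) (by rwa [flipAt_flipAt])
      rw [flipAt_flipAt] at h2
      exact Or.inr h2
    · exact Or.inl (merges_of_not_rel h (h1.2 h))

end LinkDiagram

namespace LinkDiagram

variable {X : Type*} [Fintype X] {D : LinkDiagram X} {s : X → Bool}

/-! ### Faces of an alternating diagram -/

variable (D) in
/-- The circles of `D_s` which pass through crossings. -/
abbrev ArmCircle (s : X → Bool) : Type _ := Quot (D.ArmStep s)

variable (D) in
theorem numCircles_eq (s : X → Bool) :
    D.numCircles s = Nat.card (D.ArmCircle s) + D.circles := by
  have : D.numCircles s = Nat.card (D.ArmCircle s ⊕ Fin D.circles) := rfl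
  rw [this, Nat.card_sum, Nat.card_eq_fintype_card (α := Fin D.circles), Fintype.card_fin]

theorem smoothArm_true_of_isOver {k : Fin 4} (hk : k = 1 ∨ k = 3) : smoothArm true k = k - 1 := by
  rcases hk with rfl | rfl <;> decide

theorem smoothArm_false_of_not {k : Fin 4} (hk : ¬ (k = 1 ∨ k = 3)) :
    smoothArm false k = k - 1 := by
  revert k; decide

theorem smoothArm_true_sub_one {k : Fin 4} (hk : ¬ (k = 1 ∨ k = 3)) :
    smoothArm true k - 1 = k := by
  revert k; decide

theorem smoothArm_false_sub_one {k : Fin 4} (hk : k = 1 ∨ k = 3) : smoothArm false k - 1 = k := by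
  rcases hk with rfl | rfl <;> decide

theorem isOver_sub_one (x : X) (k : Fin 4) : IsOver (x, k - 1) ↔ ¬ IsOver (x, k) := by
  have : ∀ k : Fin 4, (k - 1 = 1 ∨ k - 1 = 3) ↔ ¬ (k = 1 ∨ k = 3) := by decide
  exact this k

theorem armCircle_glue (a : X × Fin 4) :
    (Quot.mk _ (D.glue a) : D.ArmCircle s) = Quot.mk _ a :=
  (Quot.sound (r := D.ArmStep s) (Or.inl rfl)).symm

theorem armCircle_smooth (a : X × Fin 4) :
    (Quot.mk _ (a.1, smoothArm (s a.1) a.2) : D.ArmCircle s) = Quot.mk _ a :=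
  (Quot.sound (r := D.ArmStep s) (Or.inr rfl)).symm

theorem armCircle_true_of_isOver {a : X × Fin 4} (ha : IsOver a) :
    (Quot.mk _ (a.1, a.2 - 1) : D.ArmCircle fun _ => true) = Quot.mk _ a := by
  rw [← armCircle_smooth a, smoothArm_true_of_isOver ha]

theorem armCircle_false_of_not {a : X × Fin 4} (ha : ¬ IsOver a) :
    (Quot.mk _ (a.1, a.2 - 1) : D.ArmCircle fun _ => false) = Quot.mk _ a := by
  rw [← armCircle_smooth a, smoothArm_false_of_not ha]

theorem face_glue (a : X × Fin 4) : D.face ((D.glue a).1, (D.glue a).2 - 1) = D.face a :=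
  (Quot.sound (r := fun a b => b = D.nextCorner a) rfl).symm

theorem face_of_glue (a : X × Fin 4) : D.face (D.glue a) = D.face (a.1, a.2 - 1) := by
  have := face_glue (D := D) (D.glue a)
  rw [D.glue_glue] at this
  exact this.symm

/-- The circle of the state with equal markers around a face. -/
def faceToCircle (hD : D.Alternating) :
    D.Face → D.ArmCircle (fun _ => true) ⊕ D.ArmCircle (fun _ => false) :=
  Quot.lift (fun a => if IsOver a then Sum.inr (Quot.mk _ a) else Sum.inl (Quot.mk _ a)) <| by
    rintro a b hab
    obtain rfl : b = ((D.glue a).1, (D.glue a).2 - 1) := hab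
    -- Crossing an edge and passing from `k` to `k - 1` each exchange over and under, so all corners
    -- of a face have one type, which selects the state whose circle runs around the face.
    have h1 := isOver_sub_one (D.glue a).1 (D.glue a).2
    have h2 := hD a
    by_cases ha : IsOver a
    · have hg : ¬ IsOver (D.glue a) := fun h => h2.1 h ha
      rw [if_pos ha, if_pos (h1.2 hg)]
      congr 1
      rw [armCircle_false_of_not hg, armCircle_glue]
    · have hg : IsOver (D.glue a) := h2.2 ha
      rw [if_neg ha, if_neg (fun h => h1.1 h hg)]
      congr 1
      rw [armCircle_true_of_isOver hg, armCircle_glue]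

/-- The face around which a circle of the positive state runs. -/
def positiveCircleToFace (hD : D.Alternating) : D.ArmCircle (fun _ => true) → D.Face :=
  Quot.lift (fun a => if IsOver a then D.face (a.1, a.2 - 1) else D.face a) <| by
    rintro a b (rfl | rfl)
    · have h2 := hD a
      by_cases ha : IsOver a
      · rw [if_pos ha, if_neg fun h => h2.1 h ha, face_of_glue]
      · rw [if_neg ha, if_pos (h2.2 ha), face_glue]
    · have h2 := isOver_smooth (fun _ => true) a
      by_cases ha : IsOver a
      · rw [if_pos ha, if_neg fun h => h2.1 h ha, smoothArm_true_of_isOver ha]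
      · rw [if_neg ha, if_pos (h2.2 ha), smoothArm_true_sub_one ha]

/-- The face around which a circle of the negative state runs. -/
def negativeCircleToFace (hD : D.Alternating) : D.ArmCircle (fun _ => false) → D.Face :=
  Quot.lift (fun a => if IsOver a then D.face a else D.face (a.1, a.2 - 1)) <| by
    rintro a b (rfl | rfl)
    · have h2 := hD a
      by_cases ha : IsOver a
      · rw [if_pos ha, if_neg fun h => h2.1 h ha, face_glue]
      · rw [if_neg ha, if_pos (h2.2 ha), face_of_glue]
    · have h2 := isOver_smooth (fun _ => false) a
      by_cases ha : IsOver a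
      · rw [if_pos ha, if_neg fun h => h2.1 h ha, smoothArm_false_sub_one ha]
      · rw [if_neg ha, if_pos (h2.2 ha), smoothArm_false_of_not ha]

theorem faceToCircle_face (hD : D.Alternating) (a : X × Fin 4) : faceToCircle hD (D.face a)
    = if IsOver a then Sum.inr (Quot.mk _ a) else Sum.inl (Quot.mk _ a) := rfl

theorem positiveCircleToFace_mk (hD : D.Alternating) (a : X × Fin 4) :
    positiveCircleToFace hD (Quot.mk _ a)
      = if IsOver a then D.face (a.1, a.2 - 1) else D.face a := rfl

theorem negativeCircleToFace_mk (hD : D.Alternating) (a : X × Fin 4) :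
    negativeCircleToFace hD (Quot.mk _ a)
      = if IsOver a then D.face a else D.face (a.1, a.2 - 1) := rfl

/-- The faces of an alternating diagram are bounded by the circles of the two states with
equal markers. -/
def faceEquiv (hD : D.Alternating) :
    D.Face ≃ D.ArmCircle (fun _ => true) ⊕ D.ArmCircle (fun _ => false) where
  toFun := faceToCircle hD
  invFun := Sum.elim (positiveCircleToFace hD) (negativeCircleToFace hD)
  left_inv := by
    intro f
    obtain ⟨a, rfl⟩ : ∃ a, D.face a = f := Quot.exists_rep f
    rw [faceToCircle_face]
    by_cases ha : IsOver a
    · rw [if_pos ha, Sum.elim_inr, negativeCircleToFace_mk, if_pos ha]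
    · rw [if_neg ha, Sum.elim_inl, positiveCircleToFace_mk, if_neg ha]
  right_inv := by
    rintro (q | q) <;> obtain ⟨a, rfl⟩ := Quot.exists_rep q
    · rw [Sum.elim_inl, positiveCircleToFace_mk]
      by_cases ha : IsOver a
      · rw [if_pos ha, faceToCircle_face, if_neg fun h => (isOver_sub_one a.1 a.2).1 h ha,
          armCircle_true_of_isOver ha]
      · rw [if_neg ha, faceToCircle_face, if_neg ha]
    · rw [Sum.elim_inr, negativeCircleToFace_mk]
      by_cases ha : IsOver a
      · rw [if_pos ha, faceToCircle_face, if_pos ha]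
      · rw [if_neg ha, faceToCircle_face, if_pos ((isOver_sub_one a.1 a.2).2 ha),
          armCircle_false_of_not ha]

/-- Circles through crossings are counted by the faces, hence by Euler's formula. A crossingless
component counts once in each state, that is, twice, just like a component of the graph in that
formula. -/
theorem sPlus_add_sMinus (hD : D.Alternating) (hN : D.NonSplit) :
    D.sPlus + D.sMinus = Fintype.card X + 2 := by
  have h1 := D.euler
  have h2 : Nat.card D.Face = Nat.card (D.ArmCircle fun _ => true)
      + Nat.card (D.ArmCircle fun _ => false) := by
    rw [Nat.card_congr (faceEquiv hD), Nat.card_sum]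
  have h3 : Nat.card (Quot fun x y : X => ∃ i, (D.glue (x, i)).1 = y) + D.circles = 1 := by
    have h4 : Nat.card ((Quot fun x y : X => ∃ i, (D.glue (x, i)).1 = y) ⊕ Fin D.circles) = 1 := hN
    rwa [Nat.card_sum, Nat.card_eq_fintype_card (α := Fin D.circles), Fintype.card_fin] at h4
  have h5 : Nat.card D.Face = Fintype.card X
      + 2 * Nat.card (Quot fun x y : X => ∃ i, (D.glue (x, i)).1 = y) := h1
  rw [sPlus, sMinus, numCircles_eq, numCircles_eq]
  omega

/-! ### The whole cube of a non-split diagram -/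

variable [LinearOrder X]

theorem pointNonempty (hN : D.NonSplit) : Nonempty D.Point := by
  obtain ⟨-, ⟨p⟩⟩ := Nat.card_eq_one_iff_unique.1 hN
  rcases p with ⟨⟨x⟩⟩ | f
  · exact ⟨Sum.inl (x, 0)⟩
  · exact ⟨Sum.inr f⟩

/-- A saturated set contains all four arms at a crossing or none, and it contains both ends of an
edge or neither; so it spreads over the connected diagram. -/
theorem eq_univ_of_saturated (hD : D.Alternating) (hN : D.NonSplit) {Z : Set D.Point}
    (hne : Z.Nonempty) (hZ : (markerSystem hD).Saturated Finset.univ s Z) : Z = Set.univ := by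
  have hmem : ∀ {p q : D.Point}, D.circleSetoid s p q → (p ∈ Z ↔ q ∈ Z) := fun h => hZ.mem_iff h
  have h02 : ∀ x, Sum.inl (x, 0) ∈ Z ↔ Sum.inl (x, 2) ∈ Z := fun x => hZ.2 x (Finset.mem_univ x)
  have harm : ∀ x k, Sum.inl (x, k) ∈ Z ↔ Sum.inl (x, 0) ∈ Z := by
    intro x k
    rcases circleSetoid_arm (D := D) (s := s) x k with h | h
    · exact hmem h
    · rw [h02]; exact hmem h
  have hcross : ∀ {x y : X}, Relation.EqvGen (fun x y : X => ∃ i, (D.glue (x, i)).1 = y) x y →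
      (Sum.inl (x, 0) ∈ Z ↔ Sum.inl (y, 0) ∈ Z) := by
    intro x y h
    induction h with
    | rel x y h =>
      obtain ⟨i, rfl⟩ := h
      rw [← harm x i, hmem (circleSetoid_glue (x, i))]
      exact harm _ _
    | refl x => rfl
    | symm x y _ ih => exact ih.symm
    | trans x y z _ _ ih1 ih2 => exact ih1.trans ih2
  have hsub : Subsingleton D.Piece := (Nat.card_eq_one_iff_unique.1 hN).1
  obtain ⟨p, hp⟩ := hne
  refine Set.eq_univ_of_forall fun q => ?_
  rcases p with ⟨x, k⟩ | f <;> rcases q with ⟨y, l⟩ | g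
  · have h1 : (Sum.inl (Quot.mk _ x) : D.Piece) = Sum.inl (Quot.mk _ y) := hsub.elim _ _
    rw [harm, ← hcross (Quot.eq.1 (Sum.inl_injective h1)), ← harm x k]
    exact hp
  · have h1 : (Sum.inl (Quot.mk _ x) : D.Piece) = Sum.inr g := hsub.elim _ _
    exact absurd h1 Sum.inl_ne_inr
  · have h1 : (Sum.inl (Quot.mk _ y) : D.Piece) = Sum.inr f := hsub.elim _ _
    exact absurd h1 Sum.inl_ne_inr
  · have h1 : (Sum.inr f : D.Piece) = Sum.inr g := hsub.elim _ _
    rw [← Sum.inr_injective h1]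
    exact hp

theorem classSum_circleSetoid (s : X → Bool) (f : D.Circle s → ℚ) :
    let _ := Fintype.ofFinite (D.Circle s)
    classSum (D.circleSetoid s) (fun p => f (D.pointCircle s p)) = ∑ c, f c :=
  let _ := Fintype.ofFinite (D.Circle s)
  classSum_ker _ (D.pointCircle_surjective s) f

theorem classSum_one (s : X → Bool) :
    classSum (D.circleSetoid s) (fun _ => 1) = D.numCircles s := by
  let _ := Fintype.ofFinite (D.Circle s)
  rw [classSum_circleSetoid s fun _ => 1]
  simp [numCircles, Nat.card_eq_fintype_card]

theorem classCount_univ_eq (s : X → Bool) :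
    classCount (D.circleSetoid s) Set.univ = D.numCircles s := by
  rw [← classSum_one, classCount]
  simp

open MarkerSystem

theorem topState_univ (s : X → Bool) : topState Finset.univ s = fun _ => true :=
  funext fun x => if_pos (Finset.mem_univ x)

theorem botState_univ (s : X → Bool) : botState Finset.univ s = fun _ => false :=
  funext fun x => if_pos (Finset.mem_univ x)

theorem thin_markerSystem (hD : D.Alternating) (hN : D.NonSplit) (s : X → Bool) :
    (markerSystem hD).Thin Finset.univ s Set.univ where
  saturated := ⟨fun _ _ _ _ => trivial, fun _ _ => Iff.rfl⟩
  left_mem := fun _ _ => trivial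
  nonempty := (pointNonempty hN).elim fun p => ⟨p, trivial⟩
  eq_of_subset := fun _ _ hne hZ => eq_univ_of_saturated hD hN hne hZ
  count := by
    rw [topState_univ, botState_univ]
    have h1 := classCount_univ_eq (D := D) fun _ => true
    have h2 := classCount_univ_eq (D := D) fun _ => false
    have h3 := sPlus_add_sMinus hD hN
    change classCount (D.circleSetoid _) _ + classCount (D.circleSetoid _) _ = _
    rw [h1, h2, Finset.card_univ]
    exact_mod_cast h3

theorem topDiagonal_markerSystem (hD : D.Alternating) (s : X → Bool) (sg : D.Point → Bool) :
    (markerSystem hD).topDiagonal Finset.univ s Set.univ sg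
      = 2 * (D.sPlus : ℚ) - Fintype.card X := by
  rw [topDiagonal, topState_univ]
  have h1 : topValue Set.univ sg = fun _ => 1 := funext fun t => topValue_of_mem trivial
  have h2 := classSum_one (D := D) fun _ => true
  rw [h1]
  change 2 * classSum (D.circleSetoid _) _ - _ = _
  rw [h2]
  simp [markerSum, sPlus]

/-! ### Comparison of the chain complexes -/

/-- The enhanced states of the diagram are those of its system of circles. -/
noncomputable def enhancedEquiv (hD : D.Alternating) : D.EnhancedState ≃ (markerSystem hD).Enhanced where
  toFun S := ⟨S.marker, fun p => S.sign (D.pointCircle S.marker p), fun _ _ h => congrArg S.sign h⟩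
  invFun S := ⟨S.marker, fun c => S.sign (Function.surjInv (D.pointCircle_surjective S.marker) c)⟩
  left_inv S := by
    simp only [Function.surjInv_eq]
  right_inv S := by
    refine Enhanced.ext rfl (funext fun p => ?_)
    exact S.invariant _ _ (Function.surjInv_eq (D.pointCircle_surjective S.marker) _)

theorem sigma_eq (S : D.EnhancedState) : S.sigma = markerSum S.marker := by
  rw [EnhancedState.sigma, markerSum, Finset.sum_ite, Finset.sum_const, Finset.sum_const]
  simp [sub_eq_add_neg]

theorem tau_eq (S : D.EnhancedState) :
    (S.tau : ℚ) = signSum (D.circleSetoid S.marker) fun p => S.sign (D.pointCircle S.marker p) := by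
  let _ := Fintype.ofFinite (D.Circle S.marker)
  rw [signSum, classSum_circleSetoid S.marker fun c => signValue (S.sign c), EnhancedState.tau]
  simp only [signValue, Nat.card_eq_fintype_card, Fintype.card_subtype]
  rw [Finset.sum_ite, Finset.sum_const, Finset.sum_const]
  simp [sub_eq_add_neg]

theorem bidegree_enhancedEquiv (hD : D.Alternating) (S : D.EnhancedState) :
    bidegree (enhancedEquiv hD S) = (S.sigma, (S.sigma : ℚ) + 2 * S.tau) := by
  rw [sigma_eq, tau_eq]; rfl

theorem hasDegree_iff (hD : D.Alternating) (S : D.EnhancedState) (i j : ℤ) :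
    S.HasDegree i j ↔ bidegree (enhancedEquiv hD S) = (i, (j : ℚ)) := by
  rw [bidegree_enhancedEquiv, Prod.mk.injEq, EnhancedState.HasDegree]
  norm_cast

/-- The bidegree condition splits in two: a drop of σ by 2 says that the marker at `v` was positive,
and then constancy of σ + 2τ says that τ grows by one, as `EdgeRule` requires. -/
theorem incident_iff (hD : D.Alternating) (v : X) (S S' : D.EnhancedState) :
    Incident v S S' ↔ Incidence v (enhancedEquiv hD S) (enhancedEquiv hD S') := by
  have hmarker : (∀ x, S.marker x ≠ S'.marker x ↔ x = v) ↔ S'.marker = flipAt S.marker v := by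
    constructor
    · intro h
      funext x
      by_cases hx : x = v
      · subst hx
        have := (h x).2 rfl
        rw [flipAt_self]
        revert this
        cases S.marker x <;> cases S'.marker x <;> simp
      · rw [flipAt_of_ne _ hx]
        exact (not_not.1 (mt (h x).1 hx)).symm
    · intro h x
      rw [h]
      by_cases hx : x = v
      · subst hx; simp [flipAt_self]
      · simp [flipAt_of_ne, hx]
  have hsigma : S'.marker = flipAt S.marker v →
      (S'.sigma = S.sigma - 2 ↔ S.marker v = true) := by
    intro h
    rw [sigma_eq, sigma_eq, h]
    cases hv : S.marker v
    · have h1 := markerSum_flipAt (s := flipAt S.marker v) (v := v) (by rw [flipAt_self, hv]; rfl)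
      rw [flipAt_flipAt] at h1
      simp only [Bool.false_eq_true, iff_false]
      omega
    · simp [markerSum_flipAt hv]
  have htau : signSum (D.circleSetoid S'.marker) (fun p => S'.sign (D.pointCircle S'.marker p))
      = signSum (D.circleSetoid S.marker) (fun p => S.sign (D.pointCircle S.marker p)) + 1
      ↔ S'.tau = S.tau + 1 := by
    rw [← tau_eq, ← tau_eq]
    norm_cast
  have hsign : ((∀ a, (∀ k, D.circleOf S.marker (v, k) ≠ D.circleOf S.marker a) →
      S.sign (D.circleOf S.marker a) = S'.sign (D.circleOf S'.marker a)) ∧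
      ∀ f, S.sign (D.freeCircle S.marker f) = S'.sign (D.freeCircle S'.marker f)) ↔
      ∀ p, ¬ D.circleSetoid S.marker p (Sum.inl (v, 0)) →
        ¬ D.circleSetoid S.marker p (Sum.inl (v, 2)) →
        S'.sign (D.pointCircle S'.marker p) = S.sign (D.pointCircle S.marker p) := by
    constructor
    · rintro ⟨h1, h2⟩ (a | f) h0 h2'
      · refine (h1 a fun k hk => ?_).symm
        have hk' : D.circleSetoid S.marker (Sum.inl a) (Sum.inl (v, k)) := hk.symm
        rcases circleSetoid_arm (D := D) (s := S.marker) v k with h | h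
        · exact h0 ((D.circleSetoid _).trans hk' h)
        · exact h2' ((D.circleSetoid _).trans hk' h)
      · exact (h2 f).symm
    · intro h
      refine ⟨fun a ha => (h (Sum.inl a) (fun h' => ha 0 ?_) fun h' => ha 2 ?_).symm, fun f =>
        (h (Sum.inr f) not_circleSetoid_inr_inl not_circleSetoid_inr_inl).symm⟩
      · exact Eq.symm h'
      · exact Eq.symm h'
  rw [Incident, hmarker, hsign, EnhancedState.HasDegree]
  change _ ↔ S.marker v = true ∧ S'.marker = flipAt S.marker v ∧ (∀ p,
    ¬ D.circleSetoid S.marker p (Sum.inl (v, 0)) → ¬ D.circleSetoid S.marker p (Sum.inl (v, 2)) →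
    S'.sign (D.pointCircle S'.marker p) = S.sign (D.pointCircle S.marker p)) ∧
    signSum (D.circleSetoid S'.marker) (fun p => S'.sign (D.pointCircle S'.marker p))
      = signSum (D.circleSetoid S.marker) (fun p => S.sign (D.pointCircle S.marker p)) + 1
  rw [htau]
  constructor
  · rintro ⟨⟨h1, h2⟩, h3, h4⟩
    exact ⟨(hsigma h3).1 h1, h3, h4, by omega⟩
  · rintro ⟨h1, h2, h3, h4⟩
    have h5 := (hsigma h2).2 h1
    exact ⟨⟨h5, by omega⟩, h2, h3⟩

theorem coeff_eq (hD : D.Alternating) (S S' : D.EnhancedState) :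
    coeff S S' = matrix (enhancedEquiv hD S) (enhancedEquiv hD S') := by
  classical
  rw [coeff, matrix]
  refine Finset.sum_congr rfl fun v _ => ?_
  exact if_congr (incident_iff hD v S S') rfl rfl

theorem d_apply (z : D.EnhancedState →₀ ℤ) (S' : D.EnhancedState) :
    D.d z S' = ∑ S, z S * coeff S S' := by
  classical
  rw [linearMap_apply_eq_sum]
  refine Finset.sum_congr rfl fun S _ => ?_
  rw [d, Finsupp.linearCombination_single, one_smul, Finsupp.finsetSum_apply,
    Finset.sum_eq_single S']
  · simp
  · intro c _ hc
    rw [Finsupp.single_apply, if_neg hc]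
  · simp

/-- The Khovanov homology of a non-split alternating diagram lies on two adjacent diagonals. -/
theorem subsingleton_homology (hD : D.Alternating) (hN : D.NonSplit) {i j : ℤ}
    (h1 : j - 2 * i ≠ 2 * (D.sPlus : ℤ) - Fintype.card X)
    (h2 : j - 2 * i ≠ 2 * (D.sPlus : ℤ) - Fintype.card X - 4) :
    Subsingleton (D.Homology i j) := by
  classical
  rw [Submodule.Quotient.subsingleton_iff, Submodule.submoduleOf_eq_top]
  rintro z ⟨hz, hdz⟩
  set e := enhancedEquiv hD
  -- All crossings and all circles are free, so the reference state and the reference signs impose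
  -- no condition.
  have hex := (thin_markerSystem hD hN fun _ => true).onTwoDiagonals (sg := fun _ => true)
    (fun _ _ _ _ => rfl) i j
    (by rw [topDiagonal_markerSystem]; exact_mod_cast h1)
    (by rw [topDiagonal_markerSystem]; exact_mod_cast h2)
  have hmem : ∀ S, S ∈ (markerSystem hD).cubeStates Finset.univ (fun _ => true) Set.univ
      fun _ => true :=
    fun S => ⟨fun x hx => absurd (Finset.mem_univ x) hx, fun t ht => absurd trivial ht⟩
  obtain ⟨y, hy, hyz⟩ := hex (fun S => z (e.symm S))
    (fun S hS => ⟨hmem S, by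
      have h3 := hz (Finsupp.mem_support_iff.2 hS)
      rw [← e.apply_symm_apply S]
      exact (hasDegree_iff hD _ i j).1 h3⟩)
    (fun c _ => by
      have h3 := DFunLike.congr_fun (LinearMap.mem_ker.1 hdz) (e.symm c)
      rw [d_apply] at h3
      rw [← e.sum_comp]
      simpa [coeff_eq hD, e] using h3)
  refine ⟨Finsupp.equivFunOnFinite.symm fun S => y (e S), ?_, ?_⟩
  · intro S hS
    have h3 : y (e S) ≠ 0 := by simpa using hS
    have h4 := (hy _ h3).2
    rw [sourceDegree] at h4
    exact (hasDegree_iff hD S (i + 2) j).2 h4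
  · ext S'
    rw [d_apply]
    have h3 := hyz (e S') (hmem _)
    rw [← e.sum_comp] at h3
    simpa [coeff_eq hD, e] using h3

end LinkDiagram

theorem corollaryX5p5 {X : Type*} [Fintype X] [LinearOrder X] (D : LinkDiagram X)
    (hAlternating : D.Alternating) (hNonSplit : D.NonSplit)
    (hNugatory : ∀ c : X, ¬ D.Nugatory c) :
    D.HThickPair 0 0 ∧ D.HThick 1 ∧
      2 * (D.sPlus : ℤ) - Fintype.card X = (Fintype.card X : ℤ) - 2 * D.sMinus + 4 ∧
      ∀ i j : ℤ, Nontrivial (D.Homology i j) →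
        j - 2 * i = (Fintype.card X : ℤ) - 2 * D.sMinus ∨
          j - 2 * i = 2 * (D.sPlus : ℤ) - Fintype.card X := by
  have hcount := LinkDiagram.sPlus_add_sMinus hAlternating hNonSplit
  have hthick : D.HThickPair 0 0 := fun i j hij =>
    LinkDiagram.subsingleton_homology hAlternating hNonSplit (by omega) (by omega)
  refine ⟨hthick, ⟨0, 0, hthick, ?_⟩, by omega, fun i j hne => ?_⟩
  -- The excess |s₊| + |s₋| - N is 2, and half of it is the thickness 1.
  · have h : (D.sPlus : ℚ) + D.sMinus = Fintype.card X + 2 := by exact_mod_cast hcount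
    rw [h]
    norm_num
  · by_contra hcon
    exact not_subsingleton _
      (LinkDiagram.subsingleton_homology hAlternating hNonSplit (i := i) (j := j)
        (by omega) (by omega))
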